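/- Let $\gamma$ be a simple closed regular real-analytic curve in $\mathbb{R}^2$ bounding a strictly convex compact region $\Omega_\gamma$ with $0\in\Omega_\gamma$. For $\xi\neq 0$ let $x_\gamma(\xi)$ be the unique point of $\gamma$ at which the outer unit normal is $\xi/\|\xi\|$, and put $Y_\gamma(\xi)=\langle \xi,x_\gamma(\xi)\rangle$. Let $\mathscr{S}_2=SL_2(\mathbb{R})/SL_2(\mathbb{Z})$ be the space of unimodular lattices of $\mathbb{R}^2$ (the class of $g$ being the lattice $g\mathbb{Z}^2$), let $\mu_2$ be its $SL_2(\mathbb{R})$-invariant probability measure, and let $\tilde\mu_2$ be a probability measure with a smooth bounded density with respect to $\mu_2$; the expectation $\mathbb{E}$ and laws are taken for $L$ distributed according to $\tilde\mu_2$. For almost every $L$ let $(e_1(L),e_2(L))$ be the unique pair of vectors of $L$ with positive first coordinates such that $\|e_i(L)\|=\|L\|_i$ for $i=1,2$, where $\|L\|_i$ is the least $r>0$ such that the closed ball of radius $r$ centred at $0$ contains $i$ linearly independent vectors of $L$. Let $$\Pi=\{(k_1,k_2)\in\mathbb{Z}^2 : \gcd(k_1,k_2)=1,\ k_1\ge 0,\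 \text{and } k_2=1 \text{ if } k_1=0\}.$$ For $k=(k_1,k_2)\in\Pi\cup(-\Pi)$ and $t\in\mathbb{R}$ let $\theta_k(L,t)=t\,Y_\gamma(k_1e_1(L)+k_2e_2(L)) \bmod 1\in\mathbb{R}/\mathbb{Z}$, and let $e(\theta)=\exp(2\pi i\theta)$. (1) For every $l\ge 1$, every $\psi\in C_c^\infty(\mathscr{S}_2)$, all distinct $k_1,\dots,k_l\in\Pi$ and all $(p_1,\dots,p_l)\in\mathbb{Z}^l\setminus\{0\}$, $$\mathbb{E}\Big(\psi(L)\,e\Big(\sum_{h=1}^l p_h\theta_{k_h}(L,t)\Big)\Big)\to 0\qquad (t\to\infty).$$ Consequently $(L,(\theta_k(L,t))_{k\in\Pi})$ converges in distribution, as $t\to\infty$, to $\tilde\mu_2\otimes\lambda^{\otimes\Pi}$, where $\lambda$ is the normalized Lebesgue measure on $\mathbb{R}/\mathbb{Z}$; that is, the phases become independent, uniformly distributed on $\mathbb{R}/\mathbb{Z}$ and independent of $L$. (2) Suppose that $\Omega_\gamma$ has no centre of symmetry. Then for every $l\ge 1$, every $\psi\in C_c^\infty(\mathscr{S}_2)$,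 all distinct $k_1,\dots,k_l\in\Pi$ and all $(p_{-l},\dots,p_{-1},p_1,\dots,p_l)\in\mathbb{Z}^{2l}\setminus\{0\}$, $$\mathbb{E}\Big(\psi(L)\,e\Big(\sum_{h=1}^l p_h\theta_{k_h}(L,t)+\sum_{h=1}^l p_{-h}\theta_{-k_h}(L,t)\Big)\Big)\to 0\qquad (t\to\infty).$$ Consequently $(L,(\theta_k(L,t))_{k\in\Pi},(\theta_{-k}(L,t))_{k\in\Pi})$ converges in distribution to $\tilde\mu_2\otimes\lambda^{\otimes\Pi}\otimes\lambda^{\otimes\Pi}$. -/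

import Mathlib

open MeasureTheory Filter Topology Matrix
open scoped ContDiff

noncomputable section

/-- The Euclidean plane `ℝ²`. -/
abbrev Plane : Type := EuclideanSpace ℝ (Fin 2)

/-! ### Analytic strictly convex curves and the function `Y_γ` -/

/-- `γ` (parametrised with period `1`) is a simple, closed, regular real-analytic curve, which bounds
the strictly convex compact region `Ω`, and this region contains the origin. -/
structure IsAnalyticOval (γ : ℝ → Plane) (Ω : Set Plane) : Prop where
  analytic : AnalyticOnNhd ℝ γ Set.univ
  regular : ∀ s, deriv γ s ≠ 0
  periodic : Function.Periodic γ 1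
  simple : Set.InjOn γ (Set.Ico 0 1)
  isCompact : IsCompact Ω
  strictConvex : StrictConvex ℝ Ω
  frontier_eq : frontier Ω = Set.range γ
  zero_mem : (0 : Plane) ∈ Ω

/-- `u` is the outer unit normal at the point `x` of the convex curve `γ`: the curve lies in the
closed half-plane bounded by the line through `x` orthogonal to `u`, on the side of `-u`. -/
def IsOuterNormalAt (γ : ℝ → Plane) (x u : Plane) : Prop :=
  x ∈ Set.range γ ∧ ‖u‖ = 1 ∧ ∀ s, inner ℝ u (γ s - x) ≤ 0

/-- `x_γ(ξ)`: the point of `γ` at which the outer unit normal is `ξ / ‖ξ‖`. -/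
def contactPoint (γ : ℝ → Plane) (ξ : Plane) : Plane :=
  Classical.epsilon fun x => IsOuterNormalAt γ x (‖ξ‖⁻¹ • ξ)

/-- For `ξ ≠ 0` there is exactly one such point. -/
theorem IsAnalyticOval.existsUnique_contactPoint {γ : ℝ → Plane} {Ω : Set Plane}
    (h : IsAnalyticOval γ Ω) {ξ : Plane} (hξ : ξ ≠ 0) :
    ∃! x, IsOuterNormalAt γ x (‖ξ‖⁻¹ • ξ) := by
  set u : Plane := ‖ξ‖⁻¹ • ξ with hu
  have hn : ‖u‖ = 1 := by
    rw [hu, norm_smul, norm_inv, norm_norm, inv_mul_cancel₀ (norm_ne_zero_iff.mpr hξ)]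
  have hcont : Continuous fun y : Plane => (inner ℝ u y : ℝ) := by fun_prop
  -- a maximiser of the linear form on `Ω` is not an interior point
  have hfr : ∀ x ∈ Ω, (∀ y ∈ Ω, (inner ℝ u y : ℝ) ≤ inner ℝ u x) → x ∉ interior Ω := by
    intro x _ hmax hint
    have hc : Continuous fun r : ℝ => x + r • u := by fun_prop
    have h0 : ∀ᶠ r : ℝ in 𝓝 0, x + r • u ∈ Ω := by
      have := hc.continuousAt (x := (0 : ℝ))
      apply this
      simpa using mem_interior_iff_mem_nhds.mp hint
    have h1 : ∀ᶠ r : ℝ in 𝓝[>] 0, x + r • u ∈ Ω ∧ r ∈ Set.Ioi (0 : ℝ) :=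
      (h0.filter_mono nhdsWithin_le_nhds).and self_mem_nhdsWithin
    obtain ⟨r, hrΩ, hr⟩ := h1.exists
    have := hmax _ hrΩ
    rw [inner_add_right, inner_smul_right, real_inner_self_eq_norm_sq, hn] at this
    have hr' : (0 : ℝ) < r := hr
    linarith
  have hclosed : closure Ω = Ω := h.isCompact.isClosed.closure_eq
  obtain ⟨x, hxΩ, hx⟩ := h.isCompact.exists_isMaxOn ⟨0, h.zero_mem⟩ hcont.continuousOn
  have hx' : ∀ y ∈ Ω, (inner ℝ u y : ℝ) ≤ inner ℝ u x := fun y hy => hx hy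
  have hγΩ : ∀ s, γ s ∈ Ω := fun s => by
    have : γ s ∈ frontier Ω := h.frontier_eq ▸ Set.mem_range_self s
    exact hclosed ▸ frontier_subset_closure this
  have hxγ : x ∈ Set.range γ := by
    rw [← h.frontier_eq]
    exact ⟨hclosed.symm ▸ hxΩ, hfr x hxΩ hx'⟩
  refine ⟨x, ⟨hxγ, hn, fun s => ?_⟩, ?_⟩
  · rw [inner_sub_right]
    linarith [hx' _ (hγΩ s)]
  · rintro y ⟨⟨s, rfl⟩, -, hy⟩
    by_contra hne
    obtain ⟨s', hs'⟩ := hxγ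
    have h1 : (inner ℝ u x : ℝ) ≤ inner ℝ u (γ s) := by
      have := hy s'
      rw [hs', inner_sub_right] at this
      linarith
    have hmid := h.strictConvex (hγΩ s) hxΩ hne (a := 1 / 2) (b := 1 / 2)
      (by norm_num) (by norm_num) (by norm_num)
    refine hfr _ (interior_subset hmid) (fun z hz => ?_) hmid
    rw [inner_add_right, inner_smul_right, inner_smul_right]
    linarith [hx' z hz]

/-- `Y_γ(ξ) = ⟨ξ, x_γ(ξ)⟩`. -/
def curveY (γ : ℝ → Plane) (ξ : Plane) : ℝ := inner ℝ ξ (contactPoint γ ξ)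

/-- `Ω` has a centre of symmetry. -/
def HasCenterOfSymmetry (Ω : Set Plane) : Prop :=
  ∃ c : Plane, ∀ x ∈ Ω, (2 : ℝ) • c - x ∈ Ω

/-! ### The space of unimodular lattices -/

/-- `SL₂(ℝ)`. -/
abbrev SL2R : Type := Matrix.SpecialLinearGroup (Fin 2) ℝ

/-- `SL₂(ℤ)` as a subgroup of `SL₂(ℝ)`. -/
def SL2Z : Subgroup SL2R :=
  (Matrix.SpecialLinearGroup.map (n := Fin 2) (Int.castRingHom ℝ)).range

/-- The space `𝒮₂ = SL₂(ℝ) / SL₂(ℤ)` of unimodular lattices of the plane, with the quotient topology;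
the class of `g` is the lattice `g ℤ²`. -/
abbrev LatticeSpace : Type := SL2R ⧸ SL2Z

instance : MeasurableSpace LatticeSpace := borel LatticeSpace
instance : BorelSpace LatticeSpace := ⟨rfl⟩

instance : SecondCountableTopology SL2R :=
  haveI : SecondCountableTopology (Matrix (Fin 2) (Fin 2) ℝ) :=
    inferInstanceAs (SecondCountableTopology (Fin 2 → Fin 2 → ℝ))
  Matrix.SpecialLinearGroup.isClosedEmbedding_val.isEmbedding.secondCountableTopology

instance : SecondCountableTopology LatticeSpace :=
  ContinuousConstSMul.secondCountableTopology

/-- The set of vectors of the lattice `L`. -/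
def latticeVectors (L : LatticeSpace) : Set Plane :=
  {v | ∃ g : SL2R, (g : LatticeSpace) = L ∧
    ∃ n : Fin 2 → ℤ, v = WithLp.toLp 2 (g.1 *ᵥ fun i => (n i : ℝ))}

/-- Smooth functions on `𝒮₂`: the lift to `SL₂(ℝ)` is a smooth function on this closed submanifold of
the space of `2 × 2` matrices, i.e. the restriction of a smooth function of the matrix entries. -/
def IsSmoothOnLattices {F : Type*} [NormedAddCommGroup F] [NormedSpace ℝ F]
    (f : LatticeSpace → F) : Prop :=
  ∃ G : (Fin 2 → Fin 2 → ℝ) → F, ContDiff ℝ ∞ G ∧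
    ∀ g : SL2R, f (g : LatticeSpace) = G fun i j => g.1 i j

/-- `‖L‖_i`: the least `r > 0` such that the closed ball `B(0, r)` contains `i` linearly independent
vectors of `L`. -/
def successiveMin (i : ℕ) (L : LatticeSpace) : ℝ :=
  sInf {r : ℝ | 0 < r ∧ ∃ v : Fin i → Plane,
    (∀ j, v j ∈ latticeVectors L ∧ ‖v j‖ ≤ r) ∧ LinearIndependent ℝ v}

/-- `e = (e₁, e₂)` is a pair of vectors of `L` with positive first coordinates which realise the two
successive minima of `L`. For almost every `L` there is exactly one such pair. -/
def IsMinimalPair (L : LatticeSpace) (e : Plane × Plane) : Prop :=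
  e.1 ∈ latticeVectors L ∧ e.2 ∈ latticeVectors L ∧ 0 < e.1 0 ∧ 0 < e.2 0 ∧
    ‖e.1‖ = successiveMin 1 L ∧ ‖e.2‖ = successiveMin 2 L

/-- The pair `(e₁(L), e₂(L))` (an arbitrary choice on the null set where it is not unique). -/
def minimalPair (L : LatticeSpace) : Plane × Plane :=
  Classical.epsilon (IsMinimalPair L)

/-- The vector `k₁ e₁(L) + k₂ e₂(L)`. -/
def latticeVec (k : ℤ × ℤ) (L : LatticeSpace) : Plane :=
  (k.1 : ℝ) • (minimalPair L).1 + (k.2 : ℝ) • (minimalPair L).2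

/-! ### The phases -/

/-- `Π`: the coprime pairs `(k₁, k₂)` with `k₁ ≥ 0`, where `k₁ = 0` is only allowed with `k₂ = 1`. -/
def PrimeIndex : Set (ℤ × ℤ) :=
  {k | IsCoprime k.1 k.2 ∧ 0 ≤ k.1 ∧ (k.1 = 0 → k.2 = 1)}

/-- `θ_k(L, t) = t Y_γ(k₁ e₁(L) + k₂ e₂(L)) mod 1`. -/
def phase (γ : ℝ → Plane) (k : ℤ × ℤ) (t : ℝ) (L : LatticeSpace) : UnitAddCircle :=
  ((t * curveY γ (latticeVec k L) : ℝ) : UnitAddCircle)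

/-- `e(θ) = exp(2πiθ)` for `θ ∈ ℝ/ℤ`. -/
def expCircle (θ : UnitAddCircle) : ℂ := (AddCircle.toCircle θ : ℂ)

/-- The product over `Π` of the normalised Lebesgue measure of `ℝ/ℤ`: the law of a family of
independent uniform phases indexed by `Π`. -/
def uniformPhases : Measure (PrimeIndex → UnitAddCircle) :=
  Measure.infinitePi fun _ => AddCircle.haarAddCircle

instance : IsProbabilityMeasure uniformPhases := by
  unfold uniformPhases; infer_instance

end

/-! The sum of phases is `t * F(L)` mod 1, where `F(L) = ∑ (p_i Y(k_i(L)) + q_i Y(-k_i(L)))` and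
`k_i(L)` abbreviates `latticeVec (k i) L`. By the Riemann–Lebesgue lemma it is enough that the law
of `F` under the invariant measure is absolutely continuous (`ae_sum_curveY_notMem`); the limits in
distribution then follow by Fourier analysis on the torus of phases
(`tendstoInDistribution_of_characters`).

For absolute continuity, invariance and Fubini (`lattice_null_of_ae_curve`) allow `F` to be studied
along orbits of `lowerUnipotent η * upperUnipotent s * diagFlow r`. A lattice vector `(x, y)` with
fixed integral coordinates moves to a positive multiple of `±(u, ηu + 1)`, with `u = s + e^{2r}
x/y`. By homogeneity `F` becomes `e^{-r} ∑ |y_i| H_i(s + e^{2r} τ_i)`, where the slopes `τ_i =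
x_i/y_i` are distinct because distinct elements of `PrimeIndex` are not proportional. Each `H_i` is
analytic off a countable set, the possible zeros of the curvature of `γ` being isolated.

If the `s`-derivative of this sum vanished on an interval for a set of `r` of positive measure, it
would vanish for all `r` in an interval, by analyticity. Eliminating the terms one at a time would
then force `H_{i₀}` to be polynomial on some interval. Hence for almost every `r` the function of
`s` has nonzero derivative almost everywhere, and pulls null sets back to null sets
(`ae_ae_sum_notMem`).

The tilt `η` excludes polynomials. Were every `η` bad, a countability argument would give two values
with a common sector; comparing the two polynomial expressions through a Möbius change of variable
leaves degree at most one, so `p Y(ξ) + q Y(-ξ)` would be linear on a sector. Then `p x(ξ) - q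
x(-ξ)` would be constant there (`not_affine`). This contradicts injectivity of the contact point if
`p` or `q` is zero, and convexity if `pq > 0`. If `pq < 0`, a homothety maps an arc of `γ` into `γ`,
hence all of `γ` by analytic continuation; its ratio must be `-1`, and the region is symmetric. -/

noncomputable section

/-! ### The support function of an analytic oval -/

/-- The determinant of a pair of vectors of the plane. -/
def planeDet (v w : Plane) : ℝ := v 0 * w 1 - v 1 * w 0

theorem plane_inner_eq (v w : Plane) : (inner ℝ v w : ℝ) = v 0 * w 0 + v 1 * w 1 := by
  simp [PiLp.inner_apply, Fin.sum_univ_two, mul_comm]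

theorem plane_ext {v w : Plane} (h0 : v 0 = w 0) (h1 : v 1 = w 1) : v = w := by
  ext i; fin_cases i <;> assumption

theorem eq_zero_of_inner_eq_zero {w w' v : Plane} (hw : planeDet w w' ≠ 0)
    (h : (inner ℝ w v : ℝ) = 0) (h' : (inner ℝ w' v : ℝ) = 0) : v = 0 := by
  rw [plane_inner_eq] at h h'
  apply plane_ext
  · have : planeDet w w' * v 0 = 0 := by
      unfold planeDet; linear_combination w' 1 * h - w 1 * h'
    simpa [hw] using this
  · have : planeDet w w' * v 1 = 0 := by
      unfold planeDet; linear_combination - w' 0 * h + w 0 * h'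
    simpa [hw] using this

theorem smul_add_ne_zero {w w' : Plane} (hw : planeDet w w' ≠ 0) (τ : ℝ) : τ • w + w' ≠ 0 := by
  intro h
  apply hw
  have h0 : τ * w 0 + w' 0 = 0 := by simpa using congrArg (fun v : Plane => v 0) h
  have h1 : τ * w 1 + w' 1 = 0 := by simpa using congrArg (fun v : Plane => v 1) h
  unfold planeDet
  linear_combination w 0 * h1 - w 1 * h0

/-- In the plane, two vectors orthogonal to a nonzero vector are proportional. -/
theorem exists_smul_of_inner_eq_zero {u v n : Plane} (hn : n ≠ 0) (hu : u ≠ 0)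
    (hun : (inner ℝ u n : ℝ) = 0) (hvn : (inner ℝ v n : ℝ) = 0) : ∃ c : ℝ, v = c • u := by
  have hdet : planeDet u v = 0 := by
    by_contra h
    exact hn (eq_zero_of_inner_eq_zero h hun hvn)
  unfold planeDet at hdet
  by_cases h0 : u 0 = 0
  · have h1 : u 1 ≠ 0 := fun h1 => hu (plane_ext h0 h1)
    refine ⟨v 1 / u 1, plane_ext ?_ ?_⟩
    · have : u 1 * v 0 = 0 := by rw [h0] at hdet; linarith
      simp [h0, (mul_eq_zero.mp this).resolve_left h1]
    · simp; field_simp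
  · refine ⟨v 0 / u 0, plane_ext ?_ ?_⟩
    · simp; field_simp
    · simp; field_simp; linarith

/-! ### Contact points, normals and supporting lines. -/

namespace IsAnalyticOval

variable {γ : ℝ → Plane} {Ω : Set Plane}

theorem isOuterNormalAt_contactPoint (h : IsAnalyticOval γ Ω) {ξ : Plane} (hξ : ξ ≠ 0) :
    IsOuterNormalAt γ (contactPoint γ ξ) (‖ξ‖⁻¹ • ξ) :=
  Classical.epsilon_spec (h.existsUnique_contactPoint hξ).exists

theorem contactPoint_mem_range (h : IsAnalyticOval γ Ω) {ξ : Plane} (hξ : ξ ≠ 0) :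
    contactPoint γ ξ ∈ Set.range γ := (h.isOuterNormalAt_contactPoint hξ).1

theorem inner_le_curveY (h : IsAnalyticOval γ Ω) (ξ : Plane) (s : ℝ) :
    (inner ℝ ξ (γ s) : ℝ) ≤ curveY γ ξ := by
  by_cases hξ : ξ = 0
  · simp [hξ, curveY]
  have := (h.isOuterNormalAt_contactPoint hξ).2.2 s
  rw [inner_smul_left, inner_sub_right] at this
  have hp : 0 < ‖ξ‖⁻¹ := by positivity
  simp only [conj_trivial] at this
  have := nonpos_of_mul_nonpos_right this hp
  unfold curveY
  linarith

theorem eq_contactPoint (h : IsAnalyticOval γ Ω) {ξ : Plane} (hξ : ξ ≠ 0) {s : ℝ}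
    (hs : ∀ s', (inner ℝ ξ (γ s') : ℝ) ≤ inner ℝ ξ (γ s)) : γ s = contactPoint γ ξ := by
  refine (h.existsUnique_contactPoint hξ).unique ⟨⟨s, rfl⟩, ?_, fun s' => ?_⟩
    (h.isOuterNormalAt_contactPoint hξ)
  · rw [norm_smul, norm_inv, norm_norm, inv_mul_cancel₀ (norm_ne_zero_iff.mpr hξ)]
  · rw [inner_smul_left, inner_sub_right]
    have hp : 0 < ‖ξ‖⁻¹ := by positivity
    simp only [conj_trivial]
    exact mul_nonpos_of_nonneg_of_nonpos hp.le (by linarith [hs s'])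

theorem eq_contactPoint_iff (h : IsAnalyticOval γ Ω) {ξ : Plane} (hξ : ξ ≠ 0) {s : ℝ} :
    γ s = contactPoint γ ξ ↔ ∀ s', (inner ℝ ξ (γ s') : ℝ) ≤ inner ℝ ξ (γ s) := by
  refine ⟨fun hs s' => ?_, h.eq_contactPoint hξ⟩
  rw [hs]
  exact h.inner_le_curveY ξ s'

theorem contactPoint_smul (h : IsAnalyticOval γ Ω) {ξ : Plane} (hξ : ξ ≠ 0) {c : ℝ} (hc : 0 < c) :
    contactPoint γ (c • ξ) = contactPoint γ ξ := by
  obtain ⟨s, hs⟩ := h.contactPoint_mem_range hξ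
  rw [← hs]
  symm
  refine (h.eq_contactPoint_iff (smul_ne_zero hc.ne' hξ)).2 fun s' => ?_
  simp only [inner_smul_left, conj_trivial]
  exact mul_le_mul_of_nonneg_left ((h.eq_contactPoint_iff hξ).1 hs s') hc.le

theorem curveY_smul (h : IsAnalyticOval γ Ω) (ξ : Plane) {c : ℝ} (hc : 0 < c) :
    curveY γ (c • ξ) = c * curveY γ ξ := by
  by_cases hξ : ξ = 0
  · simp [hξ, curveY]
  · simp [curveY, h.contactPoint_smul hξ hc, inner_smul_left]

theorem differentiable (h : IsAnalyticOval γ Ω) : Differentiable ℝ γ :=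
  fun s => (h.analytic s trivial).differentiableAt

theorem continuous (h : IsAnalyticOval γ Ω) : Continuous γ := h.differentiable.continuous

theorem analytic_deriv (h : IsAnalyticOval γ Ω) : AnalyticOnNhd ℝ (deriv γ) Set.univ :=
  h.analytic.deriv

theorem inner_deriv_eq_zero (h : IsAnalyticOval γ Ω) {ξ : Plane} (hξ : ξ ≠ 0) {s : ℝ}
    (hs : γ s = contactPoint γ ξ) : (inner ℝ ξ (deriv γ s) : ℝ) = 0 := by
  have hd : HasDerivAt (fun u => (inner ℝ ξ (γ u) : ℝ)) (inner ℝ ξ (deriv γ s)) s := by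
    simpa using (hasDerivAt_const s ξ).inner ℝ (h.differentiable s).hasDerivAt
  have hmax : IsLocalMax (fun u => (inner ℝ ξ (γ u) : ℝ)) s :=
    Eventually.of_forall ((h.eq_contactPoint_iff hξ).1 hs)
  exact hmax.hasDerivAt_eq_zero hd

/-- A common contact point would make `⟨ξ, ·⟩` constant on `γ`; every point would then be the unique
maximiser and the curve would be a point. -/
theorem contactPoint_ne_neg (h : IsAnalyticOval γ Ω) {ξ : Plane} (hξ : ξ ≠ 0) :
    contactPoint γ ξ ≠ contactPoint γ (-ξ) := by
  intro he
  obtain ⟨s, hs⟩ := h.contactPoint_mem_range hξ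
  have h1 := (h.eq_contactPoint_iff hξ).1 hs
  have h2 := (h.eq_contactPoint_iff (neg_ne_zero.2 hξ)).1 (hs.trans he)
  have h3 : ∀ u, γ u = γ s := fun u => by
    rw [hs]
    refine (h.eq_contactPoint_iff hξ).2 fun s' => ?_
    have := h2 u
    simp only [inner_neg_left] at this
    linarith [h1 s']
  have := h.simple (x₁ := 0) (x₂ := 1 / 2) (by norm_num) (by norm_num) ((h3 0).trans (h3 _).symm)
  norm_num at this

theorem mem_region (h : IsAnalyticOval γ Ω) (s : ℝ) : γ s ∈ Ω := by
  have : γ s ∈ frontier Ω := h.frontier_eq ▸ Set.mem_range_self s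
  exact h.isCompact.isClosed.closure_eq ▸ frontier_subset_closure this

theorem interior_nonempty (h : IsAnalyticOval γ Ω) : (interior Ω).Nonempty := by
  have hne : γ 0 ≠ γ (1 / 2) := fun he => by
    have := h.simple (x₁ := 0) (x₂ := 1 / 2) (by norm_num) (by norm_num) he
    norm_num at this
  exact ⟨_, h.strictConvex (h.mem_region 0) (h.mem_region (1 / 2)) hne (a := 1 / 2) (b := 1 / 2)
    (by norm_num) (by norm_num) (by norm_num)⟩

/-- A boundary point is separated from the open convex interior by Hahn–Banach. The inequality
passes to the closure of the interior, which contains the whole region. -/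
theorem exists_eq_contactPoint (h : IsAnalyticOval γ Ω) (s : ℝ) :
    ∃ ξ : Plane, ξ ≠ 0 ∧ γ s = contactPoint γ ξ := by
  have hs : γ s ∉ interior Ω := by
    have : γ s ∈ frontier Ω := h.frontier_eq ▸ Set.mem_range_self s
    exact this.2
  have hconv : Convex ℝ Ω := h.strictConvex.convex
  obtain ⟨f, hf⟩ := geometric_hahn_banach_open_point hconv.interior isOpen_interior hs
  set ξ : Plane := (InnerProductSpace.toDual ℝ Plane).symm f with hξdef
  have hξ : ∀ x, f x = inner ℝ ξ x := fun x => by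
    simp [hξdef, InnerProductSpace.toDual_symm_apply]
  have hle : ∀ x ∈ Ω, f x ≤ f (γ s) := by
    intro x hx
    have hx' : x ∈ closure (interior Ω) := by
      rw [hconv.closure_interior_eq_closure_of_nonempty_interior h.interior_nonempty]
      exact subset_closure hx
    exact closure_minimal (fun y hy => (hf y hy).le)
      (isClosed_le f.continuous continuous_const) hx'
  refine ⟨ξ, fun h0 => ?_, ?_⟩
  · obtain ⟨y, hy⟩ := h.interior_nonempty
    have := hf y hy
    simp [hξ, h0] at this
  · by_cases h0 : ξ = 0
    · exfalso
      obtain ⟨y, hy⟩ := h.interior_nonempty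
      have := hf y hy
      simp [hξ, h0] at this
    refine h.eq_contactPoint h0 fun s' => ?_
    rw [← hξ, ← hξ]
    exact hle _ (h.mem_region s')

/-- The value `τ` for which the tangent of `γ` at `γ s` is orthogonal to `τ w + w'`. -/
def normalParam (γ : ℝ → Plane) (w w' : Plane) (s : ℝ) : ℝ :=
  -(inner ℝ w' (deriv γ s)) / inner ℝ w (deriv γ s)

theorem inner_deriv_ne_zero (h : IsAnalyticOval γ Ω) {w w' : Plane} (hw : planeDet w w' ≠ 0)
    {τ s : ℝ} (hs : (inner ℝ (τ • w + w') (deriv γ s) : ℝ) = 0) :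
    (inner ℝ w (deriv γ s) : ℝ) ≠ 0 := by
  intro h0
  rw [inner_add_left, inner_smul_left, h0, mul_zero, zero_add] at hs
  exact h.regular s (eq_zero_of_inner_eq_zero hw h0 hs)

theorem normalParam_eq (h : IsAnalyticOval γ Ω) {w w' : Plane} (hw : planeDet w w' ≠ 0)
    {τ s : ℝ} (hs : (inner ℝ (τ • w + w') (deriv γ s) : ℝ) = 0) :
    normalParam γ w w' s = τ := by
  have h0 := h.inner_deriv_ne_zero hw hs
  rw [inner_add_left, inner_smul_left] at hs
  simp only [conj_trivial] at hs
  unfold normalParam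
  field_simp
  linarith

theorem inner_normalParam {w w' : Plane} {s : ℝ} (h0 : (inner ℝ w (deriv γ s) : ℝ) ≠ 0) :
    (inner ℝ (normalParam γ w w' s • w + w') (deriv γ s) : ℝ) = 0 := by
  rw [inner_add_left, inner_smul_left, normalParam]
  simp only [conj_trivial]
  field_simp
  ring

theorem analyticAt_inner_deriv (h : IsAnalyticOval γ Ω) (w : Plane) (s : ℝ) :
    AnalyticAt ℝ (fun u => (inner ℝ w (deriv γ u) : ℝ)) s :=
  ((innerSL ℝ w).analyticAt _).comp (h.analytic_deriv s trivial)

theorem analyticAt_normalParam (h : IsAnalyticOval γ Ω) {w w' : Plane} {s : ℝ}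
    (h0 : (inner ℝ w (deriv γ s) : ℝ) ≠ 0) : AnalyticAt ℝ (normalParam γ w w') s :=
  (h.analyticAt_inner_deriv w' s).neg.div (h.analyticAt_inner_deriv w s) h0

/-- Near `s` the outer normal at `γ u` is proportional to `normalParam γ w w' u • w + w'`; only the
sign is in doubt. If it were negative for `u` arbitrarily close to `s`, the limit would make `γ s` a
contact point for the opposite direction too. -/
theorem eventually_eq_contactPoint (h : IsAnalyticOval γ Ω) {w w' : Plane}
    (hw : planeDet w w' ≠ 0) {τ s : ℝ} (hs : γ s = contactPoint γ (τ • w + w')) :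
    ∀ᶠ u in 𝓝 s, γ u = contactPoint γ (normalParam γ w w' u • w + w') := by
  have hξ := smul_add_ne_zero hw τ
  have hd := h.inner_deriv_eq_zero hξ hs
  have h0 := h.inner_deriv_ne_zero hw hd
  have hc : ContinuousAt (normalParam γ w w') s := (h.analyticAt_normalParam h0).continuousAt
  have hne : ∀ᶠ u in 𝓝 s, (inner ℝ w (deriv γ u) : ℝ) ≠ 0 :=
    (h.analyticAt_inner_deriv w s).continuousAt.eventually_ne h0
  by_contra hcon
  have hfr : ∃ᶠ u in 𝓝 s, ∀ s', (inner ℝ (normalParam γ w w' u • w + w') (γ u - γ s') : ℝ) ≤ 0 := by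
    refine (Filter.not_eventually.1 hcon |>.and_eventually hne).mono ?_
    rintro u ⟨hu, hu0⟩ s'
    obtain ⟨ξ, hξ0, hξu⟩ := h.exists_eq_contactPoint u
    obtain ⟨c, hc⟩ := exists_smul_of_inner_eq_zero (h.regular u)
      (smul_add_ne_zero hw (normalParam γ w w' u)) (inner_normalParam hu0)
      (h.inner_deriv_eq_zero hξ0 hξu)
    have hc0 : c < 0 := by
      rcases lt_trichotomy c 0 with h1 | h1 | h1
      · exact h1
      · simp [h1] at hc; exact absurd hc hξ0
      · rw [hc, h.contactPoint_smul (smul_add_ne_zero hw _) h1] at hξu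
        exact absurd hξu hu
    have := (h.eq_contactPoint_iff hξ0).1 hξu s'
    rw [hc, inner_smul_left, inner_smul_left] at this
    simp only [conj_trivial] at this
    rw [inner_sub_right]
    nlinarith
  have hτ := h.normalParam_eq hw hd
  refine h.contactPoint_ne_neg hξ (hs.symm.trans ?_)
  refine (h.eq_contactPoint_iff (neg_ne_zero.2 hξ)).2 fun s' => ?_
  have hct : Tendsto (fun u => (inner ℝ (normalParam γ w w' u • w + w') (γ u - γ s') : ℝ)) (𝓝 s)
      (𝓝 (inner ℝ (τ • w + w') (γ s - γ s'))) := by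
    have h1 : Tendsto (normalParam γ w w') (𝓝 s) (𝓝 τ) := hτ ▸ hc
    have h2 : Tendsto γ (𝓝 s) (𝓝 (γ s)) := h.continuous.tendsto s
    exact ((h1.smul_const w).add_const w').inner (h2.sub_const _)
  have := le_of_tendsto_of_frequently hct (hfr.mono fun u hu => hu s')
  rw [inner_sub_right] at this
  simp only [inner_neg_left]
  linarith

end IsAnalyticOval

/-! ### Zeros of the curvature and piecewise analyticity of the support function. -/

theorem countable_zeros_of_analyticOnNhd {f : ℝ → ℝ} (hf : AnalyticOnNhd ℝ f Set.univ) {x : ℝ}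
    (hx : f x ≠ 0) : {s | f s = 0}.Countable := by
  have h := hf.preimage_zero_mem_codiscrete hx
  have hd : IsDiscrete {s | f s = 0} := by
    rw [← Set.inter_univ {s | f s = 0}]
    apply isDiscrete_of_codiscreteWithin
    exact h
  exact (HereditarilyLindelofSpace.isLindelof _).countable_of_isDiscrete hd

namespace IsAnalyticOval

variable {γ : ℝ → Plane} {Ω : Set Plane}

/-- The numerator of the curvature of `γ`. -/
def curvatureNum (γ : ℝ → Plane) (s : ℝ) : ℝ := planeDet (deriv γ s) (deriv (deriv γ) s)

theorem analyticAt_coord {f : ℝ → Plane} {s : ℝ} (hf : AnalyticAt ℝ f s) (i : Fin 2) :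
    AnalyticAt ℝ (fun u => f u i) s :=
  ((EuclideanSpace.proj (𝕜 := ℝ) i : Plane →L[ℝ] ℝ).analyticAt _).comp hf

theorem analytic_curvatureNum (h : IsAnalyticOval γ Ω) :
    AnalyticOnNhd ℝ (curvatureNum γ) Set.univ := by
  intro s _
  have h1 := h.analytic_deriv s trivial
  have h2 := h.analytic_deriv.deriv s trivial
  exact ((analyticAt_coord h1 0).mul (analyticAt_coord h2 1)).sub
    ((analyticAt_coord h1 1).mul (analyticAt_coord h2 0))

theorem hasDerivAt_normalParam (h : IsAnalyticOval γ Ω) {w w' : Plane} {s : ℝ}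
    (h0 : (inner ℝ w (deriv γ s) : ℝ) ≠ 0) :
    HasDerivAt (normalParam γ w w')
      (-(planeDet w w' * curvatureNum γ s) / (inner ℝ w (deriv γ s)) ^ 2) s := by
  have hg : HasDerivAt (deriv γ) (deriv (deriv γ) s) s :=
    (h.analytic_deriv s trivial).differentiableAt.hasDerivAt
  have hi : ∀ v : Plane, HasDerivAt (fun u => (inner ℝ v (deriv γ u) : ℝ))
      (inner ℝ v (deriv (deriv γ) s)) s := fun v => by
    simpa using (hasDerivAt_const s v).inner ℝ hg
  refine ((hi w').neg.div (hi w) h0).congr_deriv ?_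
  congr 1
  simp only [plane_inner_eq, planeDet, curvatureNum, Pi.neg_apply]
  ring

/-- With zero curvature the normal direction would be constant near `0`. Since it determines the
contact point, `γ` would be locally constant, against regularity. -/
theorem exists_curvatureNum_ne_zero (h : IsAnalyticOval γ Ω) : ∃ s, curvatureNum γ s ≠ 0 := by
  by_contra hcon
  push Not at hcon
  obtain ⟨ξ, hξ, hs⟩ := h.exists_eq_contactPoint 0
  -- The quarter turn of `ξ`, so that `planeDet w ξ = ‖ξ‖²`.
  set w : Plane := !₂[ξ 1, -ξ 0] with hwdef
  have hw : planeDet w ξ ≠ 0 := by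
    intro h0
    have h1 : ξ 1 * ξ 1 + ξ 0 * ξ 0 = 0 := by
      simpa [planeDet, hwdef] using h0
    apply hξ
    apply plane_ext
    · simp; nlinarith [mul_self_nonneg (ξ 1), mul_self_nonneg (ξ 0)]
    · simp; nlinarith [mul_self_nonneg (ξ 1), mul_self_nonneg (ξ 0)]
  have hs' : γ 0 = contactPoint γ ((0 : ℝ) • w + ξ) := by simpa using hs
  have hd := h.inner_deriv_eq_zero (smul_add_ne_zero hw 0) hs'
  have h0 := h.inner_deriv_ne_zero hw hd
  have hne : ∀ᶠ u in 𝓝 (0 : ℝ), (inner ℝ w (deriv γ u) : ℝ) ≠ 0 :=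
    (h.analyticAt_inner_deriv w 0).continuousAt.eventually_ne h0
  obtain ⟨ε, hε, hball⟩ := Metric.eventually_nhds_iff_ball.1
    ((h.eventually_eq_contactPoint hw hs').and hne)
  have hconst : ∀ u ∈ Metric.ball (0 : ℝ) ε, normalParam γ w ξ u = normalParam γ w ξ 0 := by
    intro u hu
    refine Metric.isOpen_ball.is_const_of_deriv_eq_zero (convex_ball _ _).isPreconnected
      (fun x hx => (h.hasDerivAt_normalParam (hball x hx).2).differentiableAt.differentiableWithinAt)
      (fun x hx => ?_) hu (Metric.mem_ball_self hε)
    rw [(h.hasDerivAt_normalParam (hball x hx).2).deriv, hcon x]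
    simp
  have heq : γ =ᶠ[𝓝 0] fun _ => γ 0 := by
    filter_upwards [Metric.ball_mem_nhds _ hε] with u hu
    rw [(hball u hu).1, hconst u hu, ← (hball 0 (Metric.mem_ball_self hε)).1]
  apply h.regular 0
  rw [heq.deriv_eq]
  simp

theorem countable_curvatureNum_zeros (h : IsAnalyticOval γ Ω) :
    {s | curvatureNum γ s = 0}.Countable := by
  obtain ⟨s, hs⟩ := h.exists_curvatureNum_ne_zero
  exact countable_zeros_of_analyticOnNhd h.analytic_curvatureNum hs

/-- In the parameter `u` of the curve, `Y` equals `⟨normalParam u • w + w', γ u⟩`, which is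
analytic. Nonzero curvature makes `normalParam` a local analytic diffeomorphism, so analyticity
descends to the variable `τ`. -/
theorem analyticAt_curveY (h : IsAnalyticOval γ Ω) {w w' : Plane} (hw : planeDet w w' ≠ 0)
    {τ s : ℝ} (hs : γ s = contactPoint γ (τ • w + w')) (hκ : curvatureNum γ s ≠ 0) :
    AnalyticAt ℝ (fun x : ℝ => curveY γ (x • w + w')) τ := by
  have hd := h.inner_deriv_eq_zero (smul_add_ne_zero hw τ) hs
  have h0 := h.inner_deriv_ne_zero hw hd
  have hT := h.analyticAt_normalParam (w' := w') h0
  have hT' : deriv (normalParam γ w w') s ≠ 0 := by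
    rw [(h.hasDerivAt_normalParam h0).deriv]
    exact div_ne_zero (neg_ne_zero.2 (mul_ne_zero hw hκ)) (pow_ne_zero _ h0)
  have hτ := h.normalParam_eq hw hd
  rw [← hτ, ← analyticAt_comp_iff_of_deriv_ne_zero hT hT']
  have ha : AnalyticAt ℝ (fun u => normalParam γ w w' u * (inner ℝ w (γ u) : ℝ)
      + inner ℝ w' (γ u)) s :=
    (hT.mul (((innerSL ℝ w).analyticAt _).comp (h.analytic s trivial))).add
      (((innerSL ℝ w').analyticAt _).comp (h.analytic s trivial))
  refine ha.congr ?_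
  filter_upwards [h.eventually_eq_contactPoint hw hs] with u hu
  simp only [Function.comp, curveY, ← hu, inner_add_left, inner_smul_left, conj_trivial]

theorem countable_not_analyticAt_curveY (h : IsAnalyticOval γ Ω) {w w' : Plane}
    (hw : planeDet w w' ≠ 0) :
    {τ | ¬ AnalyticAt ℝ (fun x : ℝ => curveY γ (x • w + w')) τ}.Countable := by
  refine (h.countable_curvatureNum_zeros.image (normalParam γ w w')).mono fun τ hτ => ?_
  obtain ⟨s, hs⟩ := h.contactPoint_mem_range (smul_add_ne_zero hw τ)
  refine ⟨s, ?_, h.normalParam_eq hw (h.inner_deriv_eq_zero (smul_add_ne_zero hw τ) hs)⟩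
  by_contra hκ
  exact hτ (h.analyticAt_curveY hw hs hκ)

/-- Envelope argument: the affine function given by the fixed point `γ s` lies below `Y` and touches
it at `τ`, so the two derivatives agree. -/
theorem deriv_curveY (h : IsAnalyticOval γ Ω) {w w' : Plane}
    (hw : planeDet w w' ≠ 0) {τ : ℝ}
    (hd : DifferentiableAt ℝ (fun x : ℝ => curveY γ (x • w + w')) τ) :
    deriv (fun x : ℝ => curveY γ (x • w + w')) τ = inner ℝ w (contactPoint γ (τ • w + w')) := by
  obtain ⟨s, hs⟩ := h.contactPoint_mem_range (smul_add_ne_zero hw τ)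
  rw [← hs]
  have h1 : HasDerivAt (fun x : ℝ => x * (inner ℝ w (γ s) : ℝ) + inner ℝ w' (γ s))
      (inner ℝ w (γ s)) τ := by
    simpa using ((hasDerivAt_id τ).mul_const (inner ℝ w (γ s) : ℝ)).add_const (inner ℝ w' (γ s) : ℝ)
  have hmin : IsLocalMin (fun x : ℝ => curveY γ (x • w + w')
      - (x * (inner ℝ w (γ s) : ℝ) + inner ℝ w' (γ s))) τ := by
    refine Eventually.of_forall fun x => ?_
    have h2 := h.inner_le_curveY (x • w + w') s
    have h3 : curveY γ (τ • w + w') = inner ℝ (τ • w + w') (γ s) := by rw [curveY, hs]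
    simp only [h3]
    rw [inner_add_left, inner_smul_left] at h2 ⊢
    simp only [conj_trivial] at h2 ⊢
    linarith
  have := hmin.hasDerivAt_eq_zero (hd.hasDerivAt.sub h1)
  linarith

end IsAnalyticOval

/-! ### Rigidity of homotheties of an arc, and non-linearity of the support function. -/

namespace IsAnalyticOval

variable {γ : ℝ → Plane} {Ω : Set Plane}

theorem inner_le_curveY_of_mem (h : IsAnalyticOval γ Ω) {ξ : Plane} (hξ : ξ ≠ 0) {x : Plane}
    (hx : x ∈ Ω) : (inner ℝ ξ x : ℝ) ≤ curveY γ ξ := by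
  obtain ⟨y, hy, hmax⟩ := h.isCompact.exists_isMaxOn ⟨x, hx⟩
    (innerSL ℝ ξ : Plane →L[ℝ] ℝ).continuous.continuousOn
  have hyi : y ∉ interior Ω := fun hi => by
    have hloc : IsLocalMax (innerSL ℝ ξ : Plane →L[ℝ] ℝ) y :=
      hmax.isLocalMax (mem_interior_iff_mem_nhds.1 hi)
    have h0 := hloc.hasFDerivAt_eq_zero (innerSL ℝ ξ : Plane →L[ℝ] ℝ).hasFDerivAt
    have : (inner ℝ ξ ξ : ℝ) = 0 := by
      simpa using congrArg (fun f : Plane →L[ℝ] ℝ => f ξ) h0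
    exact hξ (inner_self_eq_zero.1 this)
  have hyγ : y ∈ Set.range γ := by
    rw [← h.frontier_eq]
    exact ⟨subset_closure hy, hyi⟩
  obtain ⟨s, rfl⟩ := hyγ
  exact (hmax hx).trans (h.inner_le_curveY ξ s)

/-- The parameter of a point of the curve may be taken in a given neighbourhood. -/
theorem eventually_exists_param (h : IsAnalyticOval γ Ω) {u₀ : ℝ} {U : Set ℝ} (hU : U ∈ 𝓝 u₀) :
    ∀ᶠ x in 𝓝 (γ u₀), x ∈ Set.range γ → ∃ u ∈ U, γ u = x := by
  -- A full period centred at `u₀`: its points are at distance less than `1` from `u₀`, so none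
  -- outside `U` has the same image. The image of this compact set thus stays away from `γ u₀`.
  have hK : IsCompact (Set.Icc (u₀ - 1 / 2) (u₀ + 1 / 2) \ interior U) :=
    isCompact_Icc.diff isOpen_interior
  have hfr : ∀ u v : ℝ, γ u = γ v → ∃ n : ℤ, u - v = n := by
    intro u v huv
    have hf : ∀ u, γ (Int.fract u) = γ u := fun u => by
      rw [← Int.self_sub_floor]
      simpa using h.periodic.sub_zsmul_eq (x := u) ⌊u⌋
    apply Int.fract_eq_fract.1
    exact h.simple ⟨Int.fract_nonneg _, Int.fract_lt_one _⟩
      ⟨Int.fract_nonneg _, Int.fract_lt_one _⟩ (by rw [hf, hf, huv])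
  have hn : γ u₀ ∉ γ '' (Set.Icc (u₀ - 1 / 2) (u₀ + 1 / 2) \ interior U) := by
    rintro ⟨u, ⟨hu, hui⟩, he⟩
    obtain ⟨n, hn⟩ := hfr u u₀ he
    have h1 : |(n : ℝ)| < 1 := by
      rw [← hn, abs_lt]
      constructor <;> linarith [hu.1, hu.2]
    have h2 : n = 0 := by
      have : |n| < 1 := by exact_mod_cast h1
      simpa using this
    rw [h2] at hn
    have : u = u₀ := by
      have : u - u₀ = 0 := by simpa using hn
      linarith
    rw [this] at hui
    exact hui (mem_interior_iff_mem_nhds.2 hU)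
  have := (hK.image h.continuous).isClosed.isOpen_compl.mem_nhds hn
  filter_upwards [this] with x hx
  rintro ⟨u, rfl⟩
  set n : ℤ := ⌊u - (u₀ - 1 / 2)⌋
  have hγ : γ (u - n) = γ u := by simpa using h.periodic.sub_zsmul_eq (x := u) n
  refine ⟨u - n, ?_, hγ⟩
  by_contra hcon
  refine hx ⟨u - n, ⟨⟨?_, ?_⟩, fun hi => hcon (interior_subset hi)⟩, hγ⟩
  · linarith [Int.floor_le (u - (u₀ - 1 / 2))]
  · linarith [Int.lt_floor_add_one (u - (u₀ - 1 / 2))]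

/-- If a homothety maps an arc of `γ` into `γ` then it maps all of `γ` into `γ`. -/
theorem homothety_mem_range_of_eventually (h : IsAnalyticOval γ Ω) {r : ℝ} {c : Plane} {s₀ : ℝ}
    (hs₀ : ∀ᶠ s in 𝓝 s₀, r • γ s + c ∈ Set.range γ) (s : ℝ) : r • γ s + c ∈ Set.range γ := by
  set S : Set ℝ := {s | ∀ᶠ u in 𝓝 s, r • γ u + c ∈ Set.range γ} with hS
  have hcont : Continuous fun s => r • γ s + c := (h.continuous.const_smul r).add_const c
  have hrange : IsClosed (Set.range γ) := by
    rw [← h.frontier_eq]; exact isClosed_frontier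
  have hopen : IsOpen S := isOpen_setOfPred_eventually_nhds
  -- Continuation step. At a limit point `s₁` of `S`, some coordinate `i` is a local analytic chart
  -- of `γ` near the image point, with inverse `ι`.
  have hclosed : IsClosed S := by
    refine isClosed_of_closure_subset fun s₁ hs₁ => ?_
    have hmem : r • γ s₁ + c ∈ Set.range γ := by
      have : S ⊆ (fun s => r • γ s + c) ⁻¹' Set.range γ := fun u hu => hu.self_of_nhds
      exact closure_minimal this (hrange.preimage hcont) hs₁
    obtain ⟨u₀, hu₀⟩ := hmem
    have hi : ∃ i, deriv γ u₀ i ≠ 0 := by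
      by_contra hcon
      push Not at hcon
      exact h.regular u₀ (plane_ext (hcon 0) (hcon 1))
    obtain ⟨i, hi⟩ := hi
    have hf : AnalyticAt ℝ (fun u => γ u i) u₀ := analyticAt_coord (h.analytic u₀ trivial) i
    have hf' : deriv (fun u => γ u i) u₀ ≠ 0 := by
      have := ((EuclideanSpace.proj (𝕜 := ℝ) i : Plane →L[ℝ] ℝ).hasFDerivAt.comp_hasDerivAt u₀
        (h.differentiable u₀).hasDerivAt).deriv
      rw [show (fun u => γ u i) = (EuclideanSpace.proj (𝕜 := ℝ) i : Plane →L[ℝ] ℝ) ∘ γ from rfl,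
        this]
      exact hi
    set ι := hf.hasStrictDerivAt.localInverse _ _ _ hf'
    have hι : AnalyticAt ℝ ι (γ u₀ i) := hf.analyticAt_localInverse hf'
    have hleft : ∀ᶠ u in 𝓝 u₀, ι (γ u i) = u := HasStrictDerivAt.eventually_left_inverse ..
    have hιu₀ : ι (γ u₀ i) = u₀ := hleft.self_of_nhds
    have hT : AnalyticAt ℝ (fun s => r • γ s + c) s₁ :=
      ((h.analytic s₁ trivial).fun_const_smul).fun_add analyticAt_const
    have hu : AnalyticAt ℝ (fun s => ι ((r • γ s + c) i)) s₁ := by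
      refine AnalyticAt.fun_comp (g := ι) ?_ (analyticAt_coord hT i)
      rw [← hu₀]; exact hι
    -- The defect between the moved point and the point of `γ` with the same `i`-th coordinate.
    -- Zeros accumulate at `s₁` because `S` is open there, so the isolated-zero alternative fails.
    have hΔ : AnalyticAt ℝ (fun s => r • γ s + c - γ (ι ((r • γ s + c) i))) s₁ :=
      hT.sub (AnalyticAt.fun_comp (h.analytic _ trivial) hu)
    have hzero : ∀ᶠ s in 𝓝 s₁, r • γ s + c ∈ Set.range γ →
        r • γ s + c - γ (ι ((r • γ s + c) i)) = 0 := by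
      have := h.eventually_exists_param hleft
      rw [hu₀] at this
      filter_upwards [hcont.continuousAt.eventually this] with s hs hsr
      obtain ⟨u, hu, hus⟩ := hs hsr
      rw [← hus, hu, sub_self]
    rcases hΔ.eventually_eq_zero_or_eventually_ne_zero with h0 | h0
    · filter_upwards [h0] with s hs
      exact ⟨_, (sub_eq_zero.1 hs).symm⟩
    · exfalso
      have h1 := eventually_nhdsWithin_iff.1 h0
      obtain ⟨ε, hε, hball⟩ := Metric.eventually_nhds_iff_ball.1 (h1.and hzero)
      obtain ⟨s₂, hs₂, hd⟩ := Metric.mem_closure_iff.1 hs₁ ε hε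
      have hs₂' : ∀ᶠ s in 𝓝 s₂, s ∈ Metric.ball s₁ ε ∧ r • γ s + c ∈ Set.range γ :=
        (Metric.isOpen_ball.mem_nhds (by rw [Metric.mem_ball, dist_comm]; exact hd) :
          Metric.ball s₁ ε ∈ 𝓝 s₂) |> fun hb => Filter.Eventually.and hb hs₂
      obtain ⟨s₃, hs₃, hne⟩ := (infinite_of_mem_nhds s₂ hs₂').nontrivial.exists_ne s₁
      exact (hball s₃ hs₃.1).1 hne ((hball s₃ hs₃.1).2 hs₃.2)
  have huniv : S = Set.univ := IsClopen.eq_univ ⟨hclosed, hopen⟩ ⟨s₀, hs₀⟩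
  have : s ∈ S := huniv ▸ trivial
  exact this.self_of_nhds

/-- A homothety of ratio `r` multiplies the finite, positive diameter by `|r|`. -/
theorem abs_le_one_of_homothety (h : IsAnalyticOval γ Ω) {r : ℝ} {c : Plane}
    (hr : ∀ s, r • γ s + c ∈ Set.range γ) : |r| ≤ 1 := by
  by_contra hcon
  push Not at hcon
  have hr0 : 0 < |r| := by linarith
  have hb : Bornology.IsBounded (Set.range γ) := by
    rw [← h.frontier_eq]
    exact h.isCompact.isBounded.subset h.isCompact.isClosed.frontier_subset
  have h1 : Metric.diam (Set.range γ) ≤ Metric.diam (Set.range γ) / |r| := by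
    refine Metric.diam_le_of_forall_dist_le (by positivity) ?_
    rintro _ ⟨s, rfl⟩ _ ⟨u, rfl⟩
    rw [le_div_iff₀ hr0, mul_comm]
    calc |r| * dist (γ s) (γ u) = dist (r • γ s + c) (r • γ u + c) := by
          rw [dist_add_right, dist_smul₀, Real.norm_eq_abs]
      _ ≤ _ := Metric.dist_le_diam_of_mem hb (hr s) (hr u)
  have hne : γ 0 ≠ γ (1 / 2) := fun he => by
    have := h.simple (x₁ := 0) (x₂ := 1 / 2) (by norm_num) (by norm_num) he
    norm_num at this
  have hpos : 0 < Metric.diam (Set.range γ) :=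
    (dist_pos.2 hne).trans_le (Metric.dist_le_diam_of_mem hb ⟨0, rfl⟩ ⟨1 / 2, rfl⟩)
  rw [le_div_iff₀ hr0] at h1
  nlinarith

/-- If `c - x` lay outside the region, separate it by a form `ξ`. The contact point for `-ξ`
minimises `⟨ξ, ·⟩` on the region, so its reflection, which is on `γ`, would lie at least as far out
as `c - x`. -/
theorem hasCenterOfSymmetry_of_reflection (h : IsAnalyticOval γ Ω) {c : Plane}
    (hc : ∀ s, (-1 : ℝ) • γ s + c ∈ Set.range γ) : HasCenterOfSymmetry Ω := by
  refine ⟨(1 / 2 : ℝ) • c, fun x hx => ?_⟩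
  rw [smul_smul]
  norm_num
  by_contra hn
  obtain ⟨f, u, hf, hu⟩ := geometric_hahn_banach_closed_point h.strictConvex.convex
    h.isCompact.isClosed hn
  set ξ : Plane := (InnerProductSpace.toDual ℝ Plane).symm f with hξdef
  have hξ : ∀ x, f x = inner ℝ ξ x := fun x => by
    simp [hξdef, InnerProductSpace.toDual_symm_apply]
  have hξ0 : ξ ≠ 0 := fun h0 => by
    have := (hf x hx).trans hu
    simp [hξ, h0] at this
  obtain ⟨s, hs⟩ := h.contactPoint_mem_range (neg_ne_zero.2 hξ0)
  have h1 := h.inner_le_curveY_of_mem (neg_ne_zero.2 hξ0) hx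
  obtain ⟨s', hs'⟩ := hc s
  have h2 := hf _ (h.mem_region s')
  rw [hs', hξ] at h2
  rw [hξ] at hu
  rw [curveY, ← hs] at h1
  simp only [inner_sub_right, inner_add_right, inner_neg_left, inner_smul_right] at *
  linarith

theorem contactPoint_injective (h : IsAnalyticOval γ Ω) {w w' : Plane} (hw : planeDet w w' ≠ 0) :
    Function.Injective fun τ : ℝ => contactPoint γ (τ • w + w') := by
  intro τ τ' he
  obtain ⟨s, hs⟩ := h.contactPoint_mem_range (smul_add_ne_zero hw τ)
  rw [← h.normalParam_eq hw (h.inner_deriv_eq_zero (smul_add_ne_zero hw τ) hs)]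
  exact h.normalParam_eq hw (h.inner_deriv_eq_zero (smul_add_ne_zero hw τ') (hs.trans he))

theorem inner_contactPoint_le (h : IsAnalyticOval γ Ω) {ξ ξ' : Plane} (hξ' : ξ' ≠ 0) :
    (inner ℝ ξ (contactPoint γ ξ') : ℝ) ≤ inner ℝ ξ (contactPoint γ ξ) := by
  obtain ⟨s, hs⟩ := h.contactPoint_mem_range hξ'
  rw [← hs]
  exact h.inner_le_curveY ξ s

theorem inner_contactPoint_lt (h : IsAnalyticOval γ Ω) {ξ ξ' : Plane} (hξ : ξ ≠ 0) (hξ' : ξ' ≠ 0)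
    (hne : contactPoint γ ξ' ≠ contactPoint γ ξ) :
    (inner ℝ ξ (contactPoint γ ξ') : ℝ) < inner ℝ ξ (contactPoint γ ξ) := by
  refine (h.inner_contactPoint_le hξ').lt_of_ne fun he => hne ?_
  obtain ⟨s, hs⟩ := h.contactPoint_mem_range hξ'
  rw [← hs] at he ⊢
  refine (h.eq_contactPoint_iff hξ).2 fun s' => ?_
  rw [he]
  exact h.inner_le_curveY ξ s'

/-- The function `p Y(ξ) + q Y(-ξ)` is not linear on any cone, unless `Ω` is symmetric. -/
theorem not_affine (h : IsAnalyticOval γ Ω) {p q : ℝ} (hpq : p ≠ 0 ∨ q ≠ 0)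
    (hsym : p = 0 ∨ q = 0 ∨ ¬ HasCenterOfSymmetry Ω) {w w' : Plane} (hw : planeDet w w' ≠ 0)
    {a b α β : ℝ} (hab : a < b) :
    ¬ ∀ τ ∈ Set.Ioo a b,
      p * curveY γ (τ • w + w') + q * curveY γ (-(τ • w + w')) = α * τ + β := by
  intro haff
  have hneg : ∀ τ : ℝ, -(τ • w + w') = τ • (-w) + -w' := fun τ => by
    rw [neg_add, smul_neg]
  have hw2 : planeDet (-w) (-w') ≠ 0 := by simpa [planeDet] using hw
  simp only [hneg] at haff
  set D : Set ℝ := {τ | ¬ AnalyticAt ℝ (fun x : ℝ => curveY γ (x • w + w')) τ} ∪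
    {τ | ¬ AnalyticAt ℝ (fun x : ℝ => curveY γ (x • (-w) + -w')) τ}
  have hD : D.Countable :=
    (h.countable_not_analyticAt_curveY hw).union (h.countable_not_analyticAt_curveY hw2)
  have hDc : IsClosed D :=
    (isOpen_analyticAt ℝ _).isClosed_compl.union (isOpen_analyticAt ℝ _).isClosed_compl
  set V : Set ℝ := Set.Ioo a b \ D
  have hV : IsOpen V := isOpen_Ioo.sdiff hDc
  have hVa : ∀ τ ∈ V, AnalyticAt ℝ (fun x : ℝ => curveY γ (x • w + w')) τ ∧
      AnalyticAt ℝ (fun x : ℝ => curveY γ (x • (-w) + -w')) τ := by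
    rintro τ ⟨-, hτ⟩
    simpa [D, not_or] using hτ
  obtain ⟨τ₀, hτ₀⟩ : V.Nonempty := by
    by_contra hne
    rw [Set.not_nonempty_iff_eq_empty, Set.sdiff_eq_empty] at hne
    exact (Cardinal.Real.Ioo_countable_iff.1 (hD.mono hne)).not_gt hab
  -- The value and the derivative of the affine relation give two linear equations, in the
  -- independent directions `w` and `w'`, for the vector `p x(ξ) - q x(-ξ)`.
  have hrel : ∀ τ ∈ V,
      (inner ℝ w (p • contactPoint γ (τ • w + w') - q • contactPoint γ (τ • (-w) + -w')) : ℝ) = α ∧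
      (inner ℝ w' (p • contactPoint γ (τ • w + w') - q • contactPoint γ (τ • (-w) + -w')) : ℝ)
        = β := by
    intro τ hτ
    obtain ⟨h1, h2⟩ := hVa τ hτ
    have e1 := h.deriv_curveY hw h1.differentiableAt
    have e2 := h.deriv_curveY hw2 h2.differentiableAt
    have hd := (h1.differentiableAt.hasDerivAt.const_mul p).add
      (h2.differentiableAt.hasDerivAt.const_mul q)
    have hl : HasDerivAt (fun x : ℝ => α * x + β) α τ := by
      simpa using ((hasDerivAt_id τ).const_mul α).add_const β
    have he : (fun x : ℝ => p * curveY γ (x • w + w') + q * curveY γ (x • (-w) + -w'))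
        =ᶠ[𝓝 τ] fun x => α * x + β := by
      filter_upwards [hV.mem_nhds hτ] with x hx using haff x hx.1
    have e3 := hd.unique (hl.congr_of_eventuallyEq he)
    rw [e1, e2] at e3
    have e4 := haff τ hτ.1
    simp only [curveY, inner_add_left, inner_smul_left, inner_neg_left, conj_trivial,
      inner_sub_right, inner_smul_right] at e3 e4 ⊢
    constructor
    · linarith
    · linear_combination e4 - τ * e3
  have hconst : ∀ τ ∈ V, ∀ τ' ∈ V,
      p • contactPoint γ (τ • w + w') - q • contactPoint γ (τ • (-w) + -w') =
      p • contactPoint γ (τ' • w + w') - q • contactPoint γ (τ' • (-w) + -w') := by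
    intro τ hτ τ' hτ'
    rw [← sub_eq_zero]
    apply eq_zero_of_inner_eq_zero hw
    · rw [inner_sub_right, (hrel τ hτ).1, (hrel τ' hτ').1, sub_self]
    · rw [inner_sub_right, (hrel τ hτ).2, (hrel τ' hτ').2, sub_self]
  obtain ⟨τ₁, hτ₁, hne⟩ := (infinite_of_mem_nhds τ₀ (hV.mem_nhds hτ₀)).nontrivial.exists_ne τ₀
  have hx1 : contactPoint γ (τ₁ • w + w') ≠ contactPoint γ (τ₀ • w + w') :=
    fun he => hne (h.contactPoint_injective hw he)
  have hx2 : contactPoint γ (τ₁ • (-w) + -w') ≠ contactPoint γ (τ₀ • (-w) + -w') :=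
    fun he => hne (h.contactPoint_injective hw2 he)
  have h01 := hconst τ₁ hτ₁ τ₀ hτ₀
  by_cases hp : p = 0
  · have hq : q ≠ 0 := by tauto
    rw [hp, zero_smul, zero_smul, zero_sub, zero_sub, neg_inj] at h01
    exact hx2 (smul_right_injective _ hq h01)
  by_cases hq : q = 0
  · rw [hq, zero_smul, zero_smul, sub_zero, sub_zero] at h01
    exact hx1 (smul_right_injective _ hp h01)
  have hns : ¬ HasCenterOfSymmetry Ω := by tauto
  -- For `pq < 0` the constant vector exhibits homotheties of ratios `p / q` and `q / p` carrying
  -- arcs of `γ` into `γ`; both ratios have modulus at most one and `p / q` is negative, so it is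
  -- `-1`.
  rcases lt_or_gt_of_ne (mul_ne_zero hp hq) with hneg' | hpos
  · set c := p • contactPoint γ (τ₀ • w + w') - q • contactPoint γ (τ₀ • (-w) + -w') with hc
    have key : ∀ {u u' : Plane}, planeDet u u' ≠ 0 → ∀ {r : ℝ} {d : Plane} (f : ℝ → Plane),
        (∀ τ, f τ ∈ Set.range γ) →
        (∀ τ ∈ V, f τ = r • contactPoint γ (τ • u + u') + d) →
        ∀ s, r • γ s + d ∈ Set.range γ := by
      intro u u' hu r d f hfr hf
      obtain ⟨s₀, hs₀⟩ := h.contactPoint_mem_range (smul_add_ne_zero hu τ₀)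
      have hd := h.inner_deriv_eq_zero (smul_add_ne_zero hu τ₀) hs₀
      have hct := (h.analyticAt_normalParam (w' := u') (h.inner_deriv_ne_zero hu hd)).continuousAt
      have hτ := h.normalParam_eq hu hd
      have hVn : V ∈ 𝓝 (normalParam γ u u' s₀) := by rw [hτ]; exact hV.mem_nhds hτ₀
      apply h.homothety_mem_range_of_eventually (s₀ := s₀)
      filter_upwards [h.eventually_eq_contactPoint hu hs₀, hct.eventually hVn] with s hs hsV
      rw [hs, ← hf _ hsV]
      exact hfr _
    have k1 := key hw (r := p / q) (d := -((1 / q) • c))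
      (fun τ => contactPoint γ (τ • (-w) + -w'))
      (fun τ => h.contactPoint_mem_range (smul_add_ne_zero hw2 τ)) (fun τ hτ => by
        rw [hc, ← hconst τ hτ τ₀ hτ₀, smul_sub, smul_smul, smul_smul]
        have : 1 / q * q = 1 := by field_simp
        rw [this, show 1 / q * p = p / q by ring]
        simp)
    have k2 := key hw2 (r := q / p) (d := (1 / p) • c)
      (fun τ => contactPoint γ (τ • w + w'))
      (fun τ => h.contactPoint_mem_range (smul_add_ne_zero hw τ)) (fun τ hτ => by
        rw [hc, ← hconst τ hτ τ₀ hτ₀, smul_sub, smul_smul, smul_smul]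
        have : 1 / p * p = 1 := by field_simp
        rw [this, show 1 / p * q = q / p by ring]
        simp)
    have a1 := h.abs_le_one_of_homothety k1
    have a2 := h.abs_le_one_of_homothety k2
    rw [abs_div, div_le_one (abs_pos.2 hq)] at a1
    rw [abs_div, div_le_one (abs_pos.2 hp)] at a2
    have hpq' : p / q = -1 := by
      rcases abs_eq_abs.1 (le_antisymm a1 a2) with e | e
      · rw [e] at hneg'; nlinarith [mul_self_nonneg q]
      · rw [e, neg_div, div_self hq]
    rw [hpq'] at k1
    exact hns (h.hasCenterOfSymmetry_of_reflection k1)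
  -- For `pq > 0`, use that the contact point is a monotone function of the normal: along `w` the
  -- contact points of `ξ` strictly advance with `τ`, those of `-ξ` never do.
  · have i1 := h.inner_contactPoint_lt (smul_add_ne_zero hw τ₀) (smul_add_ne_zero hw τ₁) hx1
    have i2 := h.inner_contactPoint_le (ξ := τ₁ • w + w') (smul_add_ne_zero hw τ₀)
    have i3 := h.inner_contactPoint_le (ξ := τ₀ • (-w) + -w') (smul_add_ne_zero hw2 τ₁)
    have i4 := h.inner_contactPoint_le (ξ := τ₁ • (-w) + -w') (smul_add_ne_zero hw2 τ₀)
    have e := congrArg (fun v : Plane => (inner ℝ ((τ₀ - τ₁) • w) v : ℝ)) h01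
    simp only [inner_add_left, inner_smul_left, inner_neg_left, conj_trivial,
      inner_sub_right, inner_smul_right] at i1 i2 i3 i4 e
    set A := (inner ℝ w (contactPoint γ (τ₀ • w + w')) : ℝ)
    set A₁ := (inner ℝ w (contactPoint γ (τ₁ • w + w')) : ℝ)
    set B := (inner ℝ w (contactPoint γ (τ₀ • (-w) + -w')) : ℝ)
    set B₁ := (inner ℝ w (contactPoint γ (τ₁ • (-w) + -w')) : ℝ)
    have j1 : 0 < (τ₀ - τ₁) * (A - A₁) := by linarith
    have j2 : (τ₀ - τ₁) * (B - B₁) ≤ 0 := by linarith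
    have j3 : p * ((τ₀ - τ₁) * (A - A₁)) = q * ((τ₀ - τ₁) * (B - B₁)) := by linarith
    have j4 : p * p * ((τ₀ - τ₁) * (A - A₁)) = p * q * ((τ₀ - τ₁) * (B - B₁)) := by
      linear_combination p * j3
    have j5 : 0 < p * p * ((τ₀ - τ₁) * (A - A₁)) := mul_pos (mul_self_pos.2 hp) j1
    nlinarith

end IsAnalyticOval

/-! ### Sums of translates of piecewise analytic functions -/

theorem exists_polynomial_antiderivative (P : Polynomial ℝ) :
    ∃ Q : Polynomial ℝ, Polynomial.derivative Q = P := by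
  induction P using Polynomial.induction_on' with
  | add p q hp hq =>
    obtain ⟨P, rfl⟩ := hp
    obtain ⟨Q, rfl⟩ := hq
    exact ⟨P + Q, Polynomial.derivative_add⟩
  | monomial n a =>
    refine ⟨Polynomial.monomial (n + 1) (a / (n + 1)), ?_⟩
    rw [Polynomial.derivative_monomial]
    congr 1
    push_cast
    field_simp

/-- A function with vanishing `n`-th derivative on an interval is a polynomial there. -/
theorem exists_polynomial_of_iteratedDeriv_eq_zero {a b : ℝ} (n : ℕ) :
    ∀ f : ℝ → ℝ, AnalyticOnNhd ℝ f (Set.Ioo a b) →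
      (∀ x ∈ Set.Ioo a b, iteratedDeriv n f x = 0) →
      ∃ P : Polynomial ℝ, ∀ x ∈ Set.Ioo a b, f x = P.eval x := by
  induction n with
  | zero =>
    intro f _ h0
    exact ⟨0, fun x hx => by simpa using h0 x hx⟩
  | succ n ih =>
    intro f hf h0
    obtain ⟨P, hP⟩ := ih (deriv f) hf.deriv (fun x hx => by rw [← iteratedDeriv_succ']; exact h0 x hx)
    obtain ⟨Q, rfl⟩ := exists_polynomial_antiderivative P
    have hd : ∀ x ∈ Set.Ioo a b, HasDerivAt (fun y => f y - Q.eval y) 0 x := by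
      intro x hx
      have := (hf x hx).differentiableAt.hasDerivAt.sub (Q.hasDerivAt x)
      rwa [hP x hx, sub_self] at this
    obtain ⟨c, hc⟩ := isOpen_Ioo.exists_is_const_of_deriv_eq_zero
      (isPreconnected_Ioo (a := a) (b := b))
      (fun x hx => (hd x hx).differentiableAt.differentiableWithinAt)
      (fun x hx => (hd x hx).deriv)
    refine ⟨Q + Polynomial.C c, fun x hx => ?_⟩
    have := hc x hx
    simp
    linarith

/-- If a sum of functions of the independent linear forms `s + λ τ_i` vanishes identically then
each of them is annihilated by a power of the derivation. -/
theorem iteratedDeriv_eq_zero_of_sum_eq_zero {ι : Type*} [DecidableEq ι] {I J : Set ℝ}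
    (hI : IsOpen I) (hJ : IsOpen J) (τ : ι → ℝ) (i₀ : ι) (S : Finset ι) :
    ∀ φ : ι → ℝ → ℝ, i₀ ∉ S → (∀ i ∈ S, τ i ≠ τ i₀) →
      (∀ i ∈ insert i₀ S, ∀ s ∈ I, ∀ l ∈ J, AnalyticAt ℝ (φ i) (s + l * τ i)) →
      (∀ s ∈ I, ∀ l ∈ J, ∑ i ∈ insert i₀ S, φ i (s + l * τ i) = 0) →
      ∀ s ∈ I, ∀ l ∈ J, iteratedDeriv S.card (φ i₀) (s + l * τ i₀) = 0 := by
  induction S using Finset.induction_on with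
  | empty =>
    intro φ _ _ _ h s hs l hl
    simpa using h s hs l hl
  | insert a S ha ih =>
    intro φ hi₀ hτ hφ hsum s hs l hl
    rw [Finset.mem_insert, not_or] at hi₀
    have hsub : insert i₀ S ⊆ insert i₀ (insert a S) :=
      Finset.insert_subset_insert _ (Finset.subset_insert _ _)
    have hne : τ i₀ - τ a ≠ 0 := sub_ne_zero.2 (hτ a (Finset.mem_insert_self _ _)).symm
    -- The operator `∂/∂l - τ_a ∂/∂s` kills the term of index `a` and turns `φ_i` into `(τ_i - τ_a)
    -- φ_i'`: one term fewer for one more derivative.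
    have key := ih (fun i => (τ i - τ a) • deriv (φ i)) hi₀.2
      (fun i hi => hτ i (Finset.mem_insert_of_mem hi))
      (fun i hi s hs l hl => ((hφ i (hsub hi) s hs l hl).deriv).const_smul) ?_ s hs l hl
    · have h1 : iteratedDeriv S.card ((τ i₀ - τ a) • deriv (φ i₀)) =
          (τ i₀ - τ a) • iteratedDeriv S.card (deriv (φ i₀)) := by
        ext x
        exact iteratedDeriv_const_smul_field _ _
      rw [h1, Pi.smul_apply, smul_eq_mul, mul_eq_zero] at key
      rw [Finset.card_insert_of_notMem ha, iteratedDeriv_succ']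
      exact key.resolve_left hne
    · intro s hs l hl
      have d1 : HasDerivAt (fun x => ∑ i ∈ insert i₀ (insert a S), φ i (x + l * τ i))
          (∑ i ∈ insert i₀ (insert a S), deriv (φ i) (s + l * τ i)) s := by
        apply HasDerivAt.fun_sum
        intro i hi
        have := (hφ i hi s hs l hl).differentiableAt.hasDerivAt
        exact this.comp_add_const s (l * τ i)
      have d2 : HasDerivAt (fun x => ∑ i ∈ insert i₀ (insert a S), φ i (s + x * τ i))
          (∑ i ∈ insert i₀ (insert a S), deriv (φ i) (s + l * τ i) * τ i) l := by
        apply HasDerivAt.fun_sum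
        intro i hi
        have := (hφ i hi s hs l hl).differentiableAt.hasDerivAt
        refine HasDerivAt.comp l (h₂ := φ i) this ?_
        simpa using ((hasDerivAt_id l).mul_const (τ i)).const_add s
      have z1 : ∑ i ∈ insert i₀ (insert a S), deriv (φ i) (s + l * τ i) = 0 := by
        refine d1.unique ((hasDerivAt_const s (0 : ℝ)).congr_of_eventuallyEq ?_)
        filter_upwards [hI.mem_nhds hs] with x hx using hsum x hx l hl
      have z2 : ∑ i ∈ insert i₀ (insert a S), deriv (φ i) (s + l * τ i) * τ i = 0 := by
        refine d2.unique ((hasDerivAt_const l (0 : ℝ)).congr_of_eventuallyEq ?_)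
        filter_upwards [hJ.mem_nhds hl] with x hx using hsum s hs x hx
      have z3 : ∑ i ∈ insert i₀ (insert a S), (τ i - τ a) * deriv (φ i) (s + l * τ i) = 0 := by
        have : ∀ i, (τ i - τ a) * deriv (φ i) (s + l * τ i) =
          deriv (φ i) (s + l * τ i) * τ i - τ a * deriv (φ i) (s + l * τ i) := fun i => by ring
        simp only [this]
        rw [Finset.sum_sub_distrib, ← Finset.mul_sum, z1, z2]
        simp
      rw [Finset.insert_comm, Finset.sum_insert (by
        rw [Finset.mem_insert, not_or]; exact ⟨fun e => hi₀.1 e.symm, ha⟩)] at z3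
      simpa using z3

/-- The preimage of a null set by a function that is almost everywhere analytic with nonzero
derivative is null. -/
theorem ae_notMem_of_deriv_ne_zero {f : ℝ → ℝ}
    (hf : ∀ᵐ s : ℝ, AnalyticAt ℝ f s ∧ deriv f s ≠ 0) {N : Set ℝ} (hN : volume N = 0) :
    ∀ᵐ s : ℝ, f s ∉ N := by
  have hZ : volume {s | f s ∈ N ∧ AnalyticAt ℝ f s ∧ deriv f s ≠ 0} = 0 := by
    refine measure_null_of_locally_null _ ?_
    rintro x ⟨-, ha, hd⟩
    -- Locally the bad set lies in the image of a null set under the differentiable inverse `g`, and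
    -- such images are null.
    set g := ha.hasStrictDerivAt.localInverse _ _ _ hd
    have hg : AnalyticAt ℝ g (f x) := ha.analyticAt_localInverse hd
    have hleft : ∀ᶠ s in 𝓝 x, g (f s) = s := HasStrictDerivAt.eventually_left_inverse ..
    have hV : ∀ᶠ s in 𝓝 x, AnalyticAt ℝ g (f s) :=
      ha.continuousAt.eventually hg.eventually_analyticAt
    refine ⟨{s | f s ∈ N ∧ AnalyticAt ℝ f s ∧ deriv f s ≠ 0} ∩
      {s | g (f s) = s ∧ AnalyticAt ℝ g (f s)},
      Filter.inter_mem self_mem_nhdsWithin (mem_nhdsWithin_of_mem_nhds (hleft.and hV)), ?_⟩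
    refine measure_mono_null ?_ (addHaar_image_eq_zero_of_differentiableOn_of_addHaar_eq_zero
      volume (f := g) (s := N ∩ {y | AnalyticAt ℝ g y})
      (fun y hy => hy.2.differentiableAt.differentiableWithinAt)
      (measure_mono_null Set.inter_subset_left hN))
    rintro s ⟨⟨h1, -⟩, h2, h3⟩
    exact ⟨f s, ⟨h1, h3⟩, h2⟩
  filter_upwards [hf, measure_eq_zero_iff_ae_notMem.1 hZ] with s h1 h2 h3
  exact h2 ⟨h3, h1⟩

theorem exists_rat_Ioo {x : ℝ} {U : Set ℝ} (hU : U ∈ 𝓝 x) :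
    ∃ a b : ℚ, x ∈ Set.Ioo (a : ℝ) b ∧ Set.Ioo (a : ℝ) b ⊆ U := by
  obtain ⟨ε, hε, hball⟩ := Metric.mem_nhds_iff.1 hU
  obtain ⟨a, ha, ha'⟩ := exists_rat_btwn (show x - ε < x by linarith)
  obtain ⟨b, hb, hb'⟩ := exists_rat_btwn (show x < x + ε by linarith)
  refine ⟨a, b, ⟨ha', hb⟩, fun y hy => hball ?_⟩
  rw [Metric.mem_ball, Real.dist_eq, abs_lt]
  constructor <;> linarith [hy.1, hy.2]

/-- A generic sum of dilated translates `∑ c_i H_i(s + e^{2r} τ_i)` pulls null sets back to null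
sets. -/
theorem ae_ae_sum_notMem {ι : Type*} [DecidableEq ι] {S : Finset ι} {i₀ : ι} (hi₀ : i₀ ∈ S)
    {τ c : ι → ℝ} (hτ : ∀ i ∈ S, i ≠ i₀ → τ i ≠ τ i₀) (hc : c i₀ ≠ 0) {H : ι → ℝ → ℝ}
    (hH : ∀ i ∈ S, {x | ¬ AnalyticAt ℝ (H i) x}.Countable)
    (hpoly : ∀ a b : ℝ, a < b → ∀ P : Polynomial ℝ, ¬ ∀ x ∈ Set.Ioo a b, H i₀ x = P.eval x)
    {N : Set ℝ} (hN : volume N = 0) :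
    ∀ᵐ r : ℝ, ∀ᵐ s : ℝ,
      Real.exp (-r) * ∑ i ∈ S, c i * H i (s + Real.exp (2 * r) * τ i) ∉ N := by
  set A : Set (ℝ × ℝ) := {x | ∀ i ∈ S, AnalyticAt ℝ (H i) (x.1 + Real.exp (2 * x.2) * τ i)} with hA
  have hAo : IsOpen A := by
    have : A = ⋂ i ∈ S, (fun x : ℝ × ℝ => x.1 + Real.exp (2 * x.2) * τ i) ⁻¹'
        {y | AnalyticAt ℝ (H i) y} := by
      ext x; simp [hA]
    rw [this]
    exact isOpen_biInter_finset fun i _ => (isOpen_analyticAt ℝ (H i)).preimage (by fun_prop)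
  have hAae : ∀ r : ℝ, ∀ᵐ s : ℝ, (s, r) ∈ A := by
    intro r
    simp only [hA, Set.mem_ofPred_eq]
    refine (ae_ball_iff S.countable_toSet).2 fun i hi => ?_
    have h1 : ((fun s => s + Real.exp (2 * r) * τ i) ⁻¹' {x | ¬ AnalyticAt ℝ (H i) x}).Countable :=
      (hH i hi).preimage_of_injOn (add_left_injective _).injOn
    filter_upwards [measure_eq_zero_iff_ae_notMem.1 (h1.measure_zero volume)] with s hs
    simpa using hs
  set F : ℝ → ℝ → ℝ := fun r s => ∑ i ∈ S, c i * deriv (H i) (s + Real.exp (2 * r) * τ i) with hF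
  have hFan : ∀ r s, (s, r) ∈ A → AnalyticAt ℝ (F r) s := by
    intro r s h
    refine Finset.analyticAt_fun_sum _ fun i hi => analyticAt_const.mul ?_
    exact AnalyticAt.fun_comp (g := deriv (H i)) (h i hi).deriv (by fun_prop)
  have hFan' : ∀ r s, (s, r) ∈ A → AnalyticAt ℝ (fun r => F r s) r := by
    intro r s h
    refine Finset.analyticAt_fun_sum _ fun i hi => analyticAt_const.mul ?_
    refine AnalyticAt.fun_comp (g := deriv (H i)) (h i hi).deriv ?_
    have : AnalyticAt ℝ (fun r => Real.exp (2 * r)) r := by fun_prop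
    fun_prop
  -- The bad `r`, sorted by a rational box inside the domain of analyticity on whose `s`-side `F r`
  -- vanishes. Countably many boxes suffice, so each can be treated alone.
  set R : ℚ × ℚ × ℚ × ℚ → Set ℝ := fun x => {r | r ∈ Set.Ioo (x.2.2.1 : ℝ) x.2.2.2 ∧
    (x.1 : ℝ) < x.2.1 ∧ Set.Ioo (x.1 : ℝ) x.2.1 ×ˢ Set.Ioo (x.2.2.1 : ℝ) x.2.2.2 ⊆ A ∧
    ∀ s ∈ Set.Ioo (x.1 : ℝ) x.2.1, F r s = 0} with hR
  have hRnull : ∀ x, volume (R x) = 0 := by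
    rintro ⟨a, b, m, n⟩
    by_contra hne
    -- A set consisting of isolated points is null. From an accumulation point, the identity theorem
    -- in `r` spreads the vanishing over the whole `r`-side of the box.
    have hacc : ∃ r₀ ∈ R (a, b, m, n), ∃ᶠ r in 𝓝[≠] r₀, r ∈ R (a, b, m, n) := by
      by_contra hcon
      push Not at hcon
      refine hne (measure_null_of_locally_null _ fun r₀ hr₀ => ?_)
      have h1 := eventually_nhdsWithin_iff.1 (hcon r₀ hr₀)
      refine ⟨_, Filter.inter_mem self_mem_nhdsWithin (mem_nhdsWithin_of_mem_nhds h1), ?_⟩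
      refine measure_mono_null (t := {r₀}) ?_ (by simp)
      rintro r ⟨hr, hr'⟩
      by_contra hne
      exact hr' hne hr
    obtain ⟨r₀, hr₀, hfr⟩ := hacc
    obtain ⟨hr₀m, hab, hsubA, -⟩ := hr₀
    simp only at hr₀m hab hsubA
    have hzero : ∀ s ∈ Set.Ioo (a : ℝ) b, ∀ r ∈ Set.Ioo (m : ℝ) n, F r s = 0 := by
      intro s hs
      exact AnalyticOnNhd.eqOn_zero_of_preconnected_of_frequently_eq_zero
        (f := fun r => F r s) (fun r hr => hFan' r s (hsubA ⟨hs, hr⟩)) isPreconnected_Ioo hr₀m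
        (hfr.mono fun r hr => hr.2.2.2 s hs)
    -- The substitution `l = e^{2r}` makes the arguments the linear forms `s + l τ_i`.
    have hmem : ∀ l ∈ Set.Ioo (Real.exp (2 * m)) (Real.exp (2 * n)),
        Real.log l / 2 ∈ Set.Ioo (m : ℝ) n ∧ Real.exp (2 * (Real.log l / 2)) = l := by
      rintro l ⟨h1, h2⟩
      have hl : 0 < l := (Real.exp_pos _).trans h1
      refine ⟨⟨?_, ?_⟩, ?_⟩
      · have := (Real.lt_log_iff_exp_lt hl).2 h1; linarith
      · have := (Real.log_lt_iff_lt_exp hl).2 h2; linarith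
      · rw [mul_div_cancel₀ _ (two_ne_zero), Real.exp_log hl]
    have hins : insert i₀ (S.erase i₀) = S := Finset.insert_erase hi₀
    have hel := iteratedDeriv_eq_zero_of_sum_eq_zero (isOpen_Ioo (a := (a : ℝ)) (b := b))
      (isOpen_Ioo (a := Real.exp (2 * m)) (b := Real.exp (2 * n))) τ i₀ (S.erase i₀)
      (fun i => c i • deriv (H i)) (Finset.notMem_erase _ _)
      (fun i hi => hτ i (Finset.mem_of_mem_erase hi) (Finset.ne_of_mem_erase hi))
      (by
        rw [hins]
        intro i hi s hs l hl
        have := hsubA (Set.mk_mem_prod hs (hmem l hl).1) i hi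
        simp only [(hmem l hl).2] at this
        exact this.deriv.const_smul)
      (by
        rw [hins]
        intro s hs l hl
        have := hzero s hs _ (hmem l hl).1
        simpa only [hF, (hmem l hl).2, Pi.smul_apply, smul_eq_mul] using this)
    have hl₀ : Real.exp (2 * r₀) ∈ Set.Ioo (Real.exp (2 * m)) (Real.exp (2 * n)) :=
      ⟨Real.exp_lt_exp.2 (by linarith [hr₀m.1]), Real.exp_lt_exp.2 (by linarith [hr₀m.2])⟩
    set t := Real.exp (2 * r₀) * τ i₀ with ht
    -- One derivative more than the number of eliminated terms, since `F` involves `deriv (H i)`.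
    obtain ⟨P, hP⟩ := exists_polynomial_of_iteratedDeriv_eq_zero (a := a + t) (b := b + t)
      ((S.erase i₀).card + 1) (H i₀) (fun x hx => by
        have := hsubA (Set.mk_mem_prod (show x - t ∈ Set.Ioo (a : ℝ) b from
          ⟨by linarith [hx.1], by linarith [hx.2]⟩) hr₀m) i₀ hi₀
        simpa [ht] using this) (fun x hx => by
        have h1 := hel (x - t) ⟨by linarith [hx.1], by linarith [hx.2]⟩ _ hl₀
        have h2 : iteratedDeriv (S.erase i₀).card (c i₀ • deriv (H i₀)) =
            c i₀ • iteratedDeriv (S.erase i₀).card (deriv (H i₀)) := by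
          ext x
          exact iteratedDeriv_const_smul_field _ _
        rw [h2, Pi.smul_apply, smul_eq_mul, mul_eq_zero, ← ht, sub_add_cancel] at h1
        rw [iteratedDeriv_succ']
        exact h1.resolve_left hc)
    exact hpoly (a + t) (b + t) (by linarith) P hP
  have hRae : ∀ᵐ r : ℝ, ∀ x, r ∉ R x :=
    ae_all_iff.2 fun x => measure_eq_zero_iff_ae_notMem.1 (hRnull x)
  filter_upwards [hRae] with r hr
  have hder : ∀ s, (s, r) ∈ A → HasDerivAt
      (fun s => Real.exp (-r) * ∑ i ∈ S, c i * H i (s + Real.exp (2 * r) * τ i))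
      (Real.exp (-r) * F r s) s := by
    intro s hs
    refine HasDerivAt.const_mul _ (HasDerivAt.fun_sum fun i hi => HasDerivAt.const_mul _ ?_)
    exact ((hs i hi).differentiableAt.hasDerivAt).comp_add_const s _
  refine ae_notMem_of_deriv_ne_zero ?_ hN
  -- For `r` outside every `R x`, the analytic function `F r` vanishes on no interval of its domain,
  -- so its zeros are isolated.
  have hZ : volume {s | (s, r) ∈ A ∧ F r s = 0} = 0 := by
    refine measure_null_of_locally_null _ ?_
    rintro s₀ ⟨hs₀, -⟩
    rcases (hFan r s₀ hs₀).eventually_eq_zero_or_eventually_ne_zero with h0 | h0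
    · exfalso
      obtain ⟨U, hU, V, hV, hUV⟩ := mem_nhds_prod_iff.1 (hAo.mem_nhds hs₀)
      obtain ⟨a, b, hab, hab'⟩ := exists_rat_Ioo (Filter.inter_mem hU h0)
      obtain ⟨m, n, hmn, hmn'⟩ := exists_rat_Ioo hV
      refine hr (a, b, m, n) ⟨hmn, hab.1.trans hab.2, ?_, fun s hs => (hab' hs).2⟩
      exact (Set.prod_mono (fun s hs => (hab' hs).1) hmn').trans hUV
    · refine ⟨_, Filter.inter_mem self_mem_nhdsWithin
        (mem_nhdsWithin_of_mem_nhds (eventually_nhdsWithin_iff.1 h0)), ?_⟩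
      refine measure_mono_null (t := {s₀}) ?_ (by simp)
      rintro s ⟨hs, hs'⟩
      by_contra hne
      exact hs' hne hs.2
  filter_upwards [hAae r, measure_eq_zero_iff_ae_notMem.1 hZ] with s h1 h2
  refine ⟨?_, ?_⟩
  · refine analyticAt_const.mul (Finset.analyticAt_fun_sum _ fun i hi => analyticAt_const.mul ?_)
    exact AnalyticAt.fun_comp (g := H i) (h1 i hi) (by fun_prop)
  · rw [(hder s h1).deriv]
    exact mul_ne_zero (Real.exp_ne_zero _) fun h0 => h2 ⟨h1, h0⟩

/-! ### Homogeneous functions that are polynomial along two directions -/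

/-- The polynomial `(1 - ηX) ^ n * P (X / (1 - ηX))`. -/
def moebiusNumerator (η : ℝ) (n : ℕ) (P : Polynomial ℝ) : Polynomial ℝ :=
  ∑ i ∈ Finset.range (n + 1),
    Polynomial.C (P.coeff i) * Polynomial.X ^ i * (1 - Polynomial.C η * Polynomial.X) ^ (n - i)

theorem eval_moebiusNumerator (η : ℝ) {n : ℕ} {P : Polynomial ℝ} (hP : P.natDegree ≤ n) {x : ℝ}
    (hx : 1 - η * x ≠ 0) :
    (moebiusNumerator η n P).eval x = (1 - η * x) ^ n * P.eval (x / (1 - η * x)) := by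
  rw [P.eval_eq_sum_range' (Nat.lt_succ_of_le hP), moebiusNumerator, Polynomial.eval_finsetSum,
    Finset.mul_sum]
  refine Finset.sum_congr rfl fun i hi => ?_
  have hi' : i ≤ n := Nat.lt_succ_iff.1 (Finset.mem_range.1 hi)
  simp only [Polynomial.eval_mul, Polynomial.eval_C, Polynomial.eval_pow, Polynomial.eval_X,
    Polynomial.eval_sub, Polynomial.eval_one]
  rw [div_pow, ← Nat.sub_add_cancel hi', pow_add]
  simp only [Nat.add_sub_cancel]
  field_simp

theorem eval_moebiusNumerator_pole {η : ℝ} (hη : η ≠ 0) (n : ℕ) (P : Polynomial ℝ) :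
    (moebiusNumerator η n P).eval (1 / η) = P.coeff n * (1 / η) ^ n := by
  have h0 : 1 - η * (1 / η) = 0 := by field_simp; simp
  rw [moebiusNumerator, Polynomial.eval_finsetSum, Finset.sum_eq_single n]
  · simp
  · intro i hi hne
    have : n - i ≠ 0 := by
      have := Finset.mem_range.1 hi
      omega
    simp only [Polynomial.eval_mul, Polynomial.eval_C, Polynomial.eval_pow, Polynomial.eval_X,
      Polynomial.eval_sub, Polynomial.eval_one]
    rw [h0, zero_pow this, mul_zero]
  · simp

/-- If `P` had degree `n + 2`, clearing denominators would leave a factor `(1 - ηX)^(n+1)` on the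
right. At the pole `X = 1/η` the right side vanishes, while the left one is the leading coefficient
of `P` times nonzero factors, as `η' ≠ η`. -/
theorem natDegree_le_one_of_moebius_eq {η η' : ℝ} (hη : η ≠ 0) (hne : η ≠ η')
    {P Q : Polynomial ℝ} {a b : ℝ} (hab : a < b)
    (h : ∀ x ∈ Set.Ioo a b, 1 - η * x ≠ 0 ∧ 1 - η' * x ≠ 0 ∧
      (1 - η * x) * P.eval (x / (1 - η * x)) = (1 - η' * x) * Q.eval (x / (1 - η' * x))) :
    P.natDegree ≤ 1 := by
  by_contra hcon
  push Not at hcon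
  obtain ⟨n, hn⟩ : ∃ n, P.natDegree = n + 2 := ⟨P.natDegree - 2, by omega⟩
  set m := Q.natDegree with hm
  have hpoly : moebiusNumerator η (n + 2) P * (1 - Polynomial.C η' * Polynomial.X) ^ m =
      (1 - Polynomial.C η * Polynomial.X) ^ (n + 1) *
        ((1 - Polynomial.C η' * Polynomial.X) * moebiusNumerator η' m Q) := by
    refine Polynomial.eq_of_infinite_eval_eq _ _ ((Set.Ioo_infinite hab).mono fun x hx => ?_)
    obtain ⟨h1, h2, h3⟩ := h x hx
    simp only [Set.mem_ofPred_eq, Polynomial.eval_mul, Polynomial.eval_C, Polynomial.eval_pow,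
      Polynomial.eval_X, Polynomial.eval_sub, Polynomial.eval_one]
    rw [eval_moebiusNumerator η hn.le h1, eval_moebiusNumerator η' hm.le h2]
    linear_combination (1 - η * x) ^ (n + 1) * (1 - η' * x) ^ m * h3
  have h0 : 1 - η * (1 / η) = 0 := by field_simp; simp
  have he := congrArg (Polynomial.eval (1 / η)) hpoly
  simp only [Polynomial.eval_mul, Polynomial.eval_C, Polynomial.eval_pow,
      Polynomial.eval_X, Polynomial.eval_sub, Polynomial.eval_one] at he
  rw [eval_moebiusNumerator_pole hη, h0, zero_pow (Nat.succ_ne_zero n), zero_mul] at he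
  have h4 : 1 - η' * (1 / η) ≠ 0 := by
    intro h5
    apply hne
    field_simp at h5
    linarith
  have h6 : P.coeff (n + 2) ≠ 0 := by
    rw [← hn, Polynomial.coeff_natDegree, Polynomial.leadingCoeff_ne_zero]
    rintro rfl
    simp at hn
  exact mul_ne_zero (mul_ne_zero h6 (pow_ne_zero _ (one_div_ne_zero hη))) (pow_ne_zero _ h4) he

/-- A positively homogeneous function of the plane which is not linear on any sector is, along
the lines of a suitable direction, not polynomial on any interval. -/
theorem exists_direction_not_polynomial {G : Plane → ℝ}
    (hG : ∀ (c : ℝ) (v : Plane), 0 < c → G (c • v) = c * G v)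
    (hlin : ∀ ε : ℤˣ, ∀ a b α β : ℝ, a < b →
      ¬ ∀ x ∈ Set.Ioo a b, G ((ε : ℝ) • !₂[x, 1]) = α * x + β) :
    ∃ η : ℝ, ∀ ε : ℤˣ, ∀ a b : ℝ, a < b → ∀ P : Polynomial ℝ,
      ¬ ∀ x ∈ Set.Ioo a b, G ((ε : ℝ) • !₂[x, η * x + 1]) = P.eval x := by
  by_contra hcon
  push Not at hcon
  -- Central projection between the lines `y = 1` and `y = ηx + 1`: `(x, 1) = (1 - ηx) (u, ηu + 1)`
  -- with `u = x / (1 - ηx)`. The sign of `1 - ηx` is absorbed into the unit, and the interval is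
  -- shrunk to rational endpoints.
  have hbad : ∀ η : ℝ, ∃ z : ℤˣ × ℚ × ℚ, (z.2.1 : ℝ) < z.2.2 ∧ ∃ Q : Polynomial ℝ,
      ∀ x ∈ Set.Ioo (z.2.1 : ℝ) z.2.2, 1 - η * x ≠ 0 ∧
        G ((z.1 : ℝ) • !₂[x, 1]) = (1 - η * x) * Q.eval (x / (1 - η * x)) := by
    intro η
    obtain ⟨ε, a, b, hab, P, hP⟩ := hcon η
    obtain ⟨t, ht, ht0⟩ : ∃ t ∈ Set.Ioo a b, η * t + 1 ≠ 0 := by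
      by_contra hno
      push Not at hno
      have h1 := hno ((2 * a + b) / 3) ⟨by linarith, by linarith⟩
      have h2 := hno ((a + 2 * b) / 3) ⟨by linarith, by linarith⟩
      have h3 : η * (b - a) = 0 := by linarith
      rcases mul_eq_zero.1 h3 with h4 | h4
      · rw [h4] at h1; simp at h1
      · linarith
    set x₀ := t / (η * t + 1) with hx₀
    have hx₀' : 1 - η * x₀ = 1 / (η * t + 1) := by rw [hx₀]; field_simp; ring
    have hne₀ : 1 - η * x₀ ≠ 0 := by rw [hx₀']; exact one_div_ne_zero ht0
    have hval : x₀ / (1 - η * x₀) = t := by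
      rw [hx₀', hx₀, div_div_div_cancel_right₀ ht0, div_one]
    have hc : ContinuousAt (fun x => x / (1 - η * x)) x₀ :=
      continuousAt_id.div (by fun_prop) hne₀
    have hev1 : ∀ᶠ x in 𝓝 x₀, x / (1 - η * x) ∈ Set.Ioo a b :=
      hc.eventually (isOpen_Ioo.mem_nhds (by simpa only [hval] using ht))
    have hc2 : Continuous fun x => 1 - η * x := by fun_prop
    have key : ∃ δ : ℤˣ, ∀ᶠ x in 𝓝 x₀, 0 < (δ : ℝ) * (1 - η * x) := by
      rcases lt_or_gt_of_ne hne₀ with h | h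
      · refine ⟨-1, ?_⟩
        filter_upwards [hc2.continuousAt.eventually (isOpen_Iio.mem_nhds h)] with x hx
        have : 1 - η * x < 0 := hx
        push_cast
        linarith
      · refine ⟨1, ?_⟩
        filter_upwards [hc2.continuousAt.eventually (isOpen_Ioi.mem_nhds h)] with x hx
        have : 0 < 1 - η * x := hx
        push_cast
        linarith
    obtain ⟨δ, hδ⟩ := key
    obtain ⟨c, d, hcd, hsub⟩ := exists_rat_Ioo (Filter.inter_mem hev1 hδ)
    refine ⟨(ε * δ, c, d), hcd.1.trans hcd.2, Polynomial.C (δ : ℝ) * P, fun x hx => ?_⟩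
    obtain ⟨h1, h2⟩ := hsub hx
    have h2' : 0 < (δ : ℝ) * (1 - η * x) := h2
    have hne : 1 - η * x ≠ 0 := fun h0 => by rw [h0, mul_zero] at h2'; exact h2'.false
    refine ⟨hne, ?_⟩
    have h3 := hP _ h1
    have hδδ : (δ : ℝ) * δ = 1 := by
      rcases Int.units_eq_one_or δ with rfl | rfl <;> simp
    have h4 : ((ε * δ : ℤˣ) : ℝ) • (!₂[x, 1] : Plane) = ((δ : ℝ) * (1 - η * x)) •
        ((ε : ℝ) • (!₂[x / (1 - η * x), η * (x / (1 - η * x)) + 1] : Plane)) := by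
      have hu : (1 - η * x) * (x / (1 - η * x)) = x := mul_div_cancel₀ x hne
      generalize x / (1 - η * x) = u at hu
      apply plane_ext
      · simp
        linear_combination (-(ε * δ : ℝ)) * hu
      · simp
        linear_combination (-(ε * δ * η : ℝ)) * hu
    simp only at h4 ⊢
    rw [h4, hG _ _ h2', h3, Polynomial.eval_mul, Polynomial.eval_C]
    ring
  choose z hz using hbad
  -- Pigeonhole: uncountably many positive `η`, countably many choices of sign and rational
  -- interval. Positivity supplies `η ≠ 0`.
  obtain ⟨η, η', hne, heq⟩ : ∃ η η' : Set.Ioi (0 : ℝ), η ≠ η' ∧ z η = z η' := by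
    have : ¬ Function.Injective fun η : Set.Ioi (0 : ℝ) => z η := by
      intro hinj
      have hc : (Set.Ioi (0 : ℝ)).Countable := Set.countable_coe_iff.1 hinj.countable
      have := Cardinal.Real.Ioo_countable_iff.1 (hc.mono fun x (hx : x ∈ Set.Ioo (0 : ℝ) 1) => hx.1)
      linarith
    rw [Function.Injective] at this
    push Not at this
    obtain ⟨η, η', h1, h2⟩ := this
    exact ⟨η, η', h2, h1⟩
  obtain ⟨hlt, Q, hQ⟩ := hz η
  obtain ⟨-, Q', hQ'⟩ := hz η'
  rw [← heq] at hQ'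
  have hdeg : Q.natDegree ≤ 1 := natDegree_le_one_of_moebius_eq η.2.ne'
    (fun h => hne (Subtype.ext h)) hlt (Q := Q') fun x hx =>
      ⟨(hQ x hx).1, (hQ' x hx).1, (hQ x hx).2.symm.trans (hQ' x hx).2⟩
  refine hlin (z η).1 _ _ (Q.coeff 1 - Q.coeff 0 * η) (Q.coeff 0) hlt fun x hx => ?_
  obtain ⟨h1, h2⟩ := hQ x hx
  rw [h2, Q.eval_eq_sum_range' (Nat.lt_succ_of_le hdeg), Finset.sum_range_succ, Finset.sum_range_one]
  field_simp
  ring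

theorem IsAnalyticOval.exists_direction_not_polynomial {γ : ℝ → Plane} {Ω : Set Plane}
    (h : IsAnalyticOval γ Ω) {p q : ℝ} (hpq : p ≠ 0 ∨ q ≠ 0)
    (hsym : p = 0 ∨ q = 0 ∨ ¬ HasCenterOfSymmetry Ω) :
    ∃ η : ℝ, ∀ ε : ℤˣ, ∀ a b : ℝ, a < b → ∀ P : Polynomial ℝ,
      ¬ ∀ x ∈ Set.Ioo a b, p * curveY γ ((ε : ℝ) • !₂[x, η * x + 1]) +
        q * curveY γ (-((ε : ℝ) • !₂[x, η * x + 1])) = P.eval x := by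
  refine _root_.exists_direction_not_polynomial
    (G := fun v => p * curveY γ v + q * curveY γ (-v)) ?_ ?_
  · intro c v hc
    rw [← smul_neg, h.curveY_smul _ hc, h.curveY_smul _ hc]
    ring
  · intro ε a b α β hab hcon
    have hε : (ε : ℝ) * ε = 1 := by
      rcases Int.units_eq_one_or ε with rfl | rfl <;> simp
    refine h.not_affine hpq hsym (w := !₂[(ε : ℝ), 0]) (w' := !₂[0, (ε : ℝ)])
      (by simp [planeDet]) hab (α := α) (β := β) fun x hx => ?_
    rw [← hcon x hx]
    have : x • (!₂[(ε : ℝ), 0] : Plane) + !₂[0, (ε : ℝ)] = (ε : ℝ) • !₂[x, 1] := by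
      apply plane_ext <;> simp [mul_comm]
    rw [this]

/-! ### Measure theory on the space of lattices -/

instance : PolishSpace SL2R :=
  haveI : PolishSpace (Matrix (Fin 2) (Fin 2) ℝ) := inferInstanceAs (PolishSpace (Fin 2 → Fin 2 → ℝ))
  Matrix.SpecialLinearGroup.isClosedEmbedding_val.polishSpace

theorem mem_SL2Z_iff (g : SL2R) : g ∈ SL2Z ↔ ∀ i j, g.1 i j ∈ Set.range ((↑) : ℤ → ℝ) := by
  constructor
  · rintro ⟨A, rfl⟩ i j
    exact ⟨A.1 i j, rfl⟩
  · intro h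
    choose A hA using h
    have hdet : (Matrix.of A).det = 1 := by
      have h1 : ((Matrix.of A).det : ℝ) = 1 := by
        rw [← g.2, Matrix.det_fin_two, Matrix.det_fin_two]
        push_cast
        simp [hA]
      exact_mod_cast h1
    refine ⟨⟨Matrix.of A, hdet⟩, ?_⟩
    ext i j
    exact hA i j

instance : IsClosed (SL2Z : Set SL2R) := by
  have : (SL2Z : Set SL2R) = ⋂ i, ⋂ j, (fun g : SL2R => g.1 i j) ⁻¹' Set.range ((↑) : ℤ → ℝ) := by
    ext g
    simp only [SetLike.mem_coe, mem_SL2Z_iff, Set.mem_iInter, Set.mem_preimage]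
  rw [this]
  refine isClosed_iInter fun i => isClosed_iInter fun j => ?_
  exact Int.isClosedEmbedding_coe_real.isClosed_range.preimage
    (Continuous.matrix_elem continuous_subtype_val i j)

/-- The projection is a Borel surjection from a standard Borel space, so it detects Borel sets. Sets
of lattices can therefore be described through integral coordinates in a basis `g`. -/
theorem measurableSet_lattice_iff {s : Set LatticeSpace} :
    MeasurableSet s ↔
      MeasurableSet[borel SL2R] ((QuotientGroup.mk : SL2R → LatticeSpace) ⁻¹' s) := by
  let _ : MeasurableSpace SL2R := borel SL2R
  have _ : BorelSpace SL2R := ⟨rfl⟩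
  have hc : Continuous (QuotientGroup.mk : SL2R → LatticeSpace) := continuous_quot_mk
  exact (hc.measurable.measurableSet_preimage_iff_of_surjective
    QuotientGroup.mk_surjective).symm

/-- The lattice vector with integral coordinates `n` in the basis given by the columns of `g`. -/
def matVec (g : SL2R) (n : ℤ × ℤ) : Plane :=
  !₂[g.1 0 0 * n.1 + g.1 0 1 * n.2, g.1 1 0 * n.1 + g.1 1 1 * n.2]

theorem continuous_entry (i j : Fin 2) : Continuous fun g : SL2R => g.1 i j :=
  Continuous.matrix_elem continuous_subtype_val i j

theorem continuous_matVec (n : ℤ × ℤ) : Continuous fun g : SL2R => matVec g n := by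
  have h00 := continuous_entry 0 0
  have h01 := continuous_entry 0 1
  have h10 := continuous_entry 1 0
  have h11 := continuous_entry 1 1
  refine (PiLp.continuous_toLp 2 _).comp (continuous_pi fun i => ?_)
  fin_cases i <;> simp <;> fun_prop

theorem mem_latticeVectors_iff (g : SL2R) (v : Plane) :
    v ∈ latticeVectors (g : LatticeSpace) ↔ ∃ n : ℤ × ℤ, v = matVec g n := by
  constructor
  · rintro ⟨g', hg', n, rfl⟩
    obtain ⟨A, hA⟩ : g⁻¹ * g' ∈ SL2Z := QuotientGroup.eq.1 hg'.symm
    have hg : g' = g * (Matrix.SpecialLinearGroup.map (Int.castRingHom ℝ)) A := by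
      rw [hA, mul_inv_cancel_left]
    refine ⟨(A.1 0 0 * n 0 + A.1 0 1 * n 1, A.1 1 0 * n 0 + A.1 1 1 * n 1), ?_⟩
    rw [hg]
    apply plane_ext
    · simp [matVec, Matrix.mul_apply, Matrix.mulVec, dotProduct, Fin.sum_univ_two]
      ring
    · simp [matVec, Matrix.mul_apply, Matrix.mulVec, dotProduct, Fin.sum_univ_two]
      ring
  · rintro ⟨n, rfl⟩
    refine ⟨g, rfl, ![n.1, n.2], ?_⟩
    apply plane_ext <;> simp [matVec, Matrix.mulVec, dotProduct, Fin.sum_univ_two]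

theorem planeDet_matVec (g : SL2R) (m n : ℤ × ℤ) :
    planeDet (matVec g m) (matVec g n) = m.1 * n.2 - m.2 * n.1 := by
  have h := g.2
  rw [Matrix.det_fin_two] at h
  simp only [planeDet, matVec]
  simp
  linear_combination ((m.1 : ℝ) * n.2 - m.2 * n.1) * h

theorem matVec_smul_add (g : SL2R) (k m n : ℤ × ℤ) :
    (k.1 : ℝ) • matVec g m + (k.2 : ℝ) • matVec g n =
      matVec g (k.1 * m.1 + k.2 * n.1, k.1 * m.2 + k.2 * n.2) := by
  apply plane_ext <;> simp [matVec] <;> ring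

theorem matVec_neg (g : SL2R) (n : ℤ × ℤ) : matVec g (-n) = -matVec g n := by
  apply plane_ext <;> simp [matVec] <;> ring

theorem matVec_eq_zero_iff (g : SL2R) (n : ℤ × ℤ) : matVec g n = 0 ↔ n = 0 := by
  constructor
  · intro h
    have h1 := planeDet_matVec g n (1, 0)
    have h2 := planeDet_matVec g n (0, 1)
    rw [h] at h1 h2
    simp [planeDet] at h1 h2
    have h3 : n.1 = 0 := by exact_mod_cast h2.symm
    ext <;> simp [h1, h3]
  · rintro rfl
    apply plane_ext <;> simp [matVec]

theorem matVec_injective (g : SL2R) : Function.Injective (matVec g) := by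
  intro m n h
  have : matVec g (m + -n) = matVec g m + matVec g (-n) := by
    apply plane_ext <;> simp [matVec] <;> ring
  rw [matVec_neg, h, add_neg_cancel, matVec_eq_zero_iff] at this
  exact sub_eq_zero.1 (by rw [sub_eq_add_neg]; exact this)

/-- A Borel set of lattices which almost every orbit piece `a(s) L` meets in a null set is null. -/
theorem lattice_null_of_ae_curve {μ : Measure LatticeSpace} [IsProbabilityMeasure μ]
    [SMulInvariantMeasure SL2R LatticeSpace μ] {a : ℝ → SL2R} (ha : Continuous a)
    {B : Set LatticeSpace} (hB : MeasurableSet B) (h : ∀ᵐ L ∂μ, ∀ᵐ s : ℝ, a s • L ∉ B) :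
    μ B = 0 := by
  have hc : Continuous fun x : LatticeSpace × ℝ => a x.2 • x.1 :=
    (ha.comp continuous_snd).smul continuous_fst
  have hm : MeasurableSet {x : LatticeSpace × ℝ | a x.2 • x.1 ∉ B} := hc.measurable hB.compl
  -- By Fubini some single translate by `a s` avoids `B` almost everywhere; invariance of `μ`
  -- removes the translation.
  have h2 := (Measure.ae_ae_comm (p := fun (L : LatticeSpace) (s : ℝ) => a s • L ∉ B) hm).1 h
  obtain ⟨s, hs⟩ := h2.exists
  rw [← measure_preimage_smul μ (a s) B]
  exact measure_eq_zero_iff_ae_notMem.2 hs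

theorem measurableSet_ae_curve {a : ℝ → SL2R} (ha : Continuous a)
    {B : Set LatticeSpace} (hB : MeasurableSet B) :
    MeasurableSet {L : LatticeSpace | ¬ ∀ᵐ s : ℝ, a s • L ∉ B} := by
  have hc : Continuous fun x : LatticeSpace × ℝ => a x.2 • x.1 :=
    (ha.comp continuous_snd).smul continuous_fst
  have hm := measurable_measure_prodMk_left (ν := (volume : Measure ℝ)) (hc.measurable hB)
  have he : {L : LatticeSpace | ¬ ∀ᵐ s : ℝ, a s • L ∉ B} =
      (fun L => volume (Prod.mk L ⁻¹' ((fun x : LatticeSpace × ℝ => a x.2 • x.1) ⁻¹' B))) ⁻¹' {0}ᶜ := by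
    ext L
    simp only [Set.mem_ofPred_eq, Set.mem_preimage, Set.mem_compl_iff, Set.mem_singleton_iff]
    rw [measure_eq_zero_iff_ae_notMem]
    rfl
  rw [he]
  exact hm (measurableSet_singleton _).compl

/-- The unipotent matrix `(1 s; 0 1)`. -/
def upperUnipotent (s : ℝ) : SL2R := ⟨!![1, s; 0, 1], by simp⟩

/-- The unipotent matrix `(1 0; η 1)`. -/
def lowerUnipotent (η : ℝ) : SL2R := ⟨!![1, 0; η, 1], by simp⟩

/-- The diagonal matrix `diag(e^r, e^{-r})`. -/
def diagFlow (r : ℝ) : SL2R :=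
  ⟨!![Real.exp r, 0; 0, Real.exp (-r)], by simp [Matrix.det_fin_two, ← Real.exp_add]⟩

theorem upperUnipotent_val (s : ℝ) : (upperUnipotent s).1 = !![1, s; 0, 1] := rfl

theorem lowerUnipotent_val (η : ℝ) : (lowerUnipotent η).1 = !![1, 0; η, 1] := rfl

theorem diagFlow_val (r : ℝ) :
    (diagFlow r).1 = !![Real.exp r, 0; 0, Real.exp (-r)] := rfl

theorem continuous_upperUnipotent : Continuous upperUnipotent := by
  refine Continuous.subtype_mk (continuous_matrix fun i j => ?_) _
  fin_cases i <;> fin_cases j <;> simp <;> fun_prop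

theorem continuous_lowerUnipotent : Continuous lowerUnipotent := by
  refine Continuous.subtype_mk (continuous_matrix fun i j => ?_) _
  fin_cases i <;> fin_cases j <;> simp <;> fun_prop

theorem continuous_diagFlow : Continuous diagFlow := by
  refine Continuous.subtype_mk (continuous_matrix fun i j => ?_) _
  fin_cases i <;> fin_cases j <;> simp <;> fun_prop

theorem matVec_upperUnipotent_mul (s : ℝ) (g : SL2R) (n : ℤ × ℤ) :
    matVec (upperUnipotent s * g) n = !₂[matVec g n 0 + s * matVec g n 1, matVec g n 1] := by
  apply plane_ext <;>
    simp [matVec, upperUnipotent_val, Matrix.mul_apply, Fin.sum_univ_two]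
  ring

theorem matVec_lowerUnipotent_mul (s : ℝ) (g : SL2R) (n : ℤ × ℤ) :
    matVec (lowerUnipotent s * g) n = !₂[matVec g n 0, s * matVec g n 0 + matVec g n 1] := by
  apply plane_ext <;>
    simp [matVec, lowerUnipotent_val, Matrix.mul_apply, Fin.sum_univ_two]
  ring

theorem matVec_diagFlow_mul (r : ℝ) (g : SL2R) (n : ℤ × ℤ) :
    matVec (diagFlow r * g) n =
      !₂[Real.exp r * matVec g n 0, Real.exp (-r) * matVec g n 1] := by
  apply plane_ext <;>
    simp [matVec, diagFlow_val, Matrix.mul_apply, Fin.sum_univ_two] <;> ring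

/-! ### Generic lattices -/

theorem ae_quadratic_ne_zero {a b c : ℝ} (h : a ≠ 0 ∨ b ≠ 0 ∨ c ≠ 0) :
    ∀ᵐ s : ℝ, a * s ^ 2 + b * s + c ≠ 0 := by
  set P : Polynomial ℝ := Polynomial.C a * Polynomial.X ^ 2 + Polynomial.C b * Polynomial.X +
    Polynomial.C c with hP
  have hP0 : P ≠ 0 := by
    intro h0
    have e0 : P.coeff 0 = c := by simp [hP]
    have e1 : P.coeff 1 = b := by simp [hP, Polynomial.coeff_C]
    have e2 : P.coeff 2 = a := by simp [hP]
    rw [h0, Polynomial.coeff_zero] at e0 e1 e2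
    simp [← e0, ← e1, ← e2] at h
  have hfin : {s : ℝ | P.eval s = 0}.Finite := by
    have := Polynomial.finite_setOfPred_isRoot hP0
    exact this
  filter_upwards [measure_eq_zero_iff_ae_notMem.1 (hfin.measure_zero volume)] with s hs h0
  apply hs
  simp [hP, h0]

theorem measurableSet_forall_latticeVectors {p : Plane × Plane → Prop}
    (hp : MeasurableSet {x | p x}) :
    MeasurableSet {L | ∀ v ∈ latticeVectors L, ∀ w ∈ latticeVectors L, p (v, w)} := by
  rw [measurableSet_lattice_iff]
  let _ : MeasurableSpace SL2R := borel SL2R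
  have _ : BorelSpace SL2R := ⟨rfl⟩
  have : (QuotientGroup.mk : SL2R → LatticeSpace) ⁻¹'
      {L | ∀ v ∈ latticeVectors L, ∀ w ∈ latticeVectors L, p (v, w)} =
      ⋂ m, ⋂ n, {g | p (matVec g m, matVec g n)} := by
    ext g
    simp only [mem_latticeVectors_iff, Set.mem_preimage, Set.mem_ofPred_eq, Set.mem_iInter]
    exact ⟨fun h m n => h _ ⟨m, rfl⟩ _ ⟨n, rfl⟩, by
      rintro h _ ⟨m, rfl⟩ _ ⟨n, rfl⟩
      exact h m n⟩
  rw [this]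
  exact MeasurableSet.iInter fun m => MeasurableSet.iInter fun n =>
    ((continuous_matVec m).prodMk (continuous_matVec n)).measurable hp

/-- A property of pairs of vectors which fails on the orbits of a one-parameter family only
for a null set of parameters holds for all the pairs of vectors of almost every lattice. -/
theorem ae_forall_latticeVectors {μ : Measure LatticeSpace} [IsProbabilityMeasure μ]
    [SMulInvariantMeasure SL2R LatticeSpace μ] {p : Plane × Plane → Prop}
    (hp : MeasurableSet {x | p x}) {a : ℝ → SL2R} (ha : Continuous a)
    (h : ∀ (g : SL2R) m n, ∀ᵐ s : ℝ, p (matVec (a s * g) m, matVec (a s * g) n)) :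
    ∀ᵐ L ∂μ, ∀ v ∈ latticeVectors L, ∀ w ∈ latticeVectors L, p (v, w) := by
  refine lattice_null_of_ae_curve ha (measurableSet_forall_latticeVectors hp).compl
    (Eventually.of_forall fun L => ?_)
  obtain ⟨g, rfl⟩ := QuotientGroup.mk_surjective L
  have : ∀ᵐ s : ℝ, ∀ m n, p (matVec (a s * g) m, matVec (a s * g) n) := by
    simp only [ae_all_iff]
    exact fun m n => h g m n
  filter_upwards [this] with s hs
  rw [Set.notMem_compl_iff]
  change ∀ v ∈ latticeVectors ((a s * g : SL2R) : LatticeSpace),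
    ∀ w ∈ latticeVectors ((a s * g : SL2R) : LatticeSpace), p (v, w)
  simp only [mem_latticeVectors_iff]
  rintro _ ⟨m, rfl⟩ _ ⟨n, rfl⟩
  exact hs m n

/-- Almost every lattice has no nonzero horizontal vector. -/
theorem ae_snd_ne_zero {μ : Measure LatticeSpace} [IsProbabilityMeasure μ]
    [SMulInvariantMeasure SL2R LatticeSpace μ] :
    ∀ᵐ L ∂μ, ∀ v ∈ latticeVectors L, v ≠ 0 → v 1 ≠ 0 := by
  have h := ae_forall_latticeVectors (μ := μ) (p := fun x => x.1 ≠ 0 → x.1 1 ≠ 0) ?_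
    continuous_lowerUnipotent ?_
  · filter_upwards [h] with L hL v hv
    exact hL v hv v hv
  · have : {x : Plane × Plane | x.1 ≠ 0 → x.1 1 ≠ 0} = {x | x.1 = 0} ∪ {x | x.1 1 = 0}ᶜ := by
      ext x; simp; tauto
    rw [this]
    exact (isClosed_eq continuous_fst continuous_const).measurableSet.union
      (isClosed_eq (by fun_prop) continuous_const).measurableSet.compl
  · intro g m _
    by_cases hm : matVec g m = 0
    · have : m = 0 := (matVec_eq_zero_iff g m).1 hm
      subst this
      exact Eventually.of_forall fun s h0 => absurd ((matVec_eq_zero_iff _ _).2 rfl) h0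
    · have hne : (0 : ℝ) ≠ 0 ∨ matVec g m 0 ≠ 0 ∨ matVec g m 1 ≠ 0 := by
        by_contra hcon
        push Not at hcon
        exact hm (plane_ext hcon.2.1 hcon.2.2)
      filter_upwards [ae_quadratic_ne_zero hne] with s hs _
      rw [matVec_lowerUnipotent_mul]
      simp only [zero_mul, zero_add] at hs
      simpa [mul_comm] using hs

/-- A lattice is generic if it has no nonzero vertical vector and if its vectors of the same
length are equal up to sign. -/
def IsGenericLattice (L : LatticeSpace) : Prop :=
  ∀ v ∈ latticeVectors L, ∀ w ∈ latticeVectors L, (v ≠ 0 → v 0 ≠ 0) ∧ (‖v‖ = ‖w‖ → v = w ∨ v = -w)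

theorem measurableSet_generic_pairs :
    MeasurableSet {x : Plane × Plane | (x.1 ≠ 0 → x.1 0 ≠ 0) ∧
      (‖x.1‖ = ‖x.2‖ → x.1 = x.2 ∨ x.1 = -x.2)} := by
  have : {x : Plane × Plane | (x.1 ≠ 0 → x.1 0 ≠ 0) ∧
      (‖x.1‖ = ‖x.2‖ → x.1 = x.2 ∨ x.1 = -x.2)} =
      ({x | x.1 = 0} ∪ {x | x.1 0 = 0}ᶜ) ∩
        ({x | ‖x.1‖ = ‖x.2‖}ᶜ ∪ ({x | x.1 = x.2} ∪ {x | x.1 = -x.2})) := by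
    ext x; simp; tauto
  rw [this]
  exact ((isClosed_eq continuous_fst continuous_const).measurableSet.union
      (isClosed_eq (by fun_prop) continuous_const).measurableSet.compl).inter
    ((isClosed_eq (by fun_prop) (by fun_prop)).measurableSet.compl.union
      ((isClosed_eq (by fun_prop) (by fun_prop)).measurableSet.union
        (isClosed_eq (by fun_prop) (by fun_prop)).measurableSet))

theorem measurableSet_isGenericLattice : MeasurableSet {L | IsGenericLattice L} :=
  measurableSet_forall_latticeVectors measurableSet_generic_pairs

theorem plane_norm_sq (v : Plane) : ‖v‖ ^ 2 = v 0 ^ 2 + v 1 ^ 2 := by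
  rw [← real_inner_self_eq_norm_sq, plane_inner_eq]; ring

/-- Under `upperUnipotent s` the first coordinate of a vector and the difference of two squared
lengths are polynomials in `s` of degree at most two. They vanish identically only for the zero
vector and for `v = ±w` respectively. -/
theorem ae_isGenericLattice {μ : Measure LatticeSpace} [IsProbabilityMeasure μ]
    [SMulInvariantMeasure SL2R LatticeSpace μ] : ∀ᵐ L ∂μ, IsGenericLattice L := by
  refine ae_forall_latticeVectors measurableSet_generic_pairs continuous_upperUnipotent ?_
  intro g m n
  refine Filter.Eventually.and ?_ ?_
  · by_cases hm : matVec g m = 0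
    · have : m = 0 := (matVec_eq_zero_iff g m).1 hm
      subst this
      exact Eventually.of_forall fun s h0 => absurd ((matVec_eq_zero_iff _ _).2 rfl) h0
    · have hne : (0 : ℝ) ≠ 0 ∨ matVec g m 1 ≠ 0 ∨ matVec g m 0 ≠ 0 := by
        by_contra hcon
        push Not at hcon
        exact hm (plane_ext hcon.2.2 hcon.2.1)
      filter_upwards [ae_quadratic_ne_zero hne] with s hs _
      rw [matVec_upperUnipotent_mul]
      simp only [zero_mul, zero_add] at hs
      simpa [mul_comm, add_comm] using hs
  · by_cases hmn : matVec g m = matVec g n ∨ matVec g m = -matVec g n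
    · refine Eventually.of_forall fun s _ => ?_
      rcases hmn with h | h
      · left; rw [matVec_injective g h]
      · right; rw [← matVec_neg] at h ⊢; rw [matVec_injective g h]
    · set v := matVec g m
      set w := matVec g n
      have hne : v 1 ^ 2 - w 1 ^ 2 ≠ 0 ∨ 2 * (v 0 * v 1 - w 0 * w 1) ≠ 0 ∨
          v 0 ^ 2 + v 1 ^ 2 - w 0 ^ 2 - w 1 ^ 2 ≠ 0 := by
        by_contra hcon
        push Not at hcon
        obtain ⟨h1, h2, h3⟩ := hcon
        apply hmn
        have h0 : v 0 ^ 2 = w 0 ^ 2 := by linarith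
        rcases sq_eq_sq_iff_eq_or_eq_neg.1 (sub_eq_zero.1 h1) with e1 | e1 <;>
          rcases sq_eq_sq_iff_eq_or_eq_neg.1 h0 with e0 | e0
        · exact Or.inl (plane_ext e0 e1)
        · rw [e1, e0] at h2
          have : w 0 * w 1 = 0 := by linarith
          rcases mul_eq_zero.1 this with h | h
          · left; exact plane_ext (by rw [e0, h, neg_zero]) e1
          · right; exact plane_ext (by simp [e0]) (by simp [e1, h])
        · rw [e1, e0] at h2
          have : w 0 * w 1 = 0 := by linarith
          rcases mul_eq_zero.1 this with h | h
          · right; exact plane_ext (by simp [e0, h]) (by simp [e1])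
          · left; exact plane_ext e0 (by rw [e1, h, neg_zero])
        · exact Or.inr (plane_ext (by simp [e0]) (by simp [e1]))
      filter_upwards [ae_quadratic_ne_zero hne] with s hs hnorm
      exfalso
      apply hs
      have h1 := plane_norm_sq (matVec (upperUnipotent s * g) m)
      have h2 := plane_norm_sq (matVec (upperUnipotent s * g) n)
      rw [hnorm, h2] at h1
      rw [matVec_upperUnipotent_mul, matVec_upperUnipotent_mul] at h1
      simp at h1
      linear_combination -h1

/-! ### The minimal pair of a lattice -/

theorem linearIndependent_iff_planeDet {v : Fin 2 → Plane} :
    LinearIndependent ℝ v ↔ planeDet (v 0) (v 1) ≠ 0 := by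
  have hv : v = ![v 0, v 1] := by ext i; fin_cases i <;> rfl
  rw [hv, LinearIndependent.pair_iff]
  simp only [Matrix.cons_val_zero, Matrix.cons_val_one]
  constructor
  · intro h h0
    unfold planeDet at h0
    obtain ⟨h1, h2⟩ := h (v 1 1) (-v 0 1) (plane_ext (by simp; linarith) (by simp; ring))
    obtain ⟨h3, h4⟩ := h (v 1 0) (-v 0 0) (plane_ext (by simp; ring) (by simp; linarith))
    have hz : v 0 = 0 := plane_ext (by simpa using h4) (by simpa using h2)
    have := (h 1 0 (by simp [hz])).1
    norm_num at this
  · intro h s t hst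
    have h0 : s * v 0 0 + t * v 1 0 = 0 := by simpa using congrArg (fun x : Plane => x 0) hst
    have h1 : s * v 0 1 + t * v 1 1 = 0 := by simpa using congrArg (fun x : Plane => x 1) hst
    unfold planeDet at h
    constructor
    · have : s * (v 0 0 * v 1 1 - v 0 1 * v 1 0) = 0 := by
        linear_combination v 1 1 * h0 - v 1 0 * h1
      exact (mul_eq_zero.1 this).resolve_right h
    · have : t * (v 0 0 * v 1 1 - v 0 1 * v 1 0) = 0 := by
        linear_combination v 0 0 * h1 - v 0 1 * h0
      exact (mul_eq_zero.1 this).resolve_right h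

theorem abs_planeDet_le (v w : Plane) : |planeDet v w| ≤ ‖v‖ * ‖w‖ := by
  apply abs_le_of_sq_le_sq' _ (by positivity) |> abs_le.2
  rw [mul_pow, plane_norm_sq, plane_norm_sq, planeDet]
  nlinarith [sq_nonneg (v 0 * w 0 + v 1 * w 1)]

/-- Up to sign, each integral coordinate is the determinant of the vector with a column of `g`, so
it is bounded in terms of the norm. -/
theorem finite_norm_matVec_le (g : SL2R) (r : ℝ) : {n : ℤ × ℤ | ‖matVec g n‖ ≤ r}.Finite := by
  set M : ℤ := ⌈r * ‖matVec g (0, 1)‖⌉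
  set M' : ℤ := ⌈r * ‖matVec g (1, 0)‖⌉
  refine ((Set.finite_Icc (-M) M).prod (Set.finite_Icc (-M') M')).subset fun n hn => ?_
  have h1 := abs_planeDet_le (matVec g n) (matVec g (0, 1))
  have h2 := abs_planeDet_le (matVec g n) (matVec g (1, 0))
  rw [planeDet_matVec] at h1 h2
  simp at h1 h2
  have h3 : |(n.1 : ℝ)| ≤ M := h1.trans
    ((mul_le_mul_of_nonneg_right hn (norm_nonneg _)).trans (Int.le_ceil _))
  have h4 : |(n.2 : ℝ)| ≤ M' := h2.trans
    ((mul_le_mul_of_nonneg_right hn (norm_nonneg _)).trans (Int.le_ceil _))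
  rw [Set.mem_prod, Set.mem_Icc, Set.mem_Icc, ← abs_le, ← abs_le]
  exact ⟨by exact_mod_cast h3, by exact_mod_cast h4⟩

theorem successiveMin_le {i : ℕ} (hi : 0 < i) (g : SL2R) {n : Fin i → ℤ × ℤ}
    (hn : LinearIndependent ℝ fun j => matVec g (n j)) {r : ℝ} (hr : ∀ j, ‖matVec g (n j)‖ ≤ r) :
    successiveMin i (g : LatticeSpace) ≤ r := by
  refine csInf_le ⟨0, fun x hx => hx.1.le⟩ ⟨?_, _, fun j => ⟨?_, hr j⟩, hn⟩
  · exact (norm_pos_iff.2 (hn.ne_zero ⟨0, hi⟩)).trans_le (hr _)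
  · exact (mem_latticeVectors_iff g _).2 ⟨_, rfl⟩

/-- The infimum is attained: only finitely many integral families do no worse than `n₀`, and one of
them minimises the largest norm. -/
theorem exists_family_successiveMin {i : ℕ} (hi : 0 < i) (g : SL2R) {n₀ : Fin i → ℤ × ℤ}
    (hn₀ : LinearIndependent ℝ fun j => matVec g (n₀ j)) :
    ∃ n : Fin i → ℤ × ℤ, LinearIndependent ℝ (fun j => matVec g (n j)) ∧
      (∀ j, ‖matVec g (n j)‖ ≤ successiveMin i (g : LatticeSpace)) ∧
      ∃ j, ‖matVec g (n j)‖ = successiveMin i (g : LatticeSpace) := by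
  have hne : (Finset.univ : Finset (Fin i)).Nonempty := ⟨⟨0, hi⟩, Finset.mem_univ _⟩
  set mx : (Fin i → ℤ × ℤ) → ℝ := fun n => Finset.univ.sup' hne fun j => ‖matVec g (n j)‖ with hmx
  have hle : ∀ n j, ‖matVec g (n j)‖ ≤ mx n := fun n j =>
    Finset.le_sup' (fun j => ‖matVec g (n j)‖) (Finset.mem_univ j)
  set S : Set (Fin i → ℤ × ℤ) := {n | LinearIndependent ℝ (fun j => matVec g (n j)) ∧
    ∀ j, ‖matVec g (n j)‖ ≤ mx n₀} with hS
  have hfin : S.Finite :=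
    (Set.Finite.pi' fun _ : Fin i => finite_norm_matVec_le g (mx n₀)).subset fun n hn => hn.2
  obtain ⟨n, hn, hmin⟩ := Set.exists_min_image S mx hfin ⟨n₀, hn₀, hle n₀⟩
  have hleast : IsLeast {r : ℝ | 0 < r ∧ ∃ v : Fin i → Plane,
      (∀ j, v j ∈ latticeVectors (g : LatticeSpace) ∧ ‖v j‖ ≤ r) ∧ LinearIndependent ℝ v}
      (mx n) := by
    refine ⟨⟨?_, _, fun j => ⟨(mem_latticeVectors_iff g _).2 ⟨n j, rfl⟩, hle n j⟩, hn.1⟩, ?_⟩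
    · exact (norm_pos_iff.2 (hn.1.ne_zero ⟨0, hi⟩)).trans_le (hle n _)
    · rintro r ⟨-, v, hv, hli⟩
      choose m hm using fun j => (mem_latticeVectors_iff g _).1 (hv j).1
      have hvm : v = fun j => matVec g (m j) := funext hm
      rw [hvm] at hli
      have hmr : mx m ≤ r := Finset.sup'_le _ _ fun j _ => by rw [← hm]; exact (hv j).2
      rcases le_total (mx m) (mx n₀) with h | h
      · exact (hmin m ⟨hli, fun j => (hle m j).trans h⟩).trans hmr
      · exact (hmin n₀ ⟨hn₀, hle n₀⟩).trans (h.trans hmr)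
  have heq : successiveMin i (g : LatticeSpace) = mx n := hleast.csInf_eq
  obtain ⟨j, -, hj⟩ := Finset.exists_mem_eq_sup' hne fun j => ‖matVec g (n j)‖
  exact ⟨n, hn.1, fun j => by rw [heq]; exact hle n j, j, by rw [heq]; exact hj.symm⟩

theorem linearIndependent_matVec_one (g : SL2R) (n : Fin 1 → ℤ × ℤ) :
    LinearIndependent ℝ (fun j => matVec g (n j)) ↔ n 0 ≠ 0 := by
  rw [linearIndependent_unique_iff, Ne, Ne, matVec_eq_zero_iff]
  rfl

theorem linearIndependent_matVec_two (g : SL2R) (n : Fin 2 → ℤ × ℤ) :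
    LinearIndependent ℝ (fun j => matVec g (n j)) ↔
      (n 0).1 * (n 1).2 - (n 0).2 * (n 1).1 ≠ 0 := by
  rw [linearIndependent_iff_planeDet, planeDet_matVec]
  norm_cast

/-- Take `a` realising the first minimum and an independent family `m` realising the second. If the
longest member of `m` is parallel to `a`, the other member is not; with `a` it forms an admissible
pair, so its norm is also the second minimum. Signs are adjusted using the absence of vertical
vectors. -/
theorem exists_isMinimalPair {L : LatticeSpace} (hL : ∀ v ∈ latticeVectors L, v ≠ 0 → v 0 ≠ 0) :
    ∃ e, IsMinimalPair L e ∧ planeDet e.1 e.2 ≠ 0 := by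
  obtain ⟨g, rfl⟩ := QuotientGroup.mk_surjective L
  have hsign : ∀ n : ℤ × ℤ, n ≠ 0 → ∃ n', 0 < matVec g n' 0 ∧ (n' = n ∨ n' = -n) := by
    intro n hn
    have h0 := hL (matVec g n) ((mem_latticeVectors_iff g _).2 ⟨n, rfl⟩)
      (by rwa [Ne, matVec_eq_zero_iff])
    rcases lt_or_gt_of_ne h0 with h | h
    · refine ⟨-n, ?_, Or.inr rfl⟩
      rw [matVec_neg]; simpa using h
    · exact ⟨n, h, Or.inl rfl⟩
  obtain ⟨n, hn, -, j, hj⟩ := exists_family_successiveMin (i := 1) one_pos g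
    (n₀ := fun _ => (1, 0)) ((linearIndependent_matVec_one g _).2 (by simp))
  obtain ⟨m, hm, hmle, j', hj'⟩ := exists_family_successiveMin (i := 2) two_pos g
    (n₀ := ![(1, 0), (0, 1)]) ((linearIndependent_matVec_two g _).2 (by simp))
  rw [linearIndependent_matVec_one] at hn
  rw [Subsingleton.elim j 0] at hj
  obtain ⟨a, ha0, ha⟩ := hsign _ hn
  have hanorm : ‖matVec g a‖ = successiveMin 1 (g : LatticeSpace) := by
    rcases ha with rfl | rfl
    · exact hj
    · rw [matVec_neg, norm_neg]; exact hj
  have hane : a ≠ 0 := by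
    rcases ha with rfl | rfl
    · exact hn
    · exact neg_ne_zero.2 hn
  have hone : ∀ b : ℤ × ℤ, b ≠ 0 → successiveMin 1 (g : LatticeSpace) ≤ ‖matVec g b‖ :=
    fun b hb => successiveMin_le one_pos g (n := fun _ => b)
      ((linearIndependent_matVec_one g _).2 hb) fun _ => le_rfl
  have key : ∃ b, ‖matVec g b‖ = successiveMin 2 (g : LatticeSpace) ∧
      a.1 * b.2 - a.2 * b.1 ≠ 0 := by
    by_cases hd : a.1 * (m j').2 - a.2 * (m j').1 ≠ 0
    · exact ⟨m j', hj', hd⟩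
    push Not at hd
    have hm2 := (linearIndependent_matVec_two g m).1 hm
    have hother : ∃ j'', a.1 * (m j'').2 - a.2 * (m j'').1 ≠ 0 := by
      by_contra hcon
      push Not at hcon
      apply hane
      have h0 := hcon 0
      have h1 := hcon 1
      have e1 : a.1 * ((m 0).1 * (m 1).2 - (m 0).2 * (m 1).1) = 0 := by
        linear_combination (m 0).1 * h1 - (m 1).1 * h0
      have e2 : a.2 * ((m 0).1 * (m 1).2 - (m 0).2 * (m 1).1) = 0 := by
        linear_combination (m 0).2 * h1 - (m 1).2 * h0
      ext
      · exact (mul_eq_zero.1 e1).resolve_right hm2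
      · exact (mul_eq_zero.1 e2).resolve_right hm2
    obtain ⟨j'', hj''⟩ := hother
    refine ⟨m j'', le_antisymm (hmle j'') ?_, hj''⟩
    have hb : m j'' ≠ 0 := by
      intro h0; rw [h0] at hj''; simp at hj''
    refine successiveMin_le two_pos g (n := ![a, m j''])
      ((linearIndependent_matVec_two g _).2 (by simpa using hj'')) fun i => ?_
    fin_cases i
    · simp only [Fin.zero_eta, Matrix.cons_val_zero]
      rw [hanorm]
      exact hone _ hb
    · simp
  obtain ⟨b, hb, hab⟩ := key
  obtain ⟨c, hc0, hc⟩ := hsign b (by rintro rfl; simp at hab)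
  refine ⟨(matVec g a, matVec g c), ⟨(mem_latticeVectors_iff g _).2 ⟨a, rfl⟩,
    (mem_latticeVectors_iff g _).2 ⟨c, rfl⟩, ha0, hc0, hanorm, ?_⟩, ?_⟩
  · rcases hc with rfl | rfl
    · exact hb
    · rw [matVec_neg, norm_neg]; exact hb
  · rw [planeDet_matVec]
    norm_cast
    rcases hc with rfl | rfl
    · exact hab
    · simp only [Prod.fst_neg, Prod.snd_neg]
      intro h0
      apply hab
      linear_combination -h0

theorem IsGenericLattice.eq_of_isMinimalPair {L : LatticeSpace} (hL : IsGenericLattice L)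
    {e e' : Plane × Plane} (he : IsMinimalPair L e) (he' : IsMinimalPair L e') : e = e' := by
  have key : ∀ v ∈ latticeVectors L, ∀ w ∈ latticeVectors L, 0 < v 0 → 0 < w 0 → ‖v‖ = ‖w‖ →
      v = w := by
    intro v hv w hw hv0 hw0 hvw
    rcases (hL v hv w hw).2 hvw with h | h
    · exact h
    · rw [h] at hv0
      simp at hv0
      linarith
  obtain ⟨h1, h2, h3, h4, h5, h6⟩ := he
  obtain ⟨h1', h2', h3', h4', h5', h6'⟩ := he'
  exact Prod.ext (key _ h1 _ h1' h3 h3' (h5.trans h5'.symm))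
    (key _ h2 _ h2' h4 h4' (h6.trans h6'.symm))

theorem IsGenericLattice.isMinimalPair {L : LatticeSpace} (hL : IsGenericLattice L) :
    IsMinimalPair L (minimalPair L) := by
  obtain ⟨e, he, -⟩ := exists_isMinimalPair fun v hv => (hL v hv v hv).1
  exact Classical.epsilon_spec (p := IsMinimalPair L) ⟨e, he⟩

/-- The minimal pair of a generic lattice, in terms of integral coordinates. -/
theorem IsGenericLattice.exists_minimalPair_eq {g : SL2R}
    (hL : IsGenericLattice (g : LatticeSpace)) : ∃ m n : ℤ × ℤ,
      minimalPair (g : LatticeSpace) = (matVec g m, matVec g n) ∧ m.1 * n.2 - m.2 * n.1 ≠ 0 := by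
  obtain ⟨e, he, hdet⟩ := exists_isMinimalPair fun v hv => (hL v hv v hv).1
  obtain ⟨m, hm⟩ := (mem_latticeVectors_iff g _).1 he.1
  obtain ⟨n, hn⟩ := (mem_latticeVectors_iff g _).1 he.2.1
  refine ⟨m, n, ?_, ?_⟩
  · rw [hL.eq_of_isMinimalPair hL.isMinimalPair he, ← hm, ← hn]
  · rw [hm, hn, planeDet_matVec] at hdet
    exact_mod_cast hdet

/-- Independence is a condition `C` on the integral coordinates alone, so strict sublevel sets are
countable unions of open sets. -/
theorem measurable_successiveMin_mk {i : ℕ} (hi : 0 < i) {n₀ : Fin i → ℤ × ℤ}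
    {C : (Fin i → ℤ × ℤ) → Prop}
    (hC : ∀ (g : SL2R) n, LinearIndependent ℝ (fun j => matVec g (n j)) ↔ C n) (hn₀ : C n₀) :
    Measurable[borel SL2R] fun g : SL2R => successiveMin i (g : LatticeSpace) := by
  let _ : MeasurableSpace SL2R := borel SL2R
  have _ : BorelSpace SL2R := ⟨rfl⟩
  refine measurable_of_Iio fun r => ?_
  have : (fun g : SL2R => successiveMin i (g : LatticeSpace)) ⁻¹' Set.Iio r =
      ⋃ n : Fin i → ℤ × ℤ, ⋃ (_ : C n), ⋂ j, {g : SL2R | ‖matVec g (n j)‖ < r} := by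
    ext g
    simp only [Set.mem_preimage, Set.mem_Iio, Set.mem_iUnion, Set.mem_iInter, Set.mem_ofPred_eq,
      exists_prop]
    constructor
    · intro h
      obtain ⟨n, hn, hle, -⟩ := exists_family_successiveMin hi g ((hC g n₀).2 hn₀)
      exact ⟨n, (hC g n).1 hn, fun j => (hle j).trans_lt h⟩
    · rintro ⟨n, hn, hlt⟩
      obtain ⟨j₀, -, hj₀⟩ := Finset.exists_max_image Finset.univ (fun j => ‖matVec g (n j)‖)
        ⟨⟨0, hi⟩, Finset.mem_univ _⟩
      exact (successiveMin_le hi g ((hC g n).2 hn) fun j => hj₀ j (Finset.mem_univ _)).trans_lt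
        (hlt j₀)
  rw [this]
  exact MeasurableSet.iUnion fun n => MeasurableSet.iUnion fun _ => MeasurableSet.iInter fun j =>
    (isOpen_lt (continuous_matVec _).norm continuous_const).measurableSet

/-- A Borel version of the minimal pair. -/
theorem measurable_indicator_minimalPair :
    Measurable ({L | IsGenericLattice L}.indicator minimalPair) := by
  intro U hU
  rw [measurableSet_lattice_iff]
  have hGm := measurableSet_lattice_iff.1 measurableSet_isGenericLattice
  have h1 := measurable_successiveMin_mk one_pos (n₀ := fun _ => (1, 0))
    linearIndependent_matVec_one (by simp)
  have h2 := measurable_successiveMin_mk two_pos (n₀ := ![(1, 0), (0, 1)])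
    linearIndependent_matVec_two (by simp)
  let _ : MeasurableSpace SL2R := borel SL2R
  have _ : BorelSpace SL2R := ⟨rfl⟩
  set G : Set SL2R := (QuotientGroup.mk : SL2R → LatticeSpace) ⁻¹' {L | IsGenericLattice L} with hG
  -- On generic lattices the minimal pair is characterised by conditions on its integral
  -- coordinates, so the preimage splits into countably many Borel pieces.
  have : (QuotientGroup.mk : SL2R → LatticeSpace) ⁻¹'
      ({L | IsGenericLattice L}.indicator minimalPair ⁻¹' U) =
      (G ∩ ⋃ m, ⋃ n, ({g : SL2R | 0 < matVec g m 0} ∩ {g : SL2R | 0 < matVec g n 0} ∩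
        {g : SL2R | ‖matVec g m‖ = successiveMin 1 (g : LatticeSpace)} ∩
        {g : SL2R | ‖matVec g n‖ = successiveMin 2 (g : LatticeSpace)}) ∩
        {g : SL2R | (matVec g m, matVec g n) ∈ U}) ∪ (Gᶜ ∩ {_g | (0 : Plane × Plane) ∈ U}) := by
    ext g
    by_cases hg : IsGenericLattice (g : LatticeSpace)
    · have hgG : g ∈ G := hg
      simp only [Set.mem_preimage, Set.indicator_of_mem (show (g : LatticeSpace) ∈
        {L | IsGenericLattice L} from hg), Set.mem_union, Set.mem_inter_iff, hgG,
        Set.mem_compl_iff, not_true_eq_false, false_and, or_false, true_and, Set.mem_iUnion,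
        Set.mem_ofPred_eq]
      constructor
      · intro hU
        obtain ⟨m, n, hmn, -⟩ := hg.exists_minimalPair_eq
        obtain ⟨-, -, e1, e2, e3, e4⟩ := hg.isMinimalPair
        rw [hmn] at e1 e2 e3 e4 hU
        exact ⟨m, n, ⟨⟨⟨e1, e2⟩, e3⟩, e4⟩, hU⟩
      · rintro ⟨m, n, ⟨⟨⟨e1, e2⟩, e3⟩, e4⟩, hU⟩
        rwa [hg.eq_of_isMinimalPair hg.isMinimalPair
          (⟨(mem_latticeVectors_iff g _).2 ⟨m, rfl⟩, (mem_latticeVectors_iff g _).2 ⟨n, rfl⟩,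
            e1, e2, e3, e4⟩ : IsMinimalPair (g : LatticeSpace) (matVec g m, matVec g n))]
    · have hgG : g ∉ G := hg
      simp [Set.indicator_of_notMem (show (g : LatticeSpace) ∉ {L | IsGenericLattice L} from hg),
        hgG]
  rw [this]
  refine (hGm.inter (MeasurableSet.iUnion fun m => MeasurableSet.iUnion fun n => ?_)).union
    (hGm.compl.inter (MeasurableSet.const _))
  have hcoord : ∀ m : ℤ × ℤ, Continuous fun g : SL2R => matVec g m 0 := fun m =>
    (EuclideanSpace.proj (𝕜 := ℝ) (0 : Fin 2)).continuous.comp (continuous_matVec m)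
  refine ((((isOpen_lt continuous_const (hcoord m)).measurableSet.inter
    (isOpen_lt continuous_const (hcoord n)).measurableSet).inter ?_).inter ?_).inter ?_
  · exact measurableSet_eq_fun (continuous_matVec m).norm.measurable h1
  · exact measurableSet_eq_fun (continuous_matVec n).norm.measurable h2
  · exact ((continuous_matVec m).prodMk (continuous_matVec n)).measurable hU

theorem aemeasurable_minimalPair {μ : Measure LatticeSpace} [IsProbabilityMeasure μ]
    [SMulInvariantMeasure SL2R LatticeSpace μ] : AEMeasurable minimalPair μ := by
  refine ⟨_, measurable_indicator_minimalPair, ?_⟩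
  filter_upwards [ae_isGenericLattice (μ := μ)] with L hL
  rw [Set.indicator_of_mem (show L ∈ {L | IsGenericLattice L} from hL)]

/-! ### Riemann–Lebesgue lemma and convergence in distribution -/

/-- A family of uniformly bounded additive functionals which tends to zero on the multiples of
indicator functions tends to zero on all integrable functions. -/
theorem tendsto_zero_of_indicator {X E : Type*} [MeasurableSpace X] [NormedAddCommGroup E]
    {ν : Measure X} (D : ℝ → (X → E) → ℂ) (C : ℝ)
    (hadd : ∀ t f g, Integrable f ν → Integrable g ν → D t (f + g) = D t f + D t g)
    (hbound : ∀ t f, Integrable f ν → ‖D t f‖ ≤ C * ∫ x, ‖f x‖ ∂ν)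
    (hcongr : ∀ t f g, f =ᵐ[ν] g → D t f = D t g)
    (hind : ∀ (c : E) (s : Set X), MeasurableSet s → ν s < ⊤ →
      Tendsto (fun t => D t (s.indicator fun _ => c)) atTop (𝓝 0))
    {f : X → E} (hf : Integrable f ν) : Tendsto (fun t => D t f) atTop (𝓝 0) := by
  refine Integrable.induction (fun f => Tendsto (fun t => D t f) atTop (𝓝 0)) hind ?_ ?_ ?_ hf
  · intro f g _ hf hg h1 h2
    simp only [hadd _ f g hf hg]
    simpa using h1.add h2
  · refine isClosed_of_closure_subset fun f hf => ?_
    rw [Set.mem_ofPred_eq, Metric.tendsto_nhds]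
    intro ε hε
    obtain ⟨g, hg, hfg⟩ := Metric.mem_closure_iff.1 hf (ε / (2 * (|C| + 1))) (by positivity)
    have hg' : Tendsto (fun t => D t g) atTop (𝓝 0) := hg
    filter_upwards [Metric.tendsto_nhds.1 hg' (ε / 2) (by positivity)] with t ht
    have hif := L1.integrable_coeFn f
    have hig := L1.integrable_coeFn g
    have h1 : D t f = D t (f - g : X → E) + D t g := by
      rw [← hadd t _ _ (hif.sub hig) hig, sub_add_cancel]
    have h2 : ∫ x, ‖(f - g : X → E) x‖ ∂ν = dist f g := by
      rw [dist_eq_norm, L1.norm_eq_integral_norm]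
      refine integral_congr_ae ?_
      filter_upwards [Lp.coeFn_sub f g] with x hx
      rw [hx]
    have h3 := hbound t _ (hif.sub hig)
    rw [h2] at h3
    have h4 : C * dist f g ≤ ε / 2 := by
      have h5 : (|C| + 1) * (ε / (2 * (|C| + 1))) = ε / 2 := by field_simp
      calc C * dist f g ≤ (|C| + 1) * dist f g :=
            mul_le_mul_of_nonneg_right (by linarith [le_abs_self C]) dist_nonneg
        _ ≤ (|C| + 1) * (ε / (2 * (|C| + 1))) :=
            mul_le_mul_of_nonneg_left hfg.le (by positivity)
        _ = ε / 2 := h5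
    rw [dist_zero_right] at ht ⊢
    rw [h1]
    exact (norm_add_le _ _).trans_lt (by linarith)
  · intro f g hfg _ h
    simpa only [hcongr _ f g hfg] using h

theorem continuous_expCircle : Continuous expCircle :=
  continuous_subtype_val.comp AddCircle.continuous_toCircle

theorem norm_expCircle (θ : UnitAddCircle) : ‖expCircle θ‖ = 1 := Circle.norm_coe _

theorem expCircle_add (x y : UnitAddCircle) : expCircle (x + y) = expCircle x * expCircle y := by
  simp [expCircle, AddCircle.toCircle_add]

theorem expCircle_coe (x : ℝ) : expCircle (x : UnitAddCircle) = Real.fourierChar x := by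
  rw [Real.fourierChar_apply, expCircle]
  have := fourier_coe_apply' (T := (1 : ℝ)) (n := 1) (x := x)
  rw [one_zsmul] at this
  rw [this]
  congr 1
  push_cast
  ring

/-- **Riemann–Lebesgue lemma** for a function with absolutely continuous law. -/
theorem tendsto_integral_expCircle_measure {m : Measure ℝ} [IsFiniteMeasure m]
    (hm : m ≪ volume) :
    Tendsto (fun t : ℝ => ∫ y, expCircle ((t * y : ℝ) : UnitAddCircle) ∂m) atTop (𝓝 0) := by
  have h := Real.tendsto_integral_exp_smul_cocompact
    (fun y => (((m.rnDeriv volume y).toReal : ℝ) : ℂ))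
  have hneg : Tendsto (fun t : ℝ => -t) atTop (cocompact ℝ) := by
    rw [cocompact_eq_atBot_atTop]
    exact tendsto_neg_atTop_atBot.mono_right le_sup_left
  refine (h.comp hneg).congr fun t => ?_
  rw [← integral_rnDeriv_smul hm]
  refine integral_congr_ae (Eventually.of_forall fun y => ?_)
  simp only [expCircle_coe, Circle.smul_def, smul_eq_mul, Complex.real_smul]
  rw [show -(y * -t) = t * y by ring, mul_comm]

/-- For an indicator weight this is the Riemann–Lebesgue lemma for the law of `F` under a restricted
measure, which is still absolutely continuous. Density of simple functions gives the rest. -/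
theorem tendsto_integral_mul_expCircle {X : Type*} [MeasurableSpace X] {ν : Measure X}
    [IsFiniteMeasure ν] {F : X → ℝ} (hF : AEMeasurable F ν)
    (hac : ν.map F ≪ volume) {φ : X → ℂ} (hφ : Integrable φ ν) :
    Tendsto (fun t : ℝ => ∫ x, φ x * expCircle ((t * F x : ℝ) : UnitAddCircle) ∂ν) atTop (𝓝 0) := by
  have hmeas : ∀ t : ℝ, AEStronglyMeasurable
      (fun x => expCircle ((t * F x : ℝ) : UnitAddCircle)) ν := fun t => by
    have hc : Continuous fun y : ℝ => expCircle ((t * y : ℝ) : UnitAddCircle) :=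
      continuous_expCircle.comp ((AddCircle.continuous_mk' 1).comp (by fun_prop))
    exact (hc.measurable.comp_aemeasurable hF).aestronglyMeasurable
  have hint : ∀ t : ℝ, ∀ f : X → ℂ, Integrable f ν →
      Integrable (fun x => f x * expCircle ((t * F x : ℝ) : UnitAddCircle)) ν := fun t f hf =>
    hf.mul_bdd (c := 1) (hmeas t) (Eventually.of_forall fun x => (norm_expCircle _).le)
  refine tendsto_zero_of_indicator (ν := ν)
    (fun t f => ∫ x, f x * expCircle ((t * F x : ℝ) : UnitAddCircle) ∂ν) 1 ?_ ?_ ?_ ?_ hφ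
  · intro t f g hf hg
    simp only [Pi.add_apply, add_mul]
    exact integral_add (hint t f hf) (hint t g hg)
  · intro t f hf
    rw [one_mul]
    refine (norm_integral_le_integral_norm _).trans_eq (integral_congr_ae ?_)
    exact Eventually.of_forall fun x => by simp [norm_expCircle]
  · intro t f g hfg
    exact integral_congr_ae (hfg.mono fun x hx => by simp only [hx])
  · intro c s hs _
    have hm : (ν.restrict s).map F ≪ volume :=
      (Measure.map_mono_of_aemeasurable Measure.restrict_le_self hF).absolutelyContinuous.trans hac
    have h := (tendsto_integral_expCircle_measure hm).const_mul c
    rw [mul_zero] at h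
    refine h.congr fun t => ?_
    have hc : Continuous fun y : ℝ => expCircle ((t * y : ℝ) : UnitAddCircle) :=
      continuous_expCircle.comp ((AddCircle.continuous_mk' 1).comp (by fun_prop))
    rw [integral_map hF.restrict hc.aestronglyMeasurable, ← integral_const_mul,
      ← integral_indicator hs]
    refine integral_congr_ae (Eventually.of_forall fun x => ?_)
    by_cases hx : x ∈ s <;> simp [hx]

section Characters

variable {X K A : Type*} [MeasurableSpace X] [TopologicalSpace K] [CompactSpace K] [AddCommGroup A]

/-- The characters of a compact space attached to a group of maps to the circle. -/
def circleChar (c : A → K → UnitAddCircle) (hcont : ∀ a, Continuous (c a)) (a : A) : C(K, ℂ) :=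
  ⟨fun y => expCircle (c a y), continuous_expCircle.comp (hcont a)⟩

/-- Stone–Weierstrass. Products and conjugates of characters are characters, so the star algebra
they generate is already their linear span. -/
theorem span_circleChar_dense {c : A → K → UnitAddCircle} (hcont : ∀ a, Continuous (c a))
    (hadd : ∀ a b y, c (a + b) y = c a y + c b y) (hsep : ∀ x y, x ≠ y → ∃ a, c a x ≠ c a y) :
    Dense (Submodule.span ℂ (Set.range (circleChar c hcont)) : Set C(K, ℂ)) := by
  have hzero : ∀ y, c 0 y = 0 := fun y => by
    have := hadd 0 0 y
    rw [add_zero] at this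
    exact left_eq_add.1 this
  have hneg : ∀ a y, c (-a) y = -c a y := fun a y => by
    have := hadd (-a) a y
    rw [neg_add_cancel, hzero] at this
    exact eq_neg_of_add_eq_zero_left this.symm
  set S := StarAlgebra.adjoin ℂ (Set.range (circleChar c hcont)) with hS
  have hstar : star (Set.range (circleChar c hcont)) ⊆ Set.range (circleChar c hcont) := by
    rintro f ⟨a, ha⟩
    refine ⟨-a, ?_⟩
    rw [← star_star f, ← ha]
    ext y
    simp only [circleChar, ContinuousMap.coe_mk, ContinuousMap.star_apply, hneg, expCircle,
      AddCircle.toCircle_neg, Circle.coe_inv_eq_conj]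
    rfl
  have hclos : (Submonoid.closure (Set.range (circleChar c hcont)) : Set C(K, ℂ)) ⊆
      Set.range (circleChar c hcont) := by
    intro f hf
    induction hf using Submonoid.closure_induction with
    | mem x hx => exact hx
    | one => exact ⟨0, by ext y; simp [circleChar, hzero, expCircle]⟩
    | mul x y _ _ hx hy =>
      obtain ⟨a, rfl⟩ := hx
      obtain ⟨b, rfl⟩ := hy
      exact ⟨a + b, by ext y; simp [circleChar, hadd, expCircle_add]⟩
  have hle : (S : Set C(K, ℂ)) ⊆ Submodule.span ℂ (Set.range (circleChar c hcont)) := by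
    intro f hf
    have h1 : f ∈ S.toSubalgebra := hf
    rw [hS, StarAlgebra.adjoin_toSubalgebra, Set.union_eq_self_of_subset_right hstar,
      ← Subalgebra.mem_toSubmodule, Algebra.adjoin_eq_span] at h1
    exact Submodule.span_mono hclos h1
  have htop := ContinuousMap.starSubalgebra_topologicalClosure_eq_top_of_separatesPoints S (by
    intro x y hxy
    obtain ⟨a, ha⟩ := hsep x y hxy
    refine ⟨circleChar c hcont a, ⟨circleChar c hcont a,
      StarAlgebra.subset_adjoin ℂ _ ⟨a, rfl⟩, rfl⟩, fun he => ha ?_⟩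
    have he' : expCircle (c a x) = expCircle (c a y) := he
    exact AddCircle.injective_toCircle one_ne_zero (Subtype.ext he'))
  have hd : Dense (S : Set C(K, ℂ)) := by
    intro f
    have : f ∈ S.topologicalClosure := htop ▸ trivial
    exact this
  exact hd.mono hle

variable [SecondCountableTopology K] [TopologicalSpace.PseudoMetrizableSpace K]
  [MeasurableSpace K] [BorelSpace K]

/-- If the characters of `Θ_t` become asymptotically uncorrelated with all events, then `Θ_t`
becomes asymptotically independent of all events. -/
theorem tendsto_integral_curry {ν : Measure X} [IsProbabilityMeasure ν] {κ : Measure K}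
    [IsProbabilityMeasure κ] {Θ : ℝ → X → K} (hΘ : ∀ t, AEMeasurable (Θ t) ν)
    {c : A → K → UnitAddCircle} (hcont : ∀ a, Continuous (c a))
    (hadd : ∀ a b y, c (a + b) y = c a y + c b y) (hsep : ∀ x y, x ≠ y → ∃ a, c a x ≠ c a y)
    (hκ : ∀ a, a ≠ 0 → ∫ y, expCircle (c a y) ∂κ = 0)
    (hlim : ∀ a, a ≠ 0 → ∀ s, MeasurableSet s →
      Tendsto (fun t => ∫ x in s, expCircle (c a (Θ t x)) ∂ν) atTop (𝓝 0))
    {φ : X → C(K, ℂ)} (hφ : Integrable φ ν) :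
    Tendsto (fun t => ∫ x, φ x (Θ t x) ∂ν - ∫ x, ∫ y, φ x y ∂κ ∂ν) atTop (𝓝 0) := by
  have hint1 : ∀ t (f : X → C(K, ℂ)), Integrable f ν → Integrable (fun x => f x (Θ t x)) ν := by
    intro t f hf
    have hev : Continuous fun z : C(K, ℂ) × K => z.1 z.2 := continuous_eval
    refine hf.norm.mono' (hev.comp_aestronglyMeasurable
      (hf.aestronglyMeasurable.prodMk (hΘ t).aestronglyMeasurable)) ?_
    exact Eventually.of_forall fun x => (f x).norm_coe_le_norm _
  have hck : ∀ f : C(K, ℂ), Integrable f κ := fun f =>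
    Integrable.of_bound f.continuous.aestronglyMeasurable ‖f‖
      (Eventually.of_forall fun y => f.norm_coe_le_norm y)
  have hkn : ∀ f : C(K, ℂ), ‖∫ y, f y ∂κ‖ ≤ ‖f‖ := fun f => by
    have := norm_integral_le_of_norm_le_const (μ := κ) (f := f)
      (Eventually.of_forall fun y => f.norm_coe_le_norm y)
    simpa using this
  have hkc : Continuous fun f : C(K, ℂ) => ∫ y, f y ∂κ := by
    refine continuous_iff_continuousAt.2 fun f => ?_
    rw [ContinuousAt, tendsto_iff_norm_sub_tendsto_zero]
    refine squeeze_zero (fun _ => norm_nonneg _) (fun g => ?_)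
      (tendsto_iff_norm_sub_tendsto_zero.1 (tendsto_id (x := 𝓝 f)))
    rw [← integral_sub (hck g) (hck f)]
    exact hkn (g - f)
  have hint2 : ∀ (f : X → C(K, ℂ)), Integrable f ν → Integrable (fun x => ∫ y, f x y ∂κ) ν := by
    intro f hf
    exact hf.norm.mono' (hkc.comp_aestronglyMeasurable hf.aestronglyMeasurable)
      (Eventually.of_forall fun x => hkn _)
  refine tendsto_zero_of_indicator (ν := ν)
    (fun t (f : X → C(K, ℂ)) => ∫ x, f x (Θ t x) ∂ν - ∫ x, ∫ y, f x y ∂κ ∂ν) 2 ?_ ?_ ?_ ?_ hφ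
  · intro t f g hf hg
    simp only [Pi.add_apply, ContinuousMap.add_apply]
    rw [integral_add (hint1 t f hf) (hint1 t g hg)]
    simp only [integral_add (hck _) (hck _)]
    rw [integral_add (hint2 f hf) (hint2 g hg)]
    ring
  · intro t f hf
    have h1 : ‖∫ x, f x (Θ t x) ∂ν‖ ≤ ∫ x, ‖f x‖ ∂ν :=
      norm_integral_le_of_norm_le hf.norm
        (Eventually.of_forall fun x => (f x).norm_coe_le_norm _)
    have h2 : ‖∫ x, ∫ y, f x y ∂κ ∂ν‖ ≤ ∫ x, ‖f x‖ ∂ν :=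
      norm_integral_le_of_norm_le hf.norm (Eventually.of_forall fun x => hkn _)
    exact (norm_sub_le _ _).trans (by linarith)
  · intro t f g hfg
    congr 1
    · exact integral_congr_ae (hfg.mono fun x hx => by simp only [hx])
    · exact integral_congr_ae (hfg.mono fun x hx => by simp only [hx])
  -- For a constant `f` on a set `s` the error is linear in `f` and bounded by `2 * ‖f‖`, uniformly
  -- in `t`; it is therefore enough to test it on characters.
  · intro f s hs _
    set D : ℝ → C(K, ℂ) → ℂ := fun t f => ∫ x in s, f (Θ t x) ∂ν - ν.real s * ∫ y, f y ∂κ with hD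
    have hDeq : ∀ t f, ∫ x, (s.indicator (fun _ => f) x) (Θ t x) ∂ν -
        ∫ x, ∫ y, (s.indicator (fun _ => f) x) y ∂κ ∂ν = D t f := by
      intro t f
      have e1 : ∀ x, (s.indicator (fun _ => f) x) (Θ t x) = s.indicator (fun x => f (Θ t x)) x :=
        fun x => by by_cases hx : x ∈ s <;> simp [hx]
      have e2 : ∀ x, ∫ y, (s.indicator (fun _ => f) x) y ∂κ =
          s.indicator (fun _ => ∫ y, f y ∂κ) x :=
        fun x => by by_cases hx : x ∈ s <;> simp [hx]
      simp only [e1, e2]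
      rw [integral_indicator hs, integral_indicator hs, setIntegral_const, hD]
      simp
    simp only [hDeq]
    have hfi : ∀ t (f : C(K, ℂ)), IntegrableOn (fun x => f (Θ t x)) s ν := fun t f =>
      (hint1 t (fun _ => f) (integrable_const f)).integrableOn
    have hDadd : ∀ t f g, D t (f + g) = D t f + D t g := by
      intro t f g
      simp only [hD, ContinuousMap.add_apply]
      rw [integral_add (hfi t f) (hfi t g), integral_add (hck f) (hck g)]
      ring
    have hDsmul : ∀ t (z : ℂ) f, D t (z • f) = z * D t f := by
      intro t z f
      simp only [hD, ContinuousMap.smul_apply, smul_eq_mul]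
      rw [integral_const_mul, integral_const_mul]
      ring
    have hDnorm : ∀ t f, ‖D t f‖ ≤ 2 * ‖f‖ := by
      intro t f
      have hs1 : ν.real s ≤ 1 := measureReal_le_one
      have h1 : ‖∫ x in s, f (Θ t x) ∂ν‖ ≤ ‖f‖ := by
        refine (norm_setIntegral_le_of_norm_le_const (measure_lt_top _ _)
          fun x _ => f.norm_coe_le_norm _).trans ?_
        exact mul_le_of_le_one_right (norm_nonneg _) hs1
      have h2 : ‖(ν.real s : ℂ) * ∫ y, f y ∂κ‖ ≤ ‖f‖ := by
        rw [norm_mul, Complex.norm_real, Real.norm_of_nonneg measureReal_nonneg]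
        exact (mul_le_of_le_one_left (norm_nonneg _) hs1).trans (hkn f)
      exact (norm_sub_le _ _).trans (by linarith)
    have hspan : ∀ f ∈ Submodule.span ℂ (Set.range (circleChar c hcont)),
        Tendsto (fun t => D t f) atTop (𝓝 0) := by
      intro f hf
      induction hf using Submodule.span_induction with
      | mem f hf =>
        obtain ⟨a, rfl⟩ := hf
        by_cases ha : a = 0
        · subst ha
          have hzero : ∀ y, c 0 y = 0 := fun y => by
            have := hadd 0 0 y
            rw [add_zero] at this
            exact left_eq_add.1 this
          have : ∀ t, D t (circleChar c hcont 0) = 0 := fun t => by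
            simp [hD, circleChar, hzero, expCircle]
          simp [this]
        · have : ∀ t, D t (circleChar c hcont a) = ∫ x in s, expCircle (c a (Θ t x)) ∂ν := fun t => by
            simp [hD, circleChar, hκ a ha]
          simpa only [this] using hlim a ha s hs
      | zero =>
        have : ∀ t, D t 0 = 0 := fun t => by simp [hD]
        simp [this]
      | add f g _ _ hf hg =>
        simp only [hDadd]
        simpa using hf.add hg
      | smul z f _ hf =>
        simp only [hDsmul]
        simpa using hf.const_mul z
    rw [Metric.tendsto_nhds]
    intro ε hε
    obtain ⟨g, hg, hfg⟩ := Metric.mem_closure_iff.1 (span_circleChar_dense hcont hadd hsep f)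
      (ε / 4) (by positivity)
    filter_upwards [Metric.tendsto_nhds.1 (hspan g hg) (ε / 2) (by positivity)] with t ht
    have h1 : D t f = D t (f - g) + D t g := by rw [← hDadd, sub_add_cancel]
    have h2 := hDnorm t (f - g)
    rw [dist_eq_norm] at hfg
    rw [dist_zero_right] at ht ⊢
    rw [h1]
    exact (norm_add_le _ _).trans_lt (by linarith)

/-- Since `K` is compact, a bounded continuous function on `X × K` curries to a bounded continuous
map from `X` to `C(K, ℂ)`, to which `tendsto_integral_curry` applies. -/
theorem tendstoInDistribution_of_characters [TopologicalSpace X] [SecondCountableTopology X]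
    [BorelSpace X] {ν : Measure X} [IsProbabilityMeasure ν] {κ : Measure K}
    [IsProbabilityMeasure κ] {Θ : ℝ → X → K} (hΘ : ∀ t, AEMeasurable (Θ t) ν)
    {c : A → K → UnitAddCircle} (hcont : ∀ a, Continuous (c a))
    (hadd : ∀ a b y, c (a + b) y = c a y + c b y) (hsep : ∀ x y, x ≠ y → ∃ a, c a x ≠ c a y)
    (hκ : ∀ a, a ≠ 0 → ∫ y, expCircle (c a y) ∂κ = 0)
    (hlim : ∀ a, a ≠ 0 → ∀ s, MeasurableSet s →
      Tendsto (fun t => ∫ x in s, expCircle (c a (Θ t x)) ∂ν) atTop (𝓝 0)) :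
    TendstoInDistribution (fun (t : ℝ) (x : X) => (x, Θ t x)) atTop (id : X × K → X × K)
      (fun _ => ν) (ν.prod κ) where
  forall_aemeasurable t := aemeasurable_id.prodMk (hΘ t)
  aemeasurable_limit := aemeasurable_id
  tendsto := by
    refine (ProbabilityMeasure.tendsto_iff_forall_integral_rclike_tendsto ℂ).2 fun f => ?_
    set φ : X → C(K, ℂ) := fun x => ContinuousMap.curry f.toContinuousMap x with hφdef
    have hφ : Integrable φ ν := by
      refine Integrable.of_bound
        (ContinuousMap.curry f.toContinuousMap).continuous.aestronglyMeasurable ‖f‖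
        (Eventually.of_forall fun x => ?_)
      exact (ContinuousMap.norm_le _ (norm_nonneg f)).2 fun y => f.norm_coe_le_norm (x, y)
    have h := tendsto_integral_curry hΘ hcont hadd hsep hκ hlim hφ
    have e1 : ∀ t, ∫ z, f z ∂(ν.map fun x => (x, Θ t x)) = ∫ x, φ x (Θ t x) ∂ν := fun t =>
      integral_map (aemeasurable_id.prodMk (hΘ t)) f.continuous.aestronglyMeasurable
    have e2 : ∫ z, f z ∂((ν.prod κ).map id) = ∫ x, ∫ y, φ x y ∂κ ∂ν := by
      rw [Measure.map_id]
      exact integral_prod _ (f.integrable _)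
    simp only [ProbabilityMeasure.coe_mk, e1, e2]
    exact tendsto_sub_nhds_zero_iff.1 h

end Characters

/-! ### Characters of the torus of phases -/

/-- Translation by half a period, `1 / (2n)`, preserves Haar measure and changes the sign of the
integrand. -/
theorem integral_expCircle_zsmul {n : ℤ} (hn : n ≠ 0) :
    ∫ θ : UnitAddCircle, expCircle (n • θ) ∂AddCircle.haarAddCircle = 0 := by
  have h1 := integral_add_right_eq_self (μ := (AddCircle.haarAddCircle : Measure UnitAddCircle))
    (fun θ => fourier (T := (1 : ℝ)) n θ) ((1 / 2 / n : ℝ) : UnitAddCircle)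
  simp only [fourier_add_half_inv_index hn one_pos] at h1
  rw [integral_neg] at h1
  have h2 : ∫ θ : UnitAddCircle, fourier (T := (1 : ℝ)) n θ ∂AddCircle.haarAddCircle = 0 :=
    self_eq_neg.1 h1.symm
  exact h2

theorem expCircle_sum {ι : Type*} (s : Finset ι) (f : ι → UnitAddCircle) :
    expCircle (∑ i ∈ s, f i) = ∏ i ∈ s, expCircle (f i) := by
  classical
  induction s using Finset.induction_on with
  | empty => simp [expCircle]
  | insert a s ha ih => rw [Finset.sum_insert ha, Finset.prod_insert ha, expCircle_add, ih]

/-- The character of the torus with exponents `n`. -/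
def torusPairing {ι : Type*} (n : ι →₀ ℤ) (θ : ι → UnitAddCircle) : UnitAddCircle :=
  n.sum fun i a => a • θ i

theorem continuous_torusPairing {ι : Type*} (n : ι →₀ ℤ) : Continuous (torusPairing n) :=
  continuous_finsetSum _ fun i _ => (continuous_apply i).zsmul _

theorem torusPairing_add {ι : Type*} (m n : ι →₀ ℤ) (θ : ι → UnitAddCircle) :
    torusPairing (m + n) θ = torusPairing m θ + torusPairing n θ := by
  classical
  exact Finsupp.sum_add_index' (fun i => zero_zsmul _) fun i a b => add_zsmul _ _ _

theorem torusPairing_zero {ι : Type*} (θ : ι → UnitAddCircle) : torusPairing 0 θ = 0 :=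
  Finsupp.sum_zero_index

theorem torusPairing_single {ι : Type*} (i : ι) (θ : ι → UnitAddCircle) :
    torusPairing (Finsupp.single i 1) θ = θ i := by
  rw [torusPairing, Finsupp.sum_single_index (zero_zsmul _), one_zsmul]

theorem torusPairing_eq_sum {ι : Type*} {n : ι →₀ ℤ} {s : Finset ι} (hs : n.support ⊆ s)
    (θ : ι → UnitAddCircle) : torusPairing n θ = ∑ i ∈ s, n i • θ i :=
  Finsupp.sum_of_support_subset _ hs _ fun _ _ => zero_zsmul _

theorem integral_torusPairing {n : PrimeIndex →₀ ℤ} (hn : n ≠ 0) :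
    ∫ θ, expCircle (torusPairing n θ) ∂uniformPhases = 0 := by
  obtain ⟨k, hk⟩ : ∃ k, k ∈ n.support := Finsupp.support_nonempty_iff.2 hn
  have e1 : ∀ θ : PrimeIndex → UnitAddCircle, expCircle (torusPairing n θ) =
      (fun u : n.support → UnitAddCircle => ∏ i : n.support, expCircle (n i • u i)) (n.support.restrict θ) := by
    intro θ
    rw [torusPairing_eq_sum subset_rfl, expCircle_sum, ← Finset.prod_coe_sort]
    rfl
  simp only [e1]
  have hm : Measurable (n.support.restrict : (PrimeIndex → UnitAddCircle) → _) :=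
    Finset.measurable_restrict _
  have hc : Continuous fun u : n.support → UnitAddCircle => ∏ i : n.support, expCircle (n i • u i) :=
    continuous_finsetProd _ fun i _ => continuous_expCircle.comp ((continuous_apply i).zsmul _)
  have h := integral_map (μ := uniformPhases) hm.aemeasurable
    (f := fun u : n.support → UnitAddCircle => ∏ i : n.support, expCircle (n i • u i))
    hc.aestronglyMeasurable
  rw [← h, uniformPhases, Measure.infinitePi_map_restrict,
    integral_fintype_prod_eq_prod (fun (i : n.support) θ => expCircle (n i • θ))]
  exact Finset.prod_eq_zero (Finset.mem_univ ⟨k, hk⟩)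
    (integral_expCircle_zsmul (Finsupp.mem_support_iff.1 hk))

/-! ### The law of a combination of the functions `Y` -/

/-- A support function is Lipschitz, with constant any bound for the norm on the region. -/
theorem IsAnalyticOval.continuous_curveY {γ : ℝ → Plane} {Ω : Set Plane}
    (h : IsAnalyticOval γ Ω) : Continuous (curveY γ) := by
  obtain ⟨M, hM⟩ := h.isCompact.isBounded.exists_norm_le
  have hle : ∀ ξ ξ' : Plane, curveY γ ξ - curveY γ ξ' ≤ M * ‖ξ - ξ'‖ := by
    intro ξ ξ'
    obtain ⟨s, hs⟩ : ∃ s, curveY γ ξ = inner ℝ ξ (γ s) := by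
      by_cases h0 : ξ = 0
      · exact ⟨0, by simp [h0, curveY]⟩
      · obtain ⟨s, hs⟩ := h.contactPoint_mem_range h0
        exact ⟨s, by rw [curveY, hs]⟩
    have h1 := h.inner_le_curveY ξ' s
    have h2 : (inner ℝ (ξ - ξ') (γ s) : ℝ) ≤ M * ‖ξ - ξ'‖ := by
      refine (real_inner_le_norm _ _).trans ?_
      rw [mul_comm]
      exact mul_le_mul_of_nonneg_right (hM _ (h.mem_region s)) (norm_nonneg _)
    rw [inner_sub_left] at h2
    linarith
  have hM0 : 0 ≤ M := (norm_nonneg _).trans (hM _ h.zero_mem)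
  refine (LipschitzWith.of_dist_le_mul (K := ⟨M, hM0⟩) fun ξ ξ' => ?_).continuous
  rw [Real.dist_eq, dist_eq_norm, abs_le]
  have h1 := hle ξ ξ'
  have h2 := hle ξ' ξ
  rw [norm_sub_rev] at h2
  change -(M * ‖ξ - ξ'‖) ≤ _ ∧ _ ≤ M * ‖ξ - ξ'‖
  constructor <;> linarith

theorem aemeasurable_curveY_latticeVec {γ : ℝ → Plane} {Ω : Set Plane} (h : IsAnalyticOval γ Ω)
    {μ : Measure LatticeSpace} [IsProbabilityMeasure μ] [SMulInvariantMeasure SL2R LatticeSpace μ]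
    (k : ℤ × ℤ) : AEMeasurable (fun L => curveY γ (latticeVec k L)) μ := by
  have hc : Continuous fun e : Plane × Plane => curveY γ ((k.1 : ℝ) • e.1 + (k.2 : ℝ) • e.2) :=
    h.continuous_curveY.comp (by fun_prop)
  exact hc.measurable.comp_aemeasurable aemeasurable_minimalPair

theorem latticeVec_neg (k : ℤ × ℤ) (L : LatticeSpace) : latticeVec (-k) L = -latticeVec k L := by
  simp only [latticeVec, Prod.fst_neg, Prod.snd_neg, Int.cast_neg, neg_smul]
  abel

/-- Proportional primitive vectors agree up to sign, and `PrimeIndex` keeps one of each opposite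
pair. This is what makes the slopes in the orbit computation distinct. -/
theorem PrimeIndex.eq_of_det_eq_zero {k k' : ℤ × ℤ} (hk : k ∈ PrimeIndex) (hk' : k' ∈ PrimeIndex)
    (h : k.1 * k'.2 - k.2 * k'.1 = 0) : k = k' := by
  obtain ⟨hc, h0, h1⟩ := hk
  obtain ⟨hc', h0', h1'⟩ := hk'
  have d1 : k.1 ∣ k'.1 := hc.dvd_of_dvd_mul_left ⟨k'.2, by linarith⟩
  have d2 : k'.1 ∣ k.1 := hc'.dvd_of_dvd_mul_right ⟨k.2, by linarith⟩
  have e1 : k.1 = k'.1 := Int.dvd_antisymm h0 h0' d1 d2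
  by_cases hz : k.1 = 0
  · exact Prod.ext e1 (by rw [h1 hz, h1' (e1 ▸ hz)])
  · refine Prod.ext e1 (mul_left_cancel₀ hz ?_)
    rw [← e1] at h
    linarith

/-- Separates the positive factor `e^{-r}|y|`, which homogeneity of `Y` extracts, from the sign `ε`,
which it cannot extract. -/
theorem upperTriangular_orbit (η r s : ℝ) (g : SL2R) (n : ℤ × ℤ) (hy : matVec g n 1 ≠ 0)
    {ε : ℤˣ} (hε : matVec g n 1 = |matVec g n 1| * ε) :
    matVec (lowerUnipotent η * (upperUnipotent s * (diagFlow r * g))) n =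
      (Real.exp (-r) * |matVec g n 1|) • ((ε : ℝ) •
        (!₂[s + Real.exp (2 * r) * (matVec g n 0 / matVec g n 1),
          η * (s + Real.exp (2 * r) * (matVec g n 0 / matVec g n 1)) + 1] : Plane)) := by
  rw [matVec_lowerUnipotent_mul, matVec_upperUnipotent_mul, matVec_diagFlow_mul, smul_smul,
    mul_assoc (Real.exp (-r)), ← hε]
  have he : Real.exp (-r) * Real.exp (2 * r) = Real.exp r := by
    rw [← Real.exp_add]; congr 1; ring
  have hd : matVec g n 1 * (matVec g n 0 / matVec g n 1) = matVec g n 0 := mul_div_cancel₀ _ hy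
  generalize matVec g n 0 / matVec g n 1 = d at hd
  rw [← hd, ← he]
  apply plane_ext
  · simp; ring
  · simp; ring

theorem exists_unit_sign (x : ℝ) : ∃ ε : ℤˣ, x = |x| * ε := by
  rcases le_total 0 x with h | h
  · exact ⟨1, by simp [abs_of_nonneg h]⟩
  · exact ⟨-1, by simp [abs_of_nonpos h]⟩

/-- The law of a nontrivial combination of the `Y_γ(± k(L))` does not charge null sets. -/
theorem ae_sum_curveY_notMem {γ : ℝ → Plane} {Ω : Set Plane} (h : IsAnalyticOval γ Ω)
    {μ : Measure LatticeSpace} [IsProbabilityMeasure μ] [SMulInvariantMeasure SL2R LatticeSpace μ]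
    {ι : Type*} (S : Finset ι) {k : ι → ℤ × ℤ} (hk : ∀ i, k i ∈ PrimeIndex)
    (hinj : Function.Injective k) {p q : ι → ℤ} {i₀ : ι} (hi₀ : i₀ ∈ S)
    (hpq : p i₀ ≠ 0 ∨ q i₀ ≠ 0) (hsym : q i₀ = 0 ∨ ¬ HasCenterOfSymmetry Ω)
    {N : Set ℝ} (hN : volume N = 0) :
    ∀ᵐ L ∂μ, ∑ i ∈ S, (p i * curveY γ (latticeVec (k i) L) +
      q i * curveY γ (latticeVec (-k i) L)) ∉ N := by
  classical
  set F : LatticeSpace → ℝ := fun L => ∑ i ∈ S, (p i * curveY γ (latticeVec (k i) L) +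
      q i * curveY γ (latticeVec (-k i) L)) with hF
  have hFm : AEMeasurable F μ := by
    refine Finset.aemeasurable_fun_sum _ fun i _ => ?_
    exact ((aemeasurable_curveY_latticeVec h _).const_mul _).add
      ((aemeasurable_curveY_latticeVec h _).const_mul _)
  obtain ⟨N', hNN', hN'm, hN'⟩ := exists_measurable_superset_of_null hN
  have hnull : NullMeasurableSet (F ⁻¹' N') μ := hFm.nullMeasurable hN'm
  -- `F` is only almost everywhere measurable; the orbit argument needs a genuine Borel set, here
  -- one contained in the preimage, so that its points still satisfy `F L ∈ N'`.
  obtain ⟨B, hBsub, hBm, hBae⟩ := hnull.exists_measurable_subset_ae_eq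
  set B' := B ∩ {L | IsGenericLattice L} with hB'
  have hB'm : MeasurableSet B' := hBm.inter measurableSet_isGenericLattice
  obtain ⟨η, hη⟩ := h.exists_direction_not_polynomial (p := p i₀) (q := q i₀)
    (by simpa using hpq) (by
      rcases hsym with hq | hs
      · exact Or.inr (Or.inl (by simp [hq]))
      · exact Or.inr (Or.inr hs))
  have hcont : Continuous fun s => lowerUnipotent η * upperUnipotent s :=
    continuous_const.mul continuous_upperUnipotent
  have hB'0 : μ B' = 0 := by
    refine lattice_null_of_ae_curve hcont hB'm ?_
    refine lattice_null_of_ae_curve continuous_diagFlow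
      (measurableSet_ae_curve hcont hB'm) ?_
    filter_upwards [ae_snd_ne_zero (μ := μ)] with L hL
    obtain ⟨g, rfl⟩ := QuotientGroup.mk_surjective L
    have hy : ∀ n : ℤ × ℤ, n ≠ 0 → matVec g n 1 ≠ 0 := fun n hn =>
      hL _ ((mem_latticeVectors_iff g _).2 ⟨n, rfl⟩) (by rwa [Ne, matVec_eq_zero_iff])
    -- The coordinates of the minimal pair may change along the orbit, so every independent integral
    -- pair `(m, n)` is treated as a candidate. There are countably many, and almost every `(r, s)`
    -- serves them all.
    have main : ∀ m n : ℤ × ℤ, m.1 * n.2 - m.2 * n.1 ≠ 0 → ∀ᵐ r : ℝ, ∀ᵐ s : ℝ,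
        ∑ i ∈ S, (p i * curveY γ (matVec (lowerUnipotent η * (upperUnipotent s * (diagFlow r * g)))
            ((k i).1 * m.1 + (k i).2 * n.1, (k i).1 * m.2 + (k i).2 * n.2)) +
          q i * curveY γ (-matVec (lowerUnipotent η * (upperUnipotent s * (diagFlow r * g)))
            ((k i).1 * m.1 + (k i).2 * n.1, (k i).1 * m.2 + (k i).2 * n.2))) ∉ N' := by
      intro m n hmn
      set a : ι → ℤ × ℤ := fun i =>
        ((k i).1 * m.1 + (k i).2 * n.1, (k i).1 * m.2 + (k i).2 * n.2) with ha
      -- Multiplicativity of the determinant: passing to the coordinates `a i` keeps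
      -- non-proportional indices non-proportional.
      have hdet : ∀ i j, (a i).1 * (a j).2 - (a i).2 * (a j).1 =
          ((k i).1 * (k j).2 - (k i).2 * (k j).1) * (m.1 * n.2 - m.2 * n.1) := by
        intro i j; simp only [ha]; ring
      have ha0 : ∀ i, a i ≠ 0 := by
        intro i hi
        have e1 : (k i).1 * (m.1 * n.2 - m.2 * n.1) = 0 := by
          have h1 : (k i).1 * m.1 + (k i).2 * n.1 = 0 := congrArg Prod.fst hi
          have h2 : (k i).1 * m.2 + (k i).2 * n.2 = 0 := congrArg Prod.snd hi
          linear_combination n.2 * h1 - n.1 * h2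
        have e2 : (k i).2 * (m.1 * n.2 - m.2 * n.1) = 0 := by
          have h1 : (k i).1 * m.1 + (k i).2 * n.1 = 0 := congrArg Prod.fst hi
          have h2 : (k i).1 * m.2 + (k i).2 * n.2 = 0 := congrArg Prod.snd hi
          linear_combination m.1 * h2 - m.2 * h1
        have e3 := (mul_eq_zero.1 e1).resolve_right hmn
        have e4 := (mul_eq_zero.1 e2).resolve_right hmn
        have := (hk i).2.2 e3
        omega
      choose ε hε using fun i => exists_unit_sign (matVec g (a i) 1)
      set y : ι → ℝ := fun i => matVec g (a i) 1 with hydef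
      have hy0 : ∀ i, y i ≠ 0 := fun i => hy _ (ha0 i)
      set H : ι → ℝ → ℝ := fun i t => p i * curveY γ ((ε i : ℝ) • !₂[t, η * t + 1]) +
        q i * curveY γ (-((ε i : ℝ) • !₂[t, η * t + 1])) with hH
      have hεε : ∀ i, (ε i : ℝ) * ε i = 1 := fun i => by
        rcases Int.units_eq_one_or (ε i) with e | e <;> simp [e]
      have key := ae_ae_sum_notMem hi₀ (τ := fun i => matVec g (a i) 0 / y i)
        (c := fun i => |y i|) (H := H) (N := N') (fun i _ hne => ?_) (abs_ne_zero.2 (hy0 i₀))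
        (fun i _ => ?_) (fun b b' hbb P => hη (ε i₀) b b' hbb P) hN'
      · filter_upwards [key] with r hr
        filter_upwards [hr] with s hs
        rw [Finset.mul_sum] at hs
        intro hmem
        refine hs (Eq.subst (motive := fun z : ℝ => z ∈ N') ?_ hmem)
        refine Finset.sum_congr rfl fun i _ => ?_
        have hpos : 0 < Real.exp (-r) * |y i| := mul_pos (Real.exp_pos _) (abs_pos.2 (hy0 i))
        change p i * curveY γ (matVec _ (a i)) + q i * curveY γ (-matVec _ (a i)) = _
        rw [upperTriangular_orbit η r s g (a i) (hy0 i) (hε i), ← smul_neg,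
          h.curveY_smul _ hpos, h.curveY_smul _ hpos]
        simp only [hH]
        ring
      · intro he
        apply hne
        rw [div_eq_div_iff (hy0 i) (hy0 i₀)] at he
        have h1 := planeDet_matVec g (a i) (a i₀)
        have h2 : planeDet (matVec g (a i)) (matVec g (a i₀)) = 0 := by
          rw [planeDet]; linarith
        rw [h2] at h1
        have h3 : (a i).1 * (a i₀).2 - (a i).2 * (a i₀).1 = 0 := by exact_mod_cast h1.symm
        rw [hdet] at h3
        exact hinj (PrimeIndex.eq_of_det_eq_zero (hk i) (hk i₀) ((mul_eq_zero.1 h3).resolve_right hmn))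
      · have hline : ∀ t : ℝ, (ε i : ℝ) • (!₂[t, η * t + 1] : Plane) =
            t • (!₂[(ε i : ℝ), ε i * η] : Plane) + !₂[0, (ε i : ℝ)] := by
          intro t
          apply plane_ext
          · simp [mul_comm]
          · simp; ring
        have hline' : ∀ t : ℝ, -((ε i : ℝ) • (!₂[t, η * t + 1] : Plane)) =
            t • (-!₂[(ε i : ℝ), ε i * η] : Plane) + -!₂[0, (ε i : ℝ)] := by
          intro t
          rw [hline, neg_add, smul_neg]
        have d1 : planeDet !₂[(ε i : ℝ), ε i * η] !₂[0, (ε i : ℝ)] ≠ 0 := by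
          simp [planeDet]
        have d2 : planeDet (-!₂[(ε i : ℝ), ε i * η]) (-!₂[0, (ε i : ℝ)]) ≠ 0 := by
          simp [planeDet]
        refine ((h.countable_not_analyticAt_curveY d1).union
          (h.countable_not_analyticAt_curveY d2)).mono fun t ht => ?_
        by_contra hcon
        simp only [Set.mem_union, Set.mem_ofPred_eq, not_or, not_not] at hcon
        apply ht
        simp only [hH, hline']
        simp only [hline]
        exact (analyticAt_const.mul hcon.1).add (analyticAt_const.mul hcon.2)
    have main' : ∀ᵐ r : ℝ, ∀ m n : ℤ × ℤ, m.1 * n.2 - m.2 * n.1 ≠ 0 → ∀ᵐ s : ℝ,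
        ∑ i ∈ S, (p i * curveY γ (matVec (lowerUnipotent η * (upperUnipotent s * (diagFlow r * g)))
            ((k i).1 * m.1 + (k i).2 * n.1, (k i).1 * m.2 + (k i).2 * n.2)) +
          q i * curveY γ (-matVec (lowerUnipotent η * (upperUnipotent s * (diagFlow r * g)))
            ((k i).1 * m.1 + (k i).2 * n.1, (k i).1 * m.2 + (k i).2 * n.2))) ∉ N' := by
      simp only [ae_all_iff]
      exact main
    filter_upwards [main'] with r hr
    rw [Set.notMem_compl_iff]
    change ∀ᵐ s : ℝ, (lowerUnipotent η * upperUnipotent s) • diagFlow r • (g : LatticeSpace) ∉ B'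
    have hr' : ∀ᵐ s : ℝ, ∀ m n : ℤ × ℤ, m.1 * n.2 - m.2 * n.1 ≠ 0 →
        ∑ i ∈ S, (p i * curveY γ (matVec (lowerUnipotent η * (upperUnipotent s * (diagFlow r * g)))
            ((k i).1 * m.1 + (k i).2 * n.1, (k i).1 * m.2 + (k i).2 * n.2)) +
          q i * curveY γ (-matVec (lowerUnipotent η * (upperUnipotent s * (diagFlow r * g)))
            ((k i).1 * m.1 + (k i).2 * n.1, (k i).1 * m.2 + (k i).2 * n.2))) ∉ N' := by
      simp only [ae_all_iff]
      exact hr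
    filter_upwards [hr'] with s hs hmem
    have hcoe : (lowerUnipotent η * upperUnipotent s) • diagFlow r • (g : LatticeSpace) =
        ((lowerUnipotent η * (upperUnipotent s * (diagFlow r * g)) : SL2R) : LatticeSpace) := by
      change ((lowerUnipotent η * upperUnipotent s * (diagFlow r * g) : SL2R) : LatticeSpace) = _
      rw [mul_assoc]
    change (lowerUnipotent η * upperUnipotent s) • diagFlow r • (g : LatticeSpace) ∈ B' at hmem
    rw [hcoe] at hmem
    obtain ⟨m, n, hmn, hdet⟩ := IsGenericLattice.exists_minimalPair_eq hmem.2
    apply hs m n hdet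
    have hFN : F _ ∈ N' := hBsub hmem.1
    have hv : ∀ i, latticeVec (k i)
        ((lowerUnipotent η * (upperUnipotent s * (diagFlow r * g)) : SL2R) : LatticeSpace) =
        matVec (lowerUnipotent η * (upperUnipotent s * (diagFlow r * g)))
          ((k i).1 * m.1 + (k i).2 * n.1, (k i).1 * m.2 + (k i).2 * n.2) := fun i => by
      rw [latticeVec, hmn, matVec_smul_add]
    simpa only [hF, latticeVec_neg, hv] using hFN
  have hae : F ⁻¹' N' =ᵐ[μ] B' := by
    refine hBae.symm.trans ?_
    filter_upwards [ae_isGenericLattice (μ := μ)] with L hL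
    apply propext
    change L ∈ B ↔ L ∈ B ∧ IsGenericLattice L
    exact ⟨fun hb => ⟨hb, hL⟩, fun hb => hb.1⟩
  have h0 : μ (F ⁻¹' N') = 0 := by rw [measure_congr hae, hB'0]
  filter_upwards [measure_eq_zero_iff_ae_notMem.1 h0] with L hL hLN
  exact hL (hNN' hLN)

/-! ### Decorrelation of the phases and their limiting law. -/

theorem continuous_of_isSmoothOnLattices {E : Type*} [NormedAddCommGroup E] [NormedSpace ℝ E]
    {f : LatticeSpace → E} (hf : IsSmoothOnLattices f) : Continuous f := by
  obtain ⟨G, hG, hfG⟩ := hf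
  have hq : IsQuotientMap (QuotientGroup.mk : SL2R → LatticeSpace) := isQuotientMap_quot_mk
  rw [hq.continuous_iff]
  have : f ∘ (QuotientGroup.mk : SL2R → LatticeSpace) = fun g : SL2R => G fun i j => g.1 i j :=
    funext hfG
  rw [this]
  exact hG.continuous.comp (continuous_pi fun i => continuous_pi fun j => continuous_entry i j)

theorem sum_phase_eq (γ : ℝ → Plane) {ι : Type*} (S : Finset ι) (k : ι → ℤ × ℤ) (p q : ι → ℤ)
    (t : ℝ) (L : LatticeSpace) :
    ∑ i ∈ S, p i • phase γ (k i) t L + ∑ i ∈ S, q i • phase γ (-k i) t L =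
      ((t * ∑ i ∈ S, (p i * curveY γ (latticeVec (k i) L) +
        q i * curveY γ (latticeVec (-k i) L)) : ℝ) : UnitAddCircle) := by
  have h1 : ∀ (n : ℤ) (x : ℝ), n • (x : UnitAddCircle) = ((n * x : ℝ) : UnitAddCircle) := by
    intro n x
    rw [← zsmul_eq_mul, AddCircle.coe_zsmul]
  have h2 : ∀ f : ι → ℝ, ∑ i ∈ S, (f i : UnitAddCircle) = ((∑ i ∈ S, f i : ℝ) : UnitAddCircle) :=
    fun f => (map_sum (QuotientAddGroup.mk' (AddSubgroup.zmultiples (1 : ℝ))) f S).symm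
  simp only [phase, h1]
  rw [h2, h2, ← AddCircle.coe_add, Finset.mul_sum, ← Finset.sum_add_distrib]
  congr 1
  refine Finset.sum_congr rfl fun i _ => ?_
  ring

/-- The phases decorrelate from every integrable function of the lattice. -/
theorem tendsto_integral_phase {γ : ℝ → Plane} {Ω : Set Plane} (h : IsAnalyticOval γ Ω)
    {μ : Measure LatticeSpace} [IsProbabilityMeasure μ] [SMulInvariantMeasure SL2R LatticeSpace μ]
    {ν : Measure LatticeSpace} [IsProbabilityMeasure ν] (hν : ν ≪ μ)
    {ι : Type*} (S : Finset ι) {k : ι → ℤ × ℤ} (hk : ∀ i, k i ∈ PrimeIndex)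
    (hinj : Function.Injective k) {p q : ι → ℤ} {i₀ : ι} (hi₀ : i₀ ∈ S)
    (hpq : p i₀ ≠ 0 ∨ q i₀ ≠ 0) (hsym : q i₀ = 0 ∨ ¬ HasCenterOfSymmetry Ω)
    {ψ : LatticeSpace → ℂ} (hψ : Integrable ψ ν) :
    Tendsto (fun t : ℝ => ∫ L, ψ L * expCircle
      (∑ i ∈ S, p i • phase γ (k i) t L + ∑ i ∈ S, q i • phase γ (-k i) t L) ∂ν) atTop (𝓝 0) := by
  simp only [sum_phase_eq]
  have hm : AEMeasurable (fun L => ∑ i ∈ S, (p i * curveY γ (latticeVec (k i) L) +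
      q i * curveY γ (latticeVec (-k i) L))) ν := by
    refine AEMeasurable.mono_ac (ν := μ) (Finset.aemeasurable_fun_sum _ fun i _ => ?_) hν
    exact ((aemeasurable_curveY_latticeVec h _).const_mul _).add
      ((aemeasurable_curveY_latticeVec h _).const_mul _)
  refine tendsto_integral_mul_expCircle hm ?_ hψ
  refine Measure.AbsolutelyContinuous.mk fun N hN hN0 => ?_
  rw [Measure.map_apply_of_aemeasurable hm hN]
  exact measure_eq_zero_iff_ae_notMem.2
    (hν.ae_le (ae_sum_curveY_notMem h S hk hinj hi₀ hpq hsym hN0))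

theorem aemeasurable_phase {γ : ℝ → Plane} {Ω : Set Plane} (h : IsAnalyticOval γ Ω)
    {μ : Measure LatticeSpace} [IsProbabilityMeasure μ] [SMulInvariantMeasure SL2R LatticeSpace μ]
    (k : ℤ × ℤ) (t : ℝ) : AEMeasurable (phase γ k t) μ := by
  have hc : Continuous fun y : ℝ => ((t * y : ℝ) : UnitAddCircle) :=
    (AddCircle.continuous_mk' 1).comp (by fun_prop)
  exact hc.measurable.comp_aemeasurable (aemeasurable_curveY_latticeVec h k)

theorem IsSmoothOnLattices.integrable {ψ : LatticeSpace → ℂ} (hψ : IsSmoothOnLattices ψ)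
    (hsupp : HasCompactSupport ψ) (ν : Measure LatticeSpace) [IsFiniteMeasure ν] :
    Integrable ψ ν := by
  have hc := continuous_of_isSmoothOnLattices hψ
  obtain ⟨C, hC⟩ := hsupp.exists_bound_of_continuous hc
  exact Integrable.of_bound hc.aestronglyMeasurable C (Eventually.of_forall hC)

/-- Decorrelation holds for every integrable weight, in particular for indicators, which is the form
the convergence criterion requires. -/
theorem tendsto_setIntegral_phase {γ : ℝ → Plane} {Ω : Set Plane} (h : IsAnalyticOval γ Ω)
    {μ : Measure LatticeSpace} [IsProbabilityMeasure μ] [SMulInvariantMeasure SL2R LatticeSpace μ]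
    {ν : Measure LatticeSpace} [IsProbabilityMeasure ν] (hν : ν ≪ μ)
    (m n : PrimeIndex →₀ ℤ) (hmn : (m, n) ≠ 0) (hsym : n = 0 ∨ ¬ HasCenterOfSymmetry Ω)
    {s : Set LatticeSpace} (hs : MeasurableSet s) :
    Tendsto (fun t : ℝ => ∫ L in s, expCircle
      (torusPairing m (fun k => phase γ k t L) + torusPairing n (fun k => phase γ (-k) t L)) ∂ν)
      atTop (𝓝 0) := by
  classical
  obtain ⟨i, hi⟩ : ∃ i, m i ≠ 0 ∨ n i ≠ 0 := by
    by_contra! hcon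
    exact hmn (Prod.ext (Finsupp.ext fun i => (hcon i).1) (Finsupp.ext fun i => (hcon i).2))
  have hiS : i ∈ m.support ∪ n.support := by
    simpa only [Finset.mem_union, Finsupp.mem_support_iff] using hi
  have key := tendsto_integral_phase h hν (m.support ∪ n.support)
    (k := fun k : PrimeIndex => (k : ℤ × ℤ)) (fun k => k.2) Subtype.val_injective
    (p := m) (q := n) hiS hi (hsym.imp_left fun e => by rw [e]; rfl)
    (ψ := s.indicator fun _ => 1) ((integrable_const (1 : ℂ)).indicator hs)
  refine key.congr fun t => ?_
  rw [← integral_indicator hs]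
  refine integral_congr_ae (Eventually.of_forall fun L => ?_)
  simp only [torusPairing_eq_sum (Finset.subset_union_left (s₂ := n.support)) (n := m),
    torusPairing_eq_sum (Finset.subset_union_right (s₁ := m.support)) (n := n)]
  by_cases hL : L ∈ s <;> simp [hL]

theorem tendstoInDistribution_phases {γ : ℝ → Plane} {Ω : Set Plane} (h : IsAnalyticOval γ Ω)
    {μ : Measure LatticeSpace} [IsProbabilityMeasure μ] [SMulInvariantMeasure SL2R LatticeSpace μ]
    {ν : Measure LatticeSpace} [IsProbabilityMeasure ν] (hν : ν ≪ μ) :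
    TendstoInDistribution
      (fun (t : ℝ) (L : LatticeSpace) => (L, fun k : PrimeIndex => phase γ k t L))
      atTop (id : LatticeSpace × (PrimeIndex → UnitAddCircle) → _)
      (fun _ => ν) (ν.prod uniformPhases) := by
  refine tendstoInDistribution_of_characters
    (fun t => (aemeasurable_pi_lambda _ fun k : PrimeIndex => aemeasurable_phase h k t).mono_ac hν)
    continuous_torusPairing torusPairing_add (fun x y hxy => ?_)
    (fun n hn => integral_torusPairing hn) fun n hn s hs => ?_
  · obtain ⟨i, hi⟩ := Function.ne_iff.1 hxy
    exact ⟨Finsupp.single i 1, by rwa [torusPairing_single, torusPairing_single]⟩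
  · have := tendsto_setIntegral_phase h hν n 0 (fun e => hn (congrArg Prod.fst e)) (Or.inl rfl) hs
    simpa only [torusPairing_zero, add_zero] using this

theorem tendstoInDistribution_symmetric_phases {γ : ℝ → Plane} {Ω : Set Plane}
    (h : IsAnalyticOval γ Ω) (hsym : ¬ HasCenterOfSymmetry Ω)
    {μ : Measure LatticeSpace} [IsProbabilityMeasure μ] [SMulInvariantMeasure SL2R LatticeSpace μ]
    {ν : Measure LatticeSpace} [IsProbabilityMeasure ν] (hν : ν ≪ μ) :
    TendstoInDistribution
      (fun (t : ℝ) (L : LatticeSpace) =>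
        (L, (fun k : PrimeIndex => phase γ k t L), fun k : PrimeIndex => phase γ (-k) t L))
      atTop
      (id : LatticeSpace × (PrimeIndex → UnitAddCircle) × (PrimeIndex → UnitAddCircle) → _)
      (fun _ => ν) (ν.prod (uniformPhases.prod uniformPhases)) := by
  have : SecondCountableTopologyEither (PrimeIndex → UnitAddCircle) (PrimeIndex → UnitAddCircle) :=
    ⟨Or.inl inferInstance⟩
  have : BorelSpace ((PrimeIndex → UnitAddCircle) × (PrimeIndex → UnitAddCircle)) :=
    Prod.borelSpace
  refine tendstoInDistribution_of_characters
    (A := (PrimeIndex →₀ ℤ) × (PrimeIndex →₀ ℤ))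
    (c := fun a y => torusPairing a.1 y.1 + torusPairing a.2 y.2)
    (fun t => ((aemeasurable_pi_lambda _ fun k : PrimeIndex => aemeasurable_phase h k t).prodMk
      (aemeasurable_pi_lambda _ fun k : PrimeIndex => aemeasurable_phase h (-k) t)).mono_ac hν)
    (fun a => ((continuous_torusPairing a.1).comp continuous_fst).add
      ((continuous_torusPairing a.2).comp continuous_snd))
    (fun a b y => ?_) (fun x y hxy => ?_) (fun a ha => ?_) fun a ha s hs => ?_
  · simp only [Prod.fst_add, Prod.snd_add, torusPairing_add]
    abel
  · by_cases h1 : x.1 = y.1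
    · obtain ⟨i, hi⟩ := Function.ne_iff.1 fun h2 : x.2 = y.2 => hxy (Prod.ext h1 h2)
      refine ⟨(0, Finsupp.single i 1), ?_⟩
      simpa only [torusPairing_single, torusPairing_zero, zero_add] using hi
    · obtain ⟨i, hi⟩ := Function.ne_iff.1 h1
      refine ⟨(Finsupp.single i 1, 0), ?_⟩
      simpa only [torusPairing_single, torusPairing_zero, add_zero] using hi
  · simp only [expCircle_add]
    rw [integral_prod_mul (fun y => expCircle (torusPairing a.1 y))
      (fun y => expCircle (torusPairing a.2 y))]
    by_cases h1 : a.1 = 0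
    · rw [integral_torusPairing (n := a.2) fun h2 => ha (Prod.ext h1 h2), mul_zero]
    · rw [integral_torusPairing h1, zero_mul]
  · exact tendsto_setIntegral_phase h hν a.1 a.2 ha (Or.inr hsym) hs

end

theorem proposition12
    (γ : ℝ → Plane) (Ω : Set Plane) (hγ : IsAnalyticOval γ Ω)
    -- the invariant (Haar) probability measure `μ` on the space of lattices
    (μ : Measure LatticeSpace) [IsProbabilityMeasure μ] [SMulInvariantMeasure SL2R LatticeSpace μ]
    -- the probability measure `ν` with smooth bounded density `σ` with respect to `μ`
    (σ : LatticeSpace → ℝ) (hσ_smooth : IsSmoothOnLattices σ) (hσ_nonneg : ∀ L, 0 ≤ σ L)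
    (hσ_bdd : ∃ C : ℝ, ∀ L, σ L ≤ C)
    (ν : Measure LatticeSpace) [IsProbabilityMeasure ν]
    (hν : ν = μ.withDensity fun L => ENNReal.ofReal (σ L)) :
    (∀ (l : ℕ) (ψ : LatticeSpace → ℂ), IsSmoothOnLattices ψ → HasCompactSupport ψ →
      ∀ k : Fin l → ℤ × ℤ, (∀ h, k h ∈ PrimeIndex) → Function.Injective k →
      ∀ p : Fin l → ℤ, p ≠ 0 →
        Tendsto (fun t : ℝ => ∫ L, ψ L * expCircle (∑ h, p h • phase γ (k h) t L) ∂ν)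
          atTop (𝓝 0)) ∧
    TendstoInDistribution
      (fun (t : ℝ) (L : LatticeSpace) => (L, fun k : PrimeIndex => phase γ k t L))
      atTop (id : LatticeSpace × (PrimeIndex → UnitAddCircle) → _)
      (fun _ => ν) (ν.prod uniformPhases) ∧
    (¬ HasCenterOfSymmetry Ω →
      (∀ (l : ℕ) (ψ : LatticeSpace → ℂ), IsSmoothOnLattices ψ → HasCompactSupport ψ →
        ∀ k : Fin l → ℤ × ℤ, (∀ h, k h ∈ PrimeIndex) → Function.Injective k →
        ∀ p q : Fin l → ℤ, (p, q) ≠ 0 →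
          Tendsto (fun t : ℝ => ∫ L, ψ L * expCircle
              (∑ h, p h • phase γ (k h) t L + ∑ h, q h • phase γ (-k h) t L) ∂ν)
            atTop (𝓝 0)) ∧
      TendstoInDistribution
        (fun (t : ℝ) (L : LatticeSpace) =>
          (L, (fun k : PrimeIndex => phase γ k t L), fun k : PrimeIndex => phase γ (-k) t L))
        atTop
        (id : LatticeSpace × (PrimeIndex → UnitAddCircle) × (PrimeIndex → UnitAddCircle) → _)
        (fun _ => ν) (ν.prod (uniformPhases.prod uniformPhases))) := by
  have hac : ν ≪ μ := hν ▸ withDensity_absolutelyContinuous _ _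
  refine ⟨fun l ψ hψ hsupp k hk hinj p hp => ?_, tendstoInDistribution_phases hγ hac,
    fun hsym => ⟨fun l ψ hψ hsupp k hk hinj p q hpq => ?_,
      tendstoInDistribution_symmetric_phases hγ hsym hac⟩⟩
  · obtain ⟨i, hi⟩ := Function.ne_iff.1 hp
    have key := tendsto_integral_phase hγ hac Finset.univ hk hinj (p := p) (q := 0)
      (Finset.mem_univ i) (Or.inl hi) (Or.inl rfl) (hψ.integrable hsupp ν)
    simpa only [Pi.zero_apply, zero_smul, Finset.sum_const_zero, add_zero] using key
  · obtain ⟨i, hi⟩ : ∃ i, p i ≠ 0 ∨ q i ≠ 0 := by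
      by_contra! hcon
      exact hpq (Prod.ext (funext fun i => (hcon i).1) (funext fun i => (hcon i).2))
    exact tendsto_integral_phase hγ hac Finset.univ hk hinj (Finset.mem_univ i) hi (Or.inr hsym)
      (hψ.integrable hsupp ν)
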